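/- Let $K$ be a number field with algebraic closure $\overline K$ and $\Gamma=\mathrm{Gal}(\overline K/K)$. For a finite place $v$ let $K_v$ be the completion, $p_v$ the residue characteristic and $n_v$ the degree of the residue field $k_v$ over $\mathbb F_{p_v}$; if $v$ is unramified over $\mathbb Q$, let $\sigma_v$ be the Frobenius automorphism of $K_v$ (the automorphism that preserves $\mathcal O_{K_v}$ and induces $x\mapsto x^{p_v}$ on $k_v$). **Target category.** An object of the Ogus category $\mathbf{Og}(K)$ is a triple $(V,(V_v,F_v)_{v\in\mathcal P'},(g_v)_{v\in\mathcal P'})$, where $\mathcal P'$ is a cofinite set of places unramified over $\mathbb Q$, $V$ is a finite dimensional $K$-vector space, $V_v$ is a finite dimensional $K_v$-vector space, $F_v\colon V_v\to V_v$ is bijective and $\sigma_v$-semilinear, and $g_v\colon V\otimes_KK_v\to V_v$ is a $K_v$-linear isomorphism. A morphism is a $K$-linear map $f\colon V\to V'$ such that for almost all $v$ the $K_v$-linear map $f_v\colon V_v\to V'_v$ corresponding to $f\otimes K_v$ under $g_v,g'_v$ satisfies $f_vF_v=F'_vf_v$. An object of $\mathbf{FOg}(K)$ is an object of $\mathbf{Og}(K)$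 with a finite increasing exhaustive filtration $0=W_m\subseteq\dots\subseteq W_n=V$ by subobjects in $\mathbf{Og}(K)$ such that, for each $i$ and almost all $v$, the eigenvalues of the $K_v$-linear map $F_v^{n_v}$ on $W_iV_v/W_{i-1}V_v$ are algebraic numbers all of whose complex conjugates have absolute value $p_v^{in_v/2}$; morphisms in $\mathbf{FOg}(K)$ are the morphisms in $\mathbf{Og}(K)$. **Source category.** $\mathcal M_{0,\mathbb Q}$ is the category of Artin motives up to isogeny, i.e. of $1$-motives $[L\to0]$ over $K$: its objects are the lattices over $K$, that is, free abelian groups $L$ of finite rank with a continuous (discrete) action of $\Gamma$, and the morphisms from $[L\to 0]$ to $[L'\to0]$ are the elements of $\mathrm{Hom}_\Gamma(L,L')\otimes_{\mathbb Z}\mathbb Q$. **Functor.** The Ogus realization $T_{\mathrm{Og}}\colon\mathcal M_{0,\mathbb Q}\to\mathbf{FOg}(K)$ sends $[L\to0]$ to the following object. Put $V=T_{\mathrm{dR}}([L\to0])=(L\otimes\overline K)^{\Gamma}$. Let $E\subset\overline K$ be the finite Galois extension of $K$ that is fixed by the kernel of $\Gamma\to\mathrm{Aut}(L)$, and let $\mathcal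 P'$ be the set of places $v$ that are unramified over $\mathbb Q$ and unramified in $E$. For $v\in\mathcal P'$ let $V_v=(L\otimes K_v\otimes_K\overline K)^{\Gamma}=(L\otimes K_v\otimes_KE)^{\mathrm{Gal}(E/K)}$, let $g_v$ be the canonical isomorphism, and let $F_v$ be the restriction of $1\otimes\varphi_v$, where $\varphi_v$ is the unique automorphism of $K_v\otimes_KE$ that preserves $\mathcal O_{K_v}\otimes_{\mathcal O_K}\mathcal O_E$ and induces $x\mapsto x^{p_v}$ on its quotient modulo $p_v$. The filtration is $W_i=0$ for $i<0$ and $W_i=V$ for $i\ge0$. On morphisms, $T_{\mathrm{Og}}(f\otimes q)$ is the restriction to $V$ of $q\cdot(f\otimes\mathrm{id}_{\overline K})$. **Lemma.** The functor $T_{\mathrm{Og}}\colon\mathcal M_{0,\mathbb Q}\to\mathbf{FOg}(K)$ is full. -/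

import Mathlib

noncomputable section

namespace OgusRealization

open IsDedekindDomain NumberField TensorProduct CategoryTheory Filter
open scoped WithZero


universe u

/-! ## Frobenius lifts on strict `p`-rings -/

section

/-- `σ` preserves the subring `A` of `B` and lifts the `p`-th power map of `A / p A`. -/
def IsFrobeniusLift {B : Type*} [CommRing B] (p : ℕ) (A : Subring B) (σ : B ≃+* B) : Prop :=
  ∀ a ∈ A, σ a ∈ A ∧ ∃ c ∈ A, σ a = a ^ p + p * c

open Classical in
/-- The automorphism of `B` that lifts the Frobenius of `A / p A`, if there is one. In the situation
of `IsStrict` below, it exists and is unique. -/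
def frobeniusLift {B : Type*} [CommRing B] (p : ℕ) (A : Subring B) : B ≃+* B :=
  if h : ∃ σ : B ≃+* B, IsFrobeniusLift p A σ then h.choose else RingEquiv.refl B

/-- `A` is a strict `p`-ring with perfect residue ring `A/p`, and `B = A[1/p]`. -/
structure IsStrict {B : Type*} [CommRing B] (p : ℕ) (A : Subring B) : Prop where
  complete : IsAdicComplete (Ideal.span {(p : A)}) A
  isUnit : IsUnit (p : B)
  not_isUnit : ¬ IsUnit (p : A)
  exists_pow : ∀ b : B, ∃ n : ℕ, (p : B) ^ n * b ∈ A
  surj : ∀ a : A, ∃ b c : A, a = b ^ p + p * c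
  inj : ∀ a c : A, a ^ p = p * c → ∃ d : A, a = p * d

open WittVector in
/-- A strict `p`-ring with perfect residue ring carries a lift of Frobenius. -/
theorem exists_lift {A : Type*} [CommRing A] (p : ℕ) [Fact p.Prime]
    (complete : IsAdicComplete (Ideal.span {(p : A)}) A) (not_isUnit : ¬ IsUnit (p : A))
    (tf : ∀ a : A, p * a = 0 → a = 0)
    (surj : ∀ a : A, ∃ b c : A, a = b ^ p + p * c)
    (inj : ∀ a c : A, a ^ p = p * c → ∃ d : A, a = p * d) :
    ∃ φ : A ≃+* A, ∀ a, ∃ c, φ a = a ^ p + p * c := by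
  have : Fact (¬ IsUnit (p : A)) := ⟨not_isUnit⟩
  have hF : Function.Surjective (frobenius (ModP A p) p) := by
    intro x
    obtain ⟨a, rfl⟩ := Ideal.Quotient.mk_surjective x
    obtain ⟨b, c, h⟩ := surj a
    refine ⟨Ideal.Quotient.mk _ b, ?_⟩
    rw [frobenius_def, ← map_pow]
    apply Ideal.Quotient.eq.mpr
    rw [Ideal.mem_span_singleton]
    exact ⟨-c, by rw [h]; ring⟩
  have hI : ∀ x : ModP A p, x ^ p = 0 → x = 0 := by
    intro x hx
    obtain ⟨a, rfl⟩ := Ideal.Quotient.mk_surjective x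
    rw [← map_pow] at hx
    have hx' := Ideal.Quotient.eq_zero_iff_mem.mp hx
    rw [Ideal.mem_span_singleton] at hx'
    obtain ⟨c, hc⟩ := hx'
    obtain ⟨d, hd⟩ := inj a c hc
    apply Ideal.Quotient.eq_zero_iff_mem.mpr
    rw [Ideal.mem_span_singleton]
    exact ⟨d, hd⟩
  have hs := surjective_fontaineTheta (R := A) (p := p) hF
  have h0 : ∀ x : WittVector p (PreTilt A p), fontaineTheta A p x = 0 →
      ∃ y, x = p * y ∧ fontaineTheta A p y = 0 := by
    intro x hx
    have h1 := mk_fontaineTheta (R := A) (p := p) x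
    rw [hx, map_zero] at h1
    have h2' : ∀ n, PreTilt.coeff n (x.coeff 0) = 0 := by
      intro n
      induction n with
      | zero => exact h1.symm
      | succ n ih =>
        apply hI
        rw [← ih]
        exact Perfection.coeff_pow_p' _ _
    have h2 : x.coeff 0 = 0 := Perfection.ext fun n => (h2' n).trans (map_zero (PreTilt.coeff n)).symm
    have h3 := (mem_span_p_iff_coeff_zero_eq_zero x).mpr h2
    rw [Ideal.mem_span_singleton] at h3
    obtain ⟨y, hy⟩ := h3
    refine ⟨y, hy, tf _ ?_⟩
    rw [hy, map_mul, map_natCast] at hx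
    exact hx
  have hinj : Function.Injective (fontaineTheta A p) := by
    rw [injective_iff_map_eq_zero]
    intro x hx
    have h4 : ∀ n : ℕ, ∀ x, fontaineTheta A p x = 0 → ∃ y, x = (p : WittVector p (PreTilt A p)) ^ n * y := by
      intro n
      induction n with
      | zero => intro x _; exact ⟨x, by simp⟩
      | succ n ih =>
        intro x hx
        obtain ⟨y, rfl, hy⟩ := h0 x hx
        obtain ⟨z, rfl⟩ := ih y hy
        exact ⟨z, by ring⟩
    ext n
    obtain ⟨y, hy⟩ := h4 (n+1) x hx
    have := (mem_span_p_pow_iff_le_coeff_eq_zero x (n+1)).mp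
      (by rw [Ideal.mem_span_singleton]; exact ⟨y, hy⟩) n (by omega)
    simpa using this
  let θ := RingEquiv.ofBijective (fontaineTheta A p) ⟨hinj, hs⟩
  refine ⟨(θ.symm.trans (WittVector.frobeniusEquiv p (PreTilt A p))).trans θ, fun a => ?_⟩
  obtain ⟨x, rfl⟩ := θ.surjective a
  have h5 : (WittVector.frobenius x - x ^ p).coeff 0 = 0 := by
    have : constantCoeff (WittVector.frobenius x - x ^ p) = 0 := by
      rw [map_sub, map_pow]
      change (WittVector.frobenius x).coeff 0 - x.coeff 0 ^ p = 0
      rw [coeff_frobenius_charP, sub_self]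
    exact this
  have h3 := (mem_span_p_iff_coeff_zero_eq_zero _).mpr h5
  rw [Ideal.mem_span_singleton] at h3
  obtain ⟨y, hy⟩ := h3
  refine ⟨θ y, ?_⟩
  simp only [RingEquiv.coe_trans, Function.comp_apply, RingEquiv.symm_apply_apply]
  rw [← map_pow, ← map_natCast θ p, ← map_mul, ← map_add, ← hy]
  congr 1
  change WittVector.frobenius x = _
  ring

theorem IsStrict.exists_isFrobeniusLift {B : Type*} [CommRing B] {p : ℕ} [hp : Fact p.Prime]
    {A : Subring B} (h : IsStrict p A) : ∃ σ : B ≃+* B, IsFrobeniusLift p A σ := by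
  have tf : ∀ a : A, p * a = 0 → a = 0 := by
    intro a ha
    have := congrArg Subtype.val ha
    simp only [Subring.coe_mul, Subring.coe_natCast, ZeroMemClass.coe_zero] at this
    exact Subtype.ext ((h.isUnit.mul_right_eq_zero).mp this)
  obtain ⟨φ, hφ⟩ := exists_lift p h.complete h.not_isUnit tf h.surj h.inj
  let : Algebra A B := A.subtype.toAlgebra
  have hmap : ∀ a : A, algebraMap A B a = a := fun _ => rfl
  have : IsLocalization.Away (p : A) B := by
    refine ⟨?_, ?_, ?_⟩
    · rintro ⟨_, n, rfl⟩
      simpa [hmap] using h.isUnit.pow n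
    · intro b
      obtain ⟨n, hn⟩ := h.exists_pow b
      exact ⟨(⟨_, hn⟩, ⟨_, n, rfl⟩), by simp [hmap, mul_comm]⟩
    · intro x y hxy
      exact ⟨1, by rw [Subtype.ext hxy]⟩
  have hH : (Submonoid.powers (p : A)).map (φ : A ≃+* A).toMonoidHom = Submonoid.powers (p : A) := by
    rw [Submonoid.map_powers]
    simp
  refine ⟨IsLocalization.ringEquivOfRingEquiv B B φ hH, fun a ha => ?_⟩
  have : IsLocalization.ringEquivOfRingEquiv B B φ hH a = φ ⟨a, ha⟩ := by
    exact IsLocalization.ringEquivOfRingEquiv_eq (S := B) (Q := B) hH ⟨a, ha⟩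
  rw [this]
  obtain ⟨c, hc⟩ := hφ ⟨a, ha⟩
  refine ⟨(φ ⟨a, ha⟩).2, c, c.2, ?_⟩
  rw [hc]; simp

theorem IsStrict.isFrobeniusLift {B : Type*} [CommRing B] {p : ℕ} [hp : Fact p.Prime]
    {A : Subring B} (h : IsStrict p A) : IsFrobeniusLift p A (frobeniusLift p A) := by
  have h' := h.exists_isFrobeniusLift
  unfold frobeniusLift
  rw [dif_pos h']
  exact h'.choose_spec

/-- Homomorphisms that agree modulo `p` are equal. -/
theorem IsStrict.hom_ext {B B' : Type*} [CommRing B] [CommRing B'] {p : ℕ} [hp : Fact p.Prime]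
    {A : Subring B} {A' : Subring B'} (h : IsStrict p A) (h' : IsStrict p A')
    (f g : B →+* B') (hf : ∀ a ∈ A, f a ∈ A') (hg : ∀ a ∈ A, g a ∈ A')
    (hfg : ∀ a ∈ A, ∃ c ∈ A', f a = g a + p * c) : f = g := by
  have key : ∀ n : ℕ, ∀ a ∈ A, ∃ c ∈ A', f a = g a + (p : B') ^ (n + 1) * c := by
    intro n
    induction n with
    | zero => simpa using hfg
    | succ n ih =>
      intro a ha
      obtain ⟨b, c, hbc⟩ := h.surj ⟨a, ha⟩
      have hbc' : a = (b : B) ^ p + p * c := by simpa using congrArg Subtype.val hbc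
      obtain ⟨d, hd, hd'⟩ := ih b b.2
      obtain ⟨e, he, he'⟩ := ih c c.2
      have h1 : ∃ u ∈ A', (g b + (p : B') ^ (n + 1) * d) ^ p = g b ^ p + (p : B') ^ (n + 2) * u := by
        obtain ⟨r, hr⟩ := exists_add_pow_prime_eq hp.out (⟨g b, hg _ b.2⟩ : A')
          ((p : A') ^ (n + 1) * ⟨d, hd⟩)
        have hr' := congrArg Subtype.val hr
        simp only [Subring.coe_add, Subring.coe_mul, Subring.coe_pow, Subring.coe_natCast] at hr'
        obtain ⟨k, hk⟩ : ∃ k, (n + 1) * p = n + 2 + k :=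
          Nat.exists_eq_add_of_le (by nlinarith [hp.out.two_le])
        refine ⟨p ^ k * d ^ p + g b * d * r, ?_, ?_⟩
        · exact add_mem (mul_mem (pow_mem (natCast_mem A' p) _) (pow_mem hd _))
            (mul_mem (mul_mem (hg _ b.2) hd) r.2)
        · rw [hr', mul_pow, ← pow_mul, hk]
          ring
      obtain ⟨u, hu, hu'⟩ := h1
      refine ⟨u + e, add_mem hu he, ?_⟩
      rw [hbc', map_add, map_pow, map_mul, map_natCast, map_add, map_pow, map_mul, map_natCast,
        hd', he', hu']
      ring
  have hA : ∀ a ∈ A, f a = g a := by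
    intro a ha
    have := h'.complete.toIsHausdorff.haus (⟨f a, hf a ha⟩ - ⟨g a, hg a ha⟩ : A') (fun n => by
      rw [SModEq.zero, smul_eq_mul, Ideal.mul_top, Ideal.span_singleton_pow, Ideal.mem_span_singleton]
      obtain ⟨c, hc, e⟩ := key n a ha
      refine ⟨p * ⟨c, hc⟩, Subtype.ext ?_⟩
      simp [e]; ring)
    have := congrArg Subtype.val this
    exact sub_eq_zero.mp (by simpa using this)
  ext b
  obtain ⟨n, hn⟩ := h.exists_pow b
  have h1 := hA _ hn
  simp only [map_mul, map_pow, map_natCast] at h1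
  exact (h'.isUnit.pow n).mul_left_cancel h1

end

/-! ## A criterion for strict `p`-rings -/

section

/-- A criterion for `IsStrict`. -/
theorem IsStrict.mk' {R B : Type*} [CommRing R] [CommRing B] {p : ℕ} [hp : Fact p.Prime]
    {A : Subring B} (I : Ideal R) [Finite (R ⧸ I)] [IsReduced (R ⧸ I)] (hpI : (p : R) ∈ I)
    (f : R →+* B) (hfA : ∀ r, f r ∈ A) (hI : ∀ r ∈ I, ∃ c ∈ A, f r = p * c)
    (hd : ∀ a ∈ A, ∃ r, ∃ c ∈ A, a = f r + p * c)
    (complete : IsAdicComplete (Ideal.span {(p : A)}) A) (isUnit : IsUnit (p : B))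
    (not_isUnit : ¬ IsUnit (p : A)) (exists_pow : ∀ b : B, ∃ n : ℕ, (p : B) ^ n * b ∈ A) :
    IsStrict p A ∧
      (∀ m : ℕ, (∀ x : R ⧸ I, x ^ p ^ m = x) → ∀ a ∈ A, ∃ c ∈ A, a ^ p ^ m = a + p * c) ∧
      ∃ m : ℕ, 0 < m ∧ ∀ x : R ⧸ I, x ^ p ^ m = x := by
  have hI1 : I ≠ ⊤ := by
    intro h
    obtain ⟨c, hc, h1⟩ := hI 1 (h ▸ Submodule.mem_top)
    rw [map_one] at h1
    exact not_isUnit (IsUnit.of_mul_eq_one ⟨c, hc⟩ (Subtype.ext (by simpa using h1.symm)))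
  have hpR : ((p : ℕ) : R ⧸ I) = 0 := by
    rw [← map_natCast (Ideal.Quotient.mk I)]
    exact Ideal.Quotient.eq_zero_iff_mem.mpr hpI
  have : Nontrivial (R ⧸ I) := Ideal.Quotient.nontrivial_iff.mpr hI1
  have : CharP (R ⧸ I) p := (CharP.charP_iff_prime_eq_zero hp.out).mpr hpR
  have hinj : Function.Injective (frobenius (R ⧸ I) p) := frobenius_inj _ _
  have hbij : Function.Bijective (frobenius (R ⧸ I) p) := Finite.injective_iff_bijective.mp hinj
  -- Frobenius on A/p
  have hsurj : ∀ a : A, ∃ b c : A, a = b ^ p + p * c := by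
    intro a
    obtain ⟨r, c, hc, h1⟩ := hd a a.2
    obtain ⟨s, hs⟩ := hbij.2 (Ideal.Quotient.mk I r)
    obtain ⟨s, rfl⟩ := Ideal.Quotient.mk_surjective s
    rw [frobenius_def, ← map_pow] at hs
    obtain ⟨d, hd, h2⟩ := hI _ (Ideal.Quotient.eq.mp hs)
    refine ⟨⟨f s, hfA s⟩, ⟨c, hc⟩ - ⟨d, hd⟩, Subtype.ext ?_⟩
    rw [map_sub, map_pow] at h2
    simp only [Subring.coe_add, Subring.coe_pow, Subring.coe_mul, Subring.coe_natCast,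
      AddSubgroupClass.coe_sub]
    linear_combination h1 - h2
  obtain ⟨m, hm, hm'⟩ : ∃ m : ℕ, 0 < m ∧ ∀ x : R ⧸ I, x ^ p ^ m = x := by
    let e : Equiv.Perm (R ⧸ I) := Equiv.ofBijective _ hbij
    obtain ⟨m, hm, h⟩ := (isOfFinOrder_of_finite e).exists_pow_eq_one
    refine ⟨m, hm, fun x => ?_⟩
    have := congrArg (fun g : Equiv.Perm (R ⧸ I) => g x) h
    rw [← iterate_frobenius]
    simpa [Equiv.Perm.coe_pow, e, ← Equiv.Perm.iterate_eq_pow] using this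
  have hpow : ∀ m : ℕ, (∀ x : R ⧸ I, x ^ p ^ m = x) →
      ∀ a ∈ A, ∃ c ∈ A, a ^ p ^ m = a + p * c := by
    intro m hm' a ha
    obtain ⟨r, c, hc, h1⟩ := hd a ha
    have h2 : Ideal.Quotient.mk I (r ^ p ^ m) = Ideal.Quotient.mk I r := by
      rw [map_pow, hm']
    obtain ⟨d, hd, h3⟩ := hI _ (Ideal.Quotient.eq.mp h2)
    rw [map_sub, map_pow] at h3
    have h4 : ∃ u ∈ A, a ^ p ^ m = (f r) ^ p ^ m + p * u := by
      have : (p : A) ∣ (⟨a, ha⟩ : A) ^ p ^ m - (⟨f r, hfA r⟩ : A) ^ p ^ m :=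
        dvd_trans ⟨⟨c, hc⟩, Subtype.ext (by simp [h1])⟩ (sub_dvd_pow_sub_pow _ _ _)
      obtain ⟨u, hu⟩ := this
      have hu' := congrArg Subtype.val hu
      simp only [AddSubgroupClass.coe_sub, Subring.coe_pow, Subring.coe_mul,
        Subring.coe_natCast] at hu'
      exact ⟨u, u.2, by linear_combination hu'⟩
    obtain ⟨u, hu, h5⟩ := h4
    refine ⟨u + d - c, sub_mem (add_mem hu hd) hc, ?_⟩
    rw [h5]
    linear_combination h3 - h1
  refine ⟨⟨complete, isUnit, not_isUnit, exists_pow, hsurj, ?_⟩, hpow, m, hm, hm'⟩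
  intro a c hac
  obtain ⟨d, hd, h1⟩ := hpow m hm' a a.2
  obtain ⟨k, hk⟩ : ∃ k, p ^ m = p + k :=
    Nat.exists_eq_add_of_le (by simpa using Nat.pow_le_pow_right hp.out.pos hm)
  refine ⟨c * a ^ k - ⟨d, hd⟩, Subtype.ext ?_⟩
  have hac' := congrArg Subtype.val hac
  simp only [Subring.coe_pow, Subring.coe_mul, Subring.coe_natCast] at hac'
  rw [hk, pow_add, hac'] at h1
  simp only [AddSubgroupClass.coe_sub, Subring.coe_pow, Subring.coe_mul, Subring.coe_natCast]
  linear_combination -h1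

theorem IsStrict.frobeniusLift_pow {B : Type*} [CommRing B] {p : ℕ} [hp : Fact p.Prime]
    {A : Subring B} (h : IsStrict p A) (m : ℕ)
    (hm : ∀ a ∈ A, ∃ c ∈ A, a ^ p ^ m = a + p * c) (b : B) :
    (frobeniusLift p A)^[m] b = b := by
  have hl := h.isFrobeniusLift
  have key : ∀ n : ℕ, ∀ a ∈ A, (frobeniusLift p A)^[n] a ∈ A ∧
      ∃ c ∈ A, (frobeniusLift p A)^[n] a = a ^ p ^ n + p * c := by
    intro n
    induction n with
    | zero => intro a ha; exact ⟨ha, 0, zero_mem _, by simp⟩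
    | succ n ih =>
      intro a ha
      obtain ⟨h1, c, hc, h2⟩ := ih a ha
      obtain ⟨h3, d, hd, h4⟩ := hl _ h1
      obtain ⟨h5, e, he, h6⟩ := hl _ (pow_mem ha (p ^ n))
      rw [Function.iterate_succ_apply']
      refine ⟨h3, frobeniusLift p A c + e, add_mem (hl c hc).1 he, ?_⟩
      rw [h2, map_add, h6, map_mul, map_natCast, pow_succ p n, pow_mul]
      ring
  have h0 : ((frobeniusLift p A : B →+* B) ^ m : B →+* B) = RingHom.id B := by
    apply h.hom_ext h
    · intro a ha
      rw [RingHom.coe_pow]; exact (key m a ha).1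
    · intro a ha; exact ha
    · intro a ha
      obtain ⟨_, c, hc, h1⟩ := key m a ha
      obtain ⟨d, hd, h2⟩ := hm a ha
      refine ⟨c + d, add_mem hc hd, ?_⟩
      rw [RingHom.coe_pow]
      change (frobeniusLift p A)^[m] a = a + _
      rw [h1, h2]; ring
  have h1 := congrArg (fun g : B →+* B => g b) h0
  rw [RingHom.coe_pow] at h1
  exact h1

end

/-! ## The completions `K_v` and their Frobenius automorphisms -/

section

variable {K : Type*} [Field K] [NumberField K]

/-- The residue characteristic `p_v`. -/
def residueChar (v : HeightOneSpectrum (𝓞 K)) : ℕ := ringChar (𝓞 K ⧸ v.asIdeal)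

/-- The degree `n_v` of the residue field over its prime field. -/
def residueDegree (v : HeightOneSpectrum (𝓞 K)) : ℕ := v.asIdeal.inertiaDeg ℤ

/-- The canonical Frobenius automorphism `σ_v` of `K_v` (for `v` unramified over `ℚ`): it preserves
`𝒪_{K_v}` and lifts the `p_v`-th power map of `𝒪_{K_v} / p_v`. -/
def frob (v : HeightOneSpectrum (𝓞 K)) : v.adicCompletion K ≃+* v.adicCompletion K :=
  frobeniusLift (residueChar v) (v.adicCompletionIntegers K).toSubring

/-- The place `v` is unramified over `ℚ`. -/
def IsUnramified (v : HeightOneSpectrum (𝓞 K)) : Prop := Algebra.IsUnramifiedAt ℤ v.asIdeal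

instance finite_residue (v : HeightOneSpectrum (𝓞 K)) : Finite (𝓞 K ⧸ v.asIdeal) :=
  v.asIdeal.finiteQuotientOfFreeOfNeBot v.ne_bot

instance fact_prime_residueChar (v : HeightOneSpectrum (𝓞 K)) : Fact (residueChar v).Prime := by
  have := v.isPrime
  exact ⟨CharP.char_is_prime (𝓞 K ⧸ v.asIdeal) _⟩

theorem residueChar_mem (v : HeightOneSpectrum (𝓞 K)) : (residueChar v : 𝓞 K) ∈ v.asIdeal := by
  rw [← Ideal.Quotient.eq_zero_iff_mem, map_natCast]
  exact CharP.cast_eq_zero _ _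

theorem liesOver_residueChar (v : HeightOneSpectrum (𝓞 K)) :
    v.asIdeal.LiesOver (Ideal.span {(residueChar v : ℤ)}) :=
  (Ideal.liesOver_span_iff v.isPrime.ne_top (Nat.prime_iff_prime_int.mp (Fact.out))).mpr
    (by simpa using residueChar_mem v)

/-- An unramified prime does not occur with multiplicity. -/
theorem not_le_sq {R S : Type*} [CommRing R] [CommRing S] [Algebra R S] [IsDedekindDomain S]
    [Algebra.EssFiniteType R S] (P : Ideal S) [P.IsPrime] (hP : P ≠ ⊥)
    (p : Ideal R) [p.IsPrime] [P.LiesOver p] (h : Algebra.IsUnramifiedAt R P) :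
    ¬ p.map (algebraMap R S) ≤ P ^ 2 := by
  let := Localization.AtPrime.algebraOfLiesOver p P
  have h1 := ((Algebra.isUnramifiedAt_iff_map_eq R p P).mp h).2
  have hle : p.map (algebraMap R S) ≤ P := by
    rw [Ideal.map_le_iff_le_comap]; exact (Ideal.LiesOver.over (p := p) (P := P)).le
  rw [← Ideal.ramificationIdx'_ne_one_iff hle, not_not]
  exact (Ideal.IsDedekindDomain.ramificationIdx'_eq_one_iff hP hle).mpr h1

theorem valued_residueChar {v : HeightOneSpectrum (𝓞 K)} (hv : IsUnramified v) :
    Valued.v ((residueChar v : ℕ) : v.adicCompletion K) = WithZero.exp (-1 : ℤ) := by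
  have := liesOver_residueChar v
  have := v.isPrime
  have hprime : (Ideal.span {(residueChar v : ℤ)}).IsPrime :=
    (Ideal.span_singleton_prime (by exact_mod_cast (Fact.out : (residueChar v).Prime).ne_zero)).mpr
      (Nat.prime_iff_prime_int.mp Fact.out)
  have h1 := not_le_sq v.asIdeal v.ne_bot (Ideal.span {(residueChar v : ℤ)}) hv
  rw [Ideal.map_span, Set.image_singleton, Ideal.span_singleton_le_iff_mem,
    ← v.intValuation_le_pow_iff_mem] at h1
  have h2 : v.intValuation (residueChar v : 𝓞 K) ≤ WithZero.exp (-(1:ℕ) : ℤ) :=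
    (v.intValuation_le_pow_iff_mem _ 1).mpr (by simpa using residueChar_mem v)
  have h3 : Valued.v ((residueChar v : ℕ) : v.adicCompletion K)
      = v.intValuation (residueChar v : 𝓞 K) := by
    rw [← v.valuation_of_algebraMap (K := K), ← HeightOneSpectrum.valuedAdicCompletion_eq_valuation]
    simp
  rw [h3]
  simp only [eq_intCast, Int.cast_natCast, not_le] at h1
  apply le_antisymm (by simpa using h2)
  have hne : v.intValuation (residueChar v : 𝓞 K) ≠ 0 := by
    intro h; rw [h] at h1; simp at h1
  rw [← WithZero.exp_log hne] at h1 ⊢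
  rw [WithZero.exp_lt_exp] at h1
  rw [WithZero.exp_le_exp]
  push_cast at h1
  omega

theorem ball_mem_nhds {v : HeightOneSpectrum (𝓞 K)} (hv : IsUnramified v)
    (L : v.adicCompletion K) (n : ℕ) :
    {y | Valued.v (y - L) < WithZero.exp (-n : ℤ)} ∈ nhds L := by
  have hp : Valued.v (((residueChar v : ℕ) : v.adicCompletion K) ^ n) = WithZero.exp (-n : ℤ) := by
    rw [map_pow, valued_residueChar hv, ← WithZero.exp_nsmul]; simp
  rw [Valued.mem_nhds]
  have h0 : (Valued.v (R := v.adicCompletion K)).restrict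
      (((residueChar v : ℕ) : v.adicCompletion K) ^ n) ≠ 0 := by
    rw [Ne, Valuation.restrict_eq_zero_iff, hp]; exact WithZero.exp_ne_zero
  refine ⟨Units.mk0 _ h0, fun y hy => ?_⟩
  rw [← hp]
  exact (Valuation.restrict_lt_iff _).mp hy

theorem isAdicComplete_integers {v : HeightOneSpectrum (𝓞 K)} (hv : IsUnramified v) :
    IsAdicComplete (Ideal.span {((residueChar v : ℕ) : v.adicCompletionIntegers K)})
      (v.adicCompletionIntegers K) := by
  have hp := valued_residueChar hv
  have hmem : ∀ (n : ℕ) (x : v.adicCompletionIntegers K),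
      x ∈ Ideal.span {((residueChar v : ℕ) : v.adicCompletionIntegers K)} ^ n ↔
        Valued.v (x : v.adicCompletion K) ≤ WithZero.exp (-n : ℤ) := by
    intro n x
    rw [Ideal.span_singleton_pow, Ideal.mem_span_singleton]
    rw [(HeightOneSpectrum.adicCompletionIntegers.integers (K := K) (v := v)).dvd_iff_le]
    change Valued.v (x : v.adicCompletion K) ≤ Valued.v ((((residueChar v : ℕ) : v.adicCompletionIntegers K) ^ n : v.adicCompletionIntegers K) : v.adicCompletion K) ↔ _
    have : ((((residueChar v : ℕ) : v.adicCompletionIntegers K) ^ n : v.adicCompletionIntegers K) : v.adicCompletion K) = ((residueChar v : ℕ) : v.adicCompletion K) ^ n := by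
      push_cast; rfl
    rw [this, map_pow, hp, ← WithZero.exp_nsmul]
    simp
  have key : ∀ x : v.adicCompletion K, (∀ n : ℕ, Valued.v x ≤ WithZero.exp (-n : ℤ)) → x = 0 := by
    intro x hx
    by_contra h
    have h0 : (Valued.v x : ℤᵐ⁰) ≠ 0 := (Valuation.ne_zero_iff _).mpr h
    have h1 := hx (WithZero.log (Valued.v x : ℤᵐ⁰)).natAbs.succ
    rw [← WithZero.exp_log h0, WithZero.exp_le_exp] at h1
    simp only [WithZero.log_exp] at h1
    omega
  refine { haus' := ?_, prec' := ?_ }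
  · intro x hx
    apply Subtype.ext
    apply key
    intro n
    have := hx n
    rw [SModEq.zero, smul_eq_mul, Ideal.mul_top, hmem] at this
    exact this
  · intro f hf
    simp only [SModEq.sub_mem, smul_eq_mul, Ideal.mul_top, hmem] at hf ⊢
    have hc : CauchySeq (fun n => (f n : v.adicCompletion K)) := by
      rw [CauchySeq, Valued.cauchy_iff]
      refine ⟨inferInstance, fun γ => ?_⟩
      have hg : MonoidWithZeroHom.ValueGroup₀.embedding γ.1 ≠ (0 : ℤᵐ⁰) := by
        rw [Ne, map_eq_zero_iff _ MonoidWithZeroHom.ValueGroup₀.embedding_strictMono.injective]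
        exact γ.ne_zero
      obtain ⟨N, hN⟩ : ∃ N : ℕ, WithZero.exp (-N : ℤ) <
          (MonoidWithZeroHom.ValueGroup₀.embedding γ.1 : ℤᵐ⁰) := by
        refine ⟨(WithZero.log (MonoidWithZeroHom.ValueGroup₀.embedding γ.1 : ℤᵐ⁰)).natAbs.succ, ?_⟩
        rw [← WithZero.exp_log hg, WithZero.exp_lt_exp]
        simp only [WithZero.log_exp]
        omega
      refine ⟨(fun n => (f n : v.adicCompletion K)) '' Set.Ici N,
        Filter.image_mem_map (Filter.mem_atTop N), ?_⟩
      rintro _ ⟨a, ha, rfl⟩ _ ⟨b, hb, rfl⟩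
      rw [Valuation.restrict_lt_iff_lt_embedding]
      refine lt_of_le_of_lt ?_ hN
      rcases le_total a b with hab | hab
      · have h1 := hf hab
        rw [Valuation.map_sub_swap]
        refine h1.trans ?_
        rw [WithZero.exp_le_exp]
        simpa using ha
      · have h1 := hf hab
        refine h1.trans ?_
        rw [WithZero.exp_le_exp]
        simpa using hb
    obtain ⟨L, hL⟩ := cauchySeq_tendsto_of_complete hc
    have hcl : ∀ n, Valued.v ((f n : v.adicCompletion K) - L) ≤ WithZero.exp (-n : ℤ) := by
      intro n
      obtain ⟨k, hk1, hk2⟩ := ((hL.eventually (ball_mem_nhds hv L n)).and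
        (Filter.eventually_ge_atTop n)).exists
      have : (f n : v.adicCompletion K) - L = (f n - f k) + (f k - L) := by ring
      rw [this]
      exact (Valuation.map_add _ _ _).trans (max_le (hf hk2) hk1.le)
    have hLi : L ∈ v.adicCompletionIntegers K := by
      have : L = f 0 - (f 0 - L) := by ring
      rw [this]
      refine sub_mem (f 0).2 ?_
      rw [HeightOneSpectrum.mem_adicCompletionIntegers]
      simpa using hcl 0
    exact ⟨⟨L, hLi⟩, fun n => hcl n⟩

theorem exists_integer_add {v : HeightOneSpectrum (𝓞 K)} (hv : IsUnramified v)
    (x : v.adicCompletionIntegers K) : ∃ (r : 𝓞 K) (c : v.adicCompletionIntegers K),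
      x = algebraMap (𝓞 K) (v.adicCompletionIntegers K) r + (residueChar v : ℕ) * c := by
  obtain ⟨k, hk⟩ := (HeightOneSpectrum.denseRange_algebraMap K v).exists_mem_open
    isOpen_interior ⟨(x : v.adicCompletion K),
      mem_interior_iff_mem_nhds.mpr (ball_mem_nhds hv (x : v.adicCompletion K) 0)⟩
  have hk1 : Valued.v (algebraMap K (v.adicCompletion K) k - x) < 1 := by
    simpa using interior_subset hk
  have hk2 : v.valuation K k ≤ 1 := by
    rw [← HeightOneSpectrum.valuedAdicCompletion_eq_valuation']
    have : algebraMap K (v.adicCompletion K) k = (algebraMap K (v.adicCompletion K) k - x) + x := by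
      ring
    change Valued.v (algebraMap K (v.adicCompletion K) k) ≤ 1
    rw [this]
    exact (Valuation.map_add _ _ _).trans (max_le hk1.le x.2)
  obtain ⟨r, hr⟩ := v.exists_valuation_sub_lt_of_integer hk2 1
  have h1 : Valued.v ((x : v.adicCompletion K) - algebraMap K (v.adicCompletion K) (algebraMap (𝓞 K) K r)) < 1 := by
    have e : (x : v.adicCompletion K) - algebraMap K (v.adicCompletion K) (algebraMap (𝓞 K) K r)
      = -((algebraMap K (v.adicCompletion K) k - x) + (algebraMap K (v.adicCompletion K) (algebraMap (𝓞 K) K r - k))) := by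
      rw [map_sub]; ring
    rw [e, Valuation.map_neg]
    refine (Valuation.map_add _ _ _).trans_lt (max_lt hk1 ?_)
    change Valued.v ((algebraMap (𝓞 K) K r - k : K) : v.adicCompletion K) < 1
    rw [HeightOneSpectrum.valuedAdicCompletion_eq_valuation']
    simpa using hr
  have h2 : ((residueChar v : ℕ) : v.adicCompletionIntegers K) ∣
      x - algebraMap (𝓞 K) (v.adicCompletionIntegers K) r := by
    rw [(HeightOneSpectrum.adicCompletionIntegers.integers (K := K) (v := v)).dvd_iff_le]
    change Valued.v ((x : v.adicCompletion K) - algebraMap K (v.adicCompletion K) (algebraMap (𝓞 K) K r)) ≤ Valued.v ((residueChar v : ℕ) : v.adicCompletion K)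
    rw [valued_residueChar hv]
    by_cases h0 : Valued.v ((x : v.adicCompletion K) - algebraMap K (v.adicCompletion K) (algebraMap (𝓞 K) K r)) = 0
    · rw [h0]; exact zero_le
    · rw [← WithZero.exp_log h0] at h1 ⊢
      rw [← WithZero.exp_zero, WithZero.exp_lt_exp] at h1
      rw [WithZero.exp_le_exp]
      omega
  obtain ⟨c, hc⟩ := h2
  exact ⟨r, c, by rw [← hc]; ring⟩

theorem exists_eq_mul {v : HeightOneSpectrum (𝓞 K)} (hv : IsUnramified v) {r : 𝓞 K}
    (hr : r ∈ v.asIdeal) : ∃ c : v.adicCompletionIntegers K,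
      algebraMap (𝓞 K) (v.adicCompletionIntegers K) r = (residueChar v : ℕ) * c := by
  change ((residueChar v : ℕ) : v.adicCompletionIntegers K) ∣ _
  rw [(HeightOneSpectrum.adicCompletionIntegers.integers (K := K) (v := v)).dvd_iff_le]
  change Valued.v ((algebraMap (𝓞 K) K r : K) : v.adicCompletion K) ≤
    Valued.v ((residueChar v : ℕ) : v.adicCompletion K)
  rw [valued_residueChar hv, HeightOneSpectrum.valuedAdicCompletion_eq_valuation',
    HeightOneSpectrum.valuation_of_algebraMap]
  simpa using (v.intValuation_le_pow_iff_mem r 1).mpr (by simpa using hr)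

theorem residueChar_ne_zero (v : HeightOneSpectrum (𝓞 K)) :
    ((residueChar v : ℕ) : v.adicCompletion K) ≠ 0 := by
  have : CharZero (v.adicCompletion K) := algebraRat.charZero _
  exact_mod_cast (Fact.out : (residueChar v).Prime).ne_zero

theorem not_isUnit_residueChar {v : HeightOneSpectrum (𝓞 K)} (hv : IsUnramified v) :
    ¬ IsUnit ((residueChar v : ℕ) : v.adicCompletionIntegers K) := by
  rw [HeightOneSpectrum.adicCompletionIntegers.isUnit_iff_valued_eq_one]
  change ¬ Valued.v ((residueChar v : ℕ) : v.adicCompletion K) = 1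
  rw [valued_residueChar hv, ← WithZero.exp_zero, WithZero.exp_inj]
  decide

theorem exists_pow_mul_mem {v : HeightOneSpectrum (𝓞 K)} (hv : IsUnramified v)
    (x : v.adicCompletion K) :
    ∃ n : ℕ, ((residueChar v : ℕ) : v.adicCompletion K) ^ n * x ∈ v.adicCompletionIntegers K := by
  by_cases hx : x = 0
  · exact ⟨0, by simp [hx]⟩
  have h0 : (Valued.v x : ℤᵐ⁰) ≠ 0 := (Valuation.ne_zero_iff _).mpr hx
  refine ⟨(WithZero.log (Valued.v x : ℤᵐ⁰)).natAbs, ?_⟩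
  rw [HeightOneSpectrum.mem_adicCompletionIntegers, map_mul, map_pow, valued_residueChar hv,
    ← WithZero.exp_nsmul]
  nth_rewrite 2 [← WithZero.exp_log h0]
  rw [← WithZero.exp_add, ← WithZero.exp_zero, WithZero.exp_le_exp]
  simp only [smul_neg, nsmul_eq_mul, mul_one]
  omega

theorem pow_card_residue (v : HeightOneSpectrum (𝓞 K)) (x : 𝓞 K ⧸ v.asIdeal) :
    x ^ (residueChar v) ^ (residueDegree v) = x := by
  have := v.isPrime
  have := v.isMaximal
  have := liesOver_residueChar v
  let := Ideal.Quotient.field v.asIdeal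
  let := Fintype.ofFinite (𝓞 K ⧸ v.asIdeal)
  have h := Ideal.pow_inertiaDeg (residueChar v) v.asIdeal
  have h2 : Fintype.card (𝓞 K ⧸ v.asIdeal) = residueChar v ^ residueDegree v := by
    rw [← Nat.card_eq_fintype_card]
    exact h.symm
  rw [← h2]
  exact FiniteField.pow_card x

theorem isStrict_integers {v : HeightOneSpectrum (𝓞 K)} (hv : IsUnramified v) :
    IsStrict (residueChar v) (v.adicCompletionIntegers K).toSubring ∧
      ∀ x, (frob v)^[residueDegree v] x = x := by
  have := v.isPrime
  have h := IsStrict.mk' (A := (v.adicCompletionIntegers K).toSubring) (p := residueChar v)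
    v.asIdeal (residueChar_mem v) ((algebraMap K (v.adicCompletion K)).comp (algebraMap (𝓞 K) K))
    (fun r => (algebraMap (𝓞 K) (v.adicCompletionIntegers K) r).2)
    (fun r hr => by
      obtain ⟨c, hc⟩ := exists_eq_mul hv hr
      exact ⟨c, c.2, congrArg Subtype.val hc⟩)
    (fun a ha => by
      obtain ⟨r, c, hc⟩ := exists_integer_add hv ⟨a, ha⟩
      exact ⟨r, c, c.2, congrArg Subtype.val hc⟩)
    (isAdicComplete_integers hv) (residueChar_ne_zero v).isUnit (not_isUnit_residueChar hv)
    (exists_pow_mul_mem hv)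
  exact ⟨h.1, h.1.frobeniusLift_pow _ (h.2.1 _ (pow_card_residue v))⟩

end

/-! ## The rings `K_v ⊗_K E` for a finite extension `E` of `K` -/

section

variable {K : Type*} [Field K] [NumberField K]

/-- The image of `𝒪_{K_v} ⊗ 𝒪_E` in `K_v ⊗_K E`. -/
def integersOver (v : HeightOneSpectrum (𝓞 K)) (E : Type*) [Field E] [Algebra K E] :
    Subalgebra (v.adicCompletionIntegers K) (v.adicCompletion K ⊗[K] E) :=
  Algebra.adjoin _ (Set.range fun a : 𝓞 E => (1 : v.adicCompletion K) ⊗ₜ[K] (a : E))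

/-- The place `v` of `K` is unramified in `E`. -/
def IsUnramifiedIn (v : HeightOneSpectrum (𝓞 K)) (E : Type*) [Field E] [Algebra K E] : Prop :=
  Algebra.IsUnramifiedIn (𝓞 E) v.asIdeal

variable {E : Type*} [Field E] [NumberField E] [Algebra K E]

theorem integersOver_eq_span (v : HeightOneSpectrum (𝓞 K)) :
    Subalgebra.toSubmodule (integersOver v E) = Submodule.span (v.adicCompletionIntegers K)
      (Set.range fun a : 𝓞 E => (1 : v.adicCompletion K) ⊗ₜ[K] (a : E)) := by
  let S : Submonoid (v.adicCompletion K ⊗[K] E) :=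
    MonoidHom.mrange ((Algebra.TensorProduct.includeRight (R := K) (A := v.adicCompletion K) (B := E) :
      E →ₐ[K] v.adicCompletion K ⊗[K] E).toRingHom.comp (algebraMap (𝓞 E) E) : 𝓞 E →* _)
  have hS : (S : Set (v.adicCompletion K ⊗[K] E)) =
    (Set.range fun a : 𝓞 E => (1 : v.adicCompletion K) ⊗ₜ[K] (a : E)) := rfl
  rw [integersOver, Algebra.adjoin_eq_span, ← hS, Submonoid.closure_eq]

theorem smul_one_tmul (v : HeightOneSpectrum (𝓞 K)) (r : 𝓞 K) (a : 𝓞 E) :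
    algebraMap (𝓞 K) (v.adicCompletionIntegers K) r • ((1 : v.adicCompletion K) ⊗ₜ[K] (a : E)) =
      (1 : v.adicCompletion K) ⊗ₜ[K] ((r • a : 𝓞 E) : E) := by
  rw [TensorProduct.smul_tmul']
  have : algebraMap (𝓞 K) (v.adicCompletionIntegers K) r • (1 : v.adicCompletion K) =
      (algebraMap (𝓞 K) K r) • (1 : v.adicCompletion K) := by
    rw [Algebra.smul_def, Algebra.smul_def]; rfl
  rw [this, TensorProduct.smul_tmul]
  congr 1
  rw [Algebra.smul_def, Algebra.smul_def]
  change _ = algebraMap (𝓞 E) E (algebraMap (𝓞 K) (𝓞 E) r * a)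
  rw [map_mul, ← IsScalarTower.algebraMap_apply, ← IsScalarTower.algebraMap_apply]

theorem finite_integersOver (v : HeightOneSpectrum (𝓞 K)) :
    Module.Finite (v.adicCompletionIntegers K) (integersOver v E) := by
  change Module.Finite (v.adicCompletionIntegers K) (Subalgebra.toSubmodule (integersOver v E))
  rw [integersOver_eq_span]
  classical
  obtain ⟨s, hs⟩ := (Module.Finite.fg_top : (⊤ : Submodule (𝓞 K) (𝓞 E)).FG)
  refine Module.Finite.iff_fg.mpr ⟨s.image fun a : 𝓞 E => (1 : v.adicCompletion K) ⊗ₜ[K] (a : E), ?_⟩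
  apply le_antisymm
  · apply Submodule.span_mono
    simp only [Finset.coe_image]
    exact Set.image_subset_range _ _
  · rw [Submodule.span_le]
    rintro _ ⟨a, rfl⟩
    have ha : a ∈ Submodule.span (𝓞 K) (s : Set (𝓞 E)) := hs ▸ Submodule.mem_top
    induction ha using Submodule.span_induction with
    | mem x hx => exact Submodule.subset_span (by simpa using ⟨x, hx, rfl⟩)
    | zero => simp
    | add x y _ _ hx hy =>
      have : ((x + y : 𝓞 E) : E) = (x : E) + (y : E) := rfl
      simp only [this, tmul_add]
      exact add_mem hx hy
    | smul r x _ hx =>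
      simp only [← smul_one_tmul]
      exact Submodule.smul_mem _ _ hx

theorem exists_integersOver_add {v : HeightOneSpectrum (𝓞 K)} (hv : IsUnramified v)
    (x : v.adicCompletion K ⊗[K] E) (hx : x ∈ integersOver v E) :
    ∃ (r : 𝓞 E), ∃ c ∈ integersOver v E,
      x = (1 : v.adicCompletion K) ⊗ₜ[K] (r : E) + (residueChar v : ℕ) * c := by
  rw [← Subalgebra.mem_toSubmodule, integersOver_eq_span] at hx
  induction hx using Submodule.span_induction with
  | mem x hx => obtain ⟨a, rfl⟩ := hx; exact ⟨a, 0, zero_mem _, by simp⟩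
  | zero => exact ⟨0, 0, zero_mem _, by simp⟩
  | add x y _ _ hx hy =>
    obtain ⟨r, c, hc, rfl⟩ := hx
    obtain ⟨s, d, hd, rfl⟩ := hy
    refine ⟨r + s, c + d, add_mem hc hd, ?_⟩
    have : ((r + s : 𝓞 E) : E) = (r : E) + (s : E) := rfl
    rw [this, tmul_add]; ring
  | smul a x hx' hx =>
    obtain ⟨r, c, hc, h1⟩ := hx
    obtain ⟨s, d, rfl⟩ := exists_integer_add hv a
    refine ⟨s • r, algebraMap (𝓞 K) (v.adicCompletionIntegers K) s • c + d • x, add_mem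
      (Subalgebra.smul_mem _ hc _) (Subalgebra.smul_mem _ ?_ _), ?_⟩
    · rw [← Subalgebra.mem_toSubmodule, integersOver_eq_span]; exact hx'
    · rw [add_smul, ← smul_one_tmul, mul_smul]
      nth_rewrite 1 [h1]
      simp only [Algebra.smul_def, map_natCast]
      ring

theorem isReduced_quotient {v : HeightOneSpectrum (𝓞 K)} (hE : IsUnramifiedIn v E) :
    IsReduced (𝓞 E ⧸ v.asIdeal.map (algebraMap (𝓞 K) (𝓞 E))) := by
  have := v.isPrime
  have := v.isMaximal
  have hne : v.asIdeal.map (algebraMap (𝓞 K) (𝓞 E)) ≠ 0 := Ideal.map_ne_bot_of_ne_bot v.ne_bot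
  rw [← Ideal.isRadical_iff_quotient_reduced]
  have hsq : Squarefree (v.asIdeal.map (algebraMap (𝓞 K) (𝓞 E))) := by
    refine (squarefree_iff_no_irreducibles hne).mpr fun P hP hPP => ?_
    have hPp : P.IsPrime := (Ideal.isPrime_of_prime hP.prime)
    have hle : v.asIdeal.map (algebraMap (𝓞 K) (𝓞 E)) ≤ P ^ 2 := by
      rw [pow_two]; exact Ideal.le_of_dvd hPP
    have : P.LiesOver v.asIdeal := by
      refine ⟨?_⟩
      refine v.isMaximal.eq_of_le (Ideal.IsPrime.comap (hK := hPp) _).ne_top ?_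
      rw [← Ideal.map_le_iff_le_comap]
      exact hle.trans (Ideal.pow_le_self two_ne_zero)
    exact not_le_sq P hP.ne_zero v.asIdeal (hE P hPp this) hle
  intro x hx
  obtain ⟨n, hn⟩ := hx
  have h1 := hsq.isRadical n (Ideal.span {x}) (by
    rw [Ideal.span_singleton_pow, Ideal.dvd_span_singleton]; exact hn)
  exact Ideal.dvd_span_singleton.mp h1

theorem finite_quotient (v : HeightOneSpectrum (𝓞 K)) :
    Finite (𝓞 E ⧸ v.asIdeal.map (algebraMap (𝓞 K) (𝓞 E))) := by
  apply Ideal.finiteQuotientOfFreeOfNeBot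
  exact Ideal.map_ne_bot_of_ne_bot v.ne_bot

theorem isAdicComplete_of_basis {R M ι : Type*} [CommRing R] [AddCommGroup M] [Module R M]
    [Finite ι] (b : Module.Basis ι R M) (p : R) [IsAdicComplete (Ideal.span {p}) R] :
    IsAdicComplete (Ideal.span {p}) M := by
  have := Fintype.ofFinite ι
  have h1 : ∀ (n : ℕ) (x : M), x ∈ ((Ideal.span {p} ^ n • ⊤ : Submodule R M)) ↔
      ∀ i, b.repr x i ∈ (Ideal.span {p} ^ n • ⊤ : Submodule R R) := by
    intro n x
    rw [Ideal.span_singleton_pow, Submodule.ideal_span_singleton_smul]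
    simp only [Submodule.mem_smul_pointwise_iff_exists, Submodule.mem_top, true_and, smul_eq_mul,
      Ideal.mul_top, Ideal.mem_span_singleton]
    constructor
    · rintro ⟨y, rfl⟩ i
      exact ⟨b.repr y i, by simp⟩
    · intro h
      choose c hc using h
      refine ⟨∑ i, c i • b i, ?_⟩
      apply b.repr.injective
      ext i
      rw [map_smul, Finsupp.smul_apply, b.repr_sum_self, hc, smul_eq_mul]
  refine { haus' := ?_, prec' := ?_ }
  · intro x hx
    apply b.repr.injective
    ext i
    rw [map_zero]
    refine IsHausdorff.haus (I := Ideal.span {p}) inferInstance _ fun n => ?_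
    have := hx n
    rw [SModEq.zero, h1] at this
    rw [SModEq.zero]
    exact this i
  · intro f hf
    simp only [SModEq.sub_mem, h1, map_sub, Finsupp.sub_apply] at hf
    have : ∀ i, ∃ L : R, ∀ n, b.repr (f n) i - L ∈ (Ideal.span {p} ^ n • ⊤ : Submodule R R) := by
      intro i
      obtain ⟨L, hL⟩ := IsPrecomplete.prec (I := Ideal.span {p}) (M := R) inferInstance
        (f := fun n => b.repr (f n) i) (fun {m n} hmn => by
          rw [SModEq.sub_mem]; exact hf hmn i)
      exact ⟨L, fun n => by rw [← SModEq.sub_mem]; exact hL n⟩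
    choose L hL using this
    refine ⟨∑ i, L i • b i, fun n => ?_⟩
    rw [SModEq.sub_mem, h1]
    intro i
    rw [map_sub, Finsupp.sub_apply, b.repr_sum_self]
    exact hL i n

theorem tmul_mem_integersOver {v : HeightOneSpectrum (𝓞 K)} {c : v.adicCompletion K}
    (hc : c ∈ v.adicCompletionIntegers K) (a : 𝓞 E) : c ⊗ₜ[K] (a : E) ∈ integersOver v E := by
  have h1 : c ⊗ₜ[K] (a : E) = (⟨c, hc⟩ : v.adicCompletionIntegers K) •
      ((1 : v.adicCompletion K) ⊗ₜ[K] (a : E)) := by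
    rw [TensorProduct.smul_tmul']
    congr 1
    rw [Algebra.smul_def, mul_one]; rfl
  rw [h1]
  have h2 : (1 : v.adicCompletion K) ⊗ₜ[K] (a : E) ∈ integersOver v E :=
    Algebra.subset_adjoin ⟨a, rfl⟩
  exact Subalgebra.smul_mem _ h2 _

theorem isStrict_integersOver {v : HeightOneSpectrum (𝓞 K)} (hv : IsUnramified v)
    (hE : IsUnramifiedIn v E) :
    IsStrict (residueChar v) (integersOver v E).toSubring ∧ ∃ m : ℕ, 0 < m ∧
      ∀ x, (frobeniusLift (residueChar v) (integersOver v E).toSubring)^[m] x = x := by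
  have := isReduced_quotient hE
  have := finite_quotient (E := E) v
  have hp0 : IsUnit ((residueChar v : ℕ) : v.adicCompletion K ⊗[K] E) := by
    rw [← map_natCast (algebraMap (v.adicCompletion K) (v.adicCompletion K ⊗[K] E))]
    exact (residueChar_ne_zero v).isUnit.map _
  have := finite_integersOver (E := E) v
  have : Module.IsTorsionFree (v.adicCompletionIntegers K) (v.adicCompletion K ⊗[K] E) :=
    Module.IsTorsionFree.trans_faithfulSMul (v.adicCompletionIntegers K) (v.adicCompletion K) _
  have hfree : Module.Free (v.adicCompletionIntegers K) (integersOver v E) := inferInstance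
  have := isAdicComplete_integers hv
  have hcomp : IsAdicComplete (Ideal.span {((residueChar v : ℕ) : integersOver v E)}) (integersOver v E) := by
    have h1 := isAdicComplete_of_basis
      (Module.Free.chooseBasis (v.adicCompletionIntegers K) (integersOver v E))
      ((residueChar v : ℕ) : v.adicCompletionIntegers K)
    rw [← IsAdicComplete.map_algebraMap_iff (S := integersOver v E), Ideal.map_span,
      Set.image_singleton, map_natCast] at h1
    exact h1
  have hnu : ¬ IsUnit ((residueChar v : ℕ) : integersOver v E) := by
    intro h
    apply not_isUnit_residueChar hv
    have : Algebra.IsIntegral (v.adicCompletionIntegers K) (integersOver v E) := inferInstance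
    have h2 : FaithfulSMul (v.adicCompletionIntegers K) (integersOver v E) := inferInstance
    rw [← map_natCast (algebraMap (v.adicCompletionIntegers K) (integersOver v E))] at h
    exact isUnit_of_map_unit _ _ h
  have h := IsStrict.mk' (A := (integersOver v E).toSubring) (p := residueChar v)
    (v.asIdeal.map (algebraMap (𝓞 K) (𝓞 E)))
    (by simpa using Ideal.mem_map_of_mem (algebraMap (𝓞 K) (𝓞 E)) (residueChar_mem v))
    ((Algebra.TensorProduct.includeRight (R := K) (A := v.adicCompletion K) (B := E) :
      E →ₐ[K] v.adicCompletion K ⊗[K] E).toRingHom.comp (algebraMap (𝓞 E) E))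
    (fun a => Algebra.subset_adjoin ⟨a, rfl⟩)
    (fun r hr => by
      induction hr using Submodule.span_induction with
      | mem x hx =>
        obtain ⟨s, hs, rfl⟩ := hx
        obtain ⟨c, hc⟩ := exists_eq_mul hv hs
        refine ⟨c ⊗ₜ[K] ((1 : 𝓞 E) : E), tmul_mem_integersOver c.2 _, ?_⟩
        have h1 := smul_one_tmul (E := E) v s 1
        rw [Algebra.smul_def (A := 𝓞 E), mul_one] at h1
        change (1 : v.adicCompletion K) ⊗ₜ[K] ((algebraMap (𝓞 K) (𝓞 E) s : 𝓞 E) : E) = _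
        rw [← h1, hc, mul_smul, TensorProduct.smul_tmul', TensorProduct.smul_tmul',
          ← nsmul_eq_mul, Nat.cast_smul_eq_nsmul]
        congr 2
        rw [Algebra.smul_def, mul_one]; rfl
      | zero => exact ⟨0, zero_mem _, by simp⟩
      | add x y _ _ hx hy =>
        obtain ⟨c, hc, h1⟩ := hx
        obtain ⟨d, hd, h2⟩ := hy
        exact ⟨c + d, add_mem hc hd, by rw [map_add, h1, h2, mul_add]⟩
      | smul a x _ hx =>
        obtain ⟨c, hc, h1⟩ := hx
        refine ⟨_, mul_mem (Algebra.subset_adjoin ⟨a, rfl⟩ :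
          (1 : v.adicCompletion K) ⊗ₜ[K] (a : E) ∈ integersOver v E) hc, ?_⟩
        rw [smul_eq_mul, map_mul, h1]
        change (1 : v.adicCompletion K) ⊗ₜ[K] (a : E) * _ = _
        ring)
    (fun a ha => exists_integersOver_add hv a ha)
    hcomp hp0 hnu
    (fun b => by
      induction b using TensorProduct.induction_on with
      | zero => exact ⟨0, by simp⟩
      | tmul c e =>
        obtain ⟨⟨a, d⟩, hd⟩ := IsLocalization.surj (Algebra.algebraMapSubmonoid (𝓞 E) (nonZeroDivisors (𝓞 K))) e
        obtain ⟨_, d, hd0, rfl⟩ := d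
        have hd1 : algebraMap (𝓞 K) K d ≠ 0 := by
          simpa using nonZeroDivisors.ne_zero hd0
        obtain ⟨n, hn⟩ := exists_pow_mul_mem hv ((algebraMap (𝓞 K) K d)⁻¹ • c)
        refine ⟨n, ?_⟩
        have h2 : c ⊗ₜ[K] e = ((algebraMap (𝓞 K) K d)⁻¹ • c) ⊗ₜ[K] (a : E) := by
          rw [TensorProduct.smul_tmul]
          congr 1
          rw [eq_inv_smul_iff₀ hd1, Algebra.smul_def, mul_comm]
          exact hd
        have h3 : ((residueChar v : ℕ) : v.adicCompletion K ⊗[K] E) ^ n * c ⊗ₜ[K] e =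
            (((residueChar v : ℕ) : v.adicCompletion K) ^ n * ((algebraMap (𝓞 K) K d)⁻¹ • c)) ⊗ₜ[K] (a : E) := by
          rw [h2, ← map_natCast (algebraMap (v.adicCompletion K) (v.adicCompletion K ⊗[K] E)),
            ← map_pow, ← Algebra.smul_def, TensorProduct.smul_tmul', smul_eq_mul]
        rw [h3]
        exact tmul_mem_integersOver hn a
      | add x y hx hy =>
        obtain ⟨n, hn⟩ := hx
        obtain ⟨m, hm⟩ := hy
        refine ⟨n + m, ?_⟩
        have : ((residueChar v : ℕ) : v.adicCompletion K ⊗[K] E) ^ (n + m) * (x + y) =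
          ((residueChar v : ℕ) : v.adicCompletion K ⊗[K] E) ^ m * (((residueChar v : ℕ) : v.adicCompletion K ⊗[K] E) ^ n * x) +
          ((residueChar v : ℕ) : v.adicCompletion K ⊗[K] E) ^ n * (((residueChar v : ℕ) : v.adicCompletion K ⊗[K] E) ^ m * y) := by ring
        rw [this]
        exact add_mem (mul_mem (pow_mem (natCast_mem _ _) _) hn) (mul_mem (pow_mem (natCast_mem _ _) _) hm))
  obtain ⟨m, hm, hm'⟩ := h.2.2
  exact ⟨h.1, m, hm, h.1.frobeniusLift_pow _ (h.2.1 _ hm')⟩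

end

/-! ## The Frobenius of `K_v ⊗_K E` -/

section

variable {K : Type*} [Field K] [NumberField K]

/-- The Frobenius lift of `K_v ⊗_K E` (meaningful for `v` unramified over `ℚ` and in `E`). -/
def frobOver (v : HeightOneSpectrum (𝓞 K)) (E : Type*) [Field E] [Algebra K E] :
    v.adicCompletion K ⊗[K] E ≃+* v.adicCompletion K ⊗[K] E :=
  frobeniusLift (residueChar v) (integersOver v E).toSubring

variable {E : Type*} [Field E] [NumberField E] [Algebra K E]
variable {E' : Type*} [Field E'] [NumberField E'] [Algebra K E']

theorem map_mem_integersOver {v : HeightOneSpectrum (𝓞 K)} (τ : E →ₐ[K] E')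
    {x : v.adicCompletion K ⊗[K] E} (hx : x ∈ integersOver v E) :
    Algebra.TensorProduct.map (AlgHom.id (v.adicCompletion K) (v.adicCompletion K)) τ x ∈
      integersOver v E' := by
  rw [← Subalgebra.mem_toSubmodule, integersOver_eq_span] at hx
  induction hx using Submodule.span_induction with
  | mem x hx =>
    obtain ⟨a, rfl⟩ := hx
    simp only [Algebra.TensorProduct.map_tmul, map_one]
    exact tmul_mem_integersOver (one_mem _) (RingOfIntegers.mapRingHom (τ : E →+* E') a)
  | zero => rw [map_zero]; exact zero_mem _
  | add x y _ _ hx hy => rw [map_add]; exact add_mem hx hy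
  | smul c x _ hx =>
    have : c • x = (c : v.adicCompletion K) • x := by
      rw [Algebra.smul_def, Algebra.smul_def]; rfl
    rw [this, map_smul]
    have h2 : (c : v.adicCompletion K) • Algebra.TensorProduct.map (AlgHom.id (v.adicCompletion K) (v.adicCompletion K)) τ x
      = c • Algebra.TensorProduct.map (AlgHom.id (v.adicCompletion K) (v.adicCompletion K)) τ x := by
      rw [Algebra.smul_def, Algebra.smul_def]; rfl
    rw [h2]
    exact Subalgebra.smul_mem _ hx _

theorem frobOver_map {v : HeightOneSpectrum (𝓞 K)} (hv : IsUnramified v)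
    (hE : IsUnramifiedIn v E) (hE' : IsUnramifiedIn v E') (τ : E →ₐ[K] E')
    (x : v.adicCompletion K ⊗[K] E) :
    frobOver v E' (Algebra.TensorProduct.map (AlgHom.id (v.adicCompletion K) (v.adicCompletion K)) τ x) =
      Algebra.TensorProduct.map (AlgHom.id (v.adicCompletion K) (v.adicCompletion K)) τ (frobOver v E x) := by
  have h := (isStrict_integersOver hv hE).1
  have h' := (isStrict_integersOver hv hE').1
  let m : v.adicCompletion K ⊗[K] E →+* v.adicCompletion K ⊗[K] E' :=
    (Algebra.TensorProduct.map (AlgHom.id (v.adicCompletion K) (v.adicCompletion K)) τ).toRingHom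
  have hm : ∀ a ∈ (integersOver v E).toSubring, m a ∈ (integersOver v E').toSubring :=
    fun a ha => map_mem_integersOver τ ha
  have key : (frobOver v E' : _ →+* _).comp m = m.comp (frobOver v E : _ →+* _) := by
    refine h.hom_ext h' _ _ (fun a ha => (h'.isFrobeniusLift _ (hm a ha)).1)
      (fun a ha => hm _ (h.isFrobeniusLift _ ha).1) (fun a ha => ?_)
    obtain ⟨_, c, hc, h1⟩ := h'.isFrobeniusLift _ (hm a ha)
    obtain ⟨_, d, hd, h2⟩ := h.isFrobeniusLift _ ha
    refine ⟨c - m d, sub_mem hc (hm d hd), ?_⟩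
    change frobeniusLift _ _ (m a) = m (frobeniusLift _ _ a) + _
    rw [h1, h2, map_add, map_pow, map_mul, map_natCast]
    ring
  exact congrArg (fun f : _ →+* _ => f x) key

theorem frobOver_algebraMap {v : HeightOneSpectrum (𝓞 K)} (hv : IsUnramified v)
    (hE : IsUnramifiedIn v E) (c : v.adicCompletion K) :
    frobOver v E (algebraMap (v.adicCompletion K) _ c) =
      algebraMap (v.adicCompletion K) (v.adicCompletion K ⊗[K] E) (frob v c) := by
  have h := (isStrict_integers hv).1
  have h' := (isStrict_integersOver hv hE).1
  let m : v.adicCompletion K →+* v.adicCompletion K ⊗[K] E := algebraMap _ _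
  have hm : ∀ a ∈ (v.adicCompletionIntegers K).toSubring, m a ∈ (integersOver v E).toSubring :=
    fun a ha => (integersOver v E).algebraMap_mem ⟨a, ha⟩
  have key : (frobOver v E : _ →+* _).comp m = m.comp (frob v : _ →+* _) := by
    refine h.hom_ext h' _ _ (fun a ha => (h'.isFrobeniusLift _ (hm a ha)).1)
      (fun a ha => hm _ (h.isFrobeniusLift _ ha).1) (fun a ha => ?_)
    obtain ⟨_, c, hc, h1⟩ := h'.isFrobeniusLift _ (hm a ha)
    obtain ⟨_, d, hd, h2⟩ := h.isFrobeniusLift _ ha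
    refine ⟨c - m d, sub_mem hc (hm d hd), ?_⟩
    change frobeniusLift _ _ (m a) = m (frobeniusLift _ _ a) + _
    rw [h1, h2, map_add, map_pow, map_mul, map_natCast]
    ring
  exact congrArg (fun f : _ →+* _ => f c) key

theorem frobOver_smul {v : HeightOneSpectrum (𝓞 K)} (hv : IsUnramified v)
    (hE : IsUnramifiedIn v E) (c : v.adicCompletion K) (x : v.adicCompletion K ⊗[K] E) :
    frobOver v E (c • x) = frob v c • frobOver v E x := by
  rw [Algebra.smul_def, map_mul, frobOver_algebraMap hv hE, ← Algebra.smul_def]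

theorem finite_not_isUnramified : {v : HeightOneSpectrum (𝓞 K) | ¬ IsUnramified v}.Finite := by
  refine (Ideal.finite_factors (I := differentIdeal ℤ (𝓞 K)) differentIdeal_ne_bot).subset ?_
  intro v hv
  have := v.isPrime
  by_contra h
  exact hv ((not_dvd_differentIdeal_iff (A := ℤ) (B := 𝓞 K) (P := v.asIdeal)).mp h)

variable (K E) in
theorem finite_not_isUnramifiedIn :
    {v : HeightOneSpectrum (𝓞 K) | ¬ IsUnramifiedIn v E}.Finite := by
  have h := (Ideal.finite_factors (I := differentIdeal (𝓞 K) (𝓞 E)) differentIdeal_ne_bot)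
  refine (h.image fun P => (P.asIdeal.under (𝓞 K))).preimage
    (f := fun v : HeightOneSpectrum (𝓞 K) => v.asIdeal)
    (fun a _ b _ hab => HeightOneSpectrum.ext hab) |>.subset ?_
  intro v hv
  simp only [Set.mem_ofPred_eq, IsUnramifiedIn, Algebra.IsUnramifiedIn, not_forall] at hv
  obtain ⟨P, hP, hlo, hun⟩ := hv
  have hne : P ≠ ⊥ := Ideal.ne_bot_of_liesOver_of_ne_bot v.ne_bot P
  refine ⟨⟨P, hP, hne⟩, ?_, (Ideal.over_def P v.asIdeal).symm⟩
  by_contra h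
  exact hun ((not_dvd_differentIdeal_iff (A := 𝓞 K) (B := 𝓞 E) (P := P)).mp h)

end

/-! ## Lattices over `K` and their de Rham realization -/

section

section
variable {R M G : Type*} [CommRing R] [AddCommGroup M] [Module R M]

/-- The vectors fixed by a family of endomorphisms. -/
def fixedVectors (a : G → M →ₗ[R] M) : Submodule R M where
  carrier := {x | ∀ g, a g x = x}
  add_mem' hx hy g := by rw [map_add, hx g, hy g]
  zero_mem' g := map_zero _
  smul_mem' c x hx g := by rw [map_smul, hx g]

theorem mem_fixedVectors {a : G → M →ₗ[R] M} {x : M} : x ∈ fixedVectors a ↔ ∀ g, a g x = x :=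
  Iff.rfl

variable (S : Type*) [CommRing S] [Algebra R S]

theorem baseChange_mem_fixedVectors (a : G → M →ₗ[R] M) (x : S ⊗[R] fixedVectors a) :
    (fixedVectors a).subtype.baseChange S x ∈ fixedVectors fun g => (a g).baseChange S := by
  intro g
  rw [← LinearMap.comp_apply, ← LinearMap.baseChange_comp]
  congr 2
  ext y
  exact y.2 g

theorem baseChange_fixedVectors_surj [Module.Free R S] (a : G → M →ₗ[R] M) {x : S ⊗[R] M}
    (hx : x ∈ fixedVectors fun g => (a g).baseChange S) :
    ∃ y, (fixedVectors a).subtype.baseChange S y = x := by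
  let b := Module.Free.chooseBasis R S
  have h1 : ∀ i, TensorProduct.equivFinsuppOfBasisLeft b x i ∈ fixedVectors a := by
    intro i g
    conv_rhs => rw [← hx g]
    generalize x = z
    induction z using TensorProduct.induction_on with
    | zero => simp
    | tmul s m => simp
    | add y z hy hz => simp only [map_add, Finsupp.add_apply, hy, hz]
  have h2 := (TensorProduct.equivFinsuppOfBasisLeft b).symm_apply_apply x
  rw [TensorProduct.equivFinsuppOfBasisLeft_symm_apply, Finsupp.sum] at h2
  refine ⟨∑ i ∈ (TensorProduct.equivFinsuppOfBasisLeft b x).support, b i ⊗ₜ ⟨_, h1 i⟩, ?_⟩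
  rw [map_sum]
  exact h2

/-- Formation of fixed vectors commutes with (flat, free) base change. -/
def baseChangeFixedVectors [Module.Free R S] (a : G → M →ₗ[R] M) :
    S ⊗[R] fixedVectors a ≃ₗ[S] fixedVectors fun g => (a g).baseChange S :=
  LinearEquiv.ofBijective
    (((fixedVectors a).subtype.baseChange S).codRestrict _ (baseChange_mem_fixedVectors S a)) <| by
    constructor
    · intro x y hxy
      exact Module.Flat.lTensor_preserves_injective_linearMap (M := S) (fixedVectors a).subtype
        (Submodule.subtype_injective _) (congrArg Subtype.val hxy)
    · rintro ⟨x, hx⟩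
      obtain ⟨y, hy⟩ := baseChange_fixedVectors_surj S a hx
      exact ⟨y, Subtype.ext hy⟩

@[simp] theorem coe_baseChangeFixedVectors [Module.Free R S] (a : G → M →ₗ[R] M)
    (x : S ⊗[R] fixedVectors a) : (baseChangeFixedVectors S a x : S ⊗[R] M) =
      (fixedVectors a).subtype.baseChange S x := rfl

end

/-- A lattice over `K`: a finitely generated free abelian group with a continuous action of the
absolute Galois group; that is, a group scheme over `K` which is étale locally constant and free
of finite rank. The Artin motive (or `1`-motive of weight zero) `[L → 0]` is given by `L`. -/
structure Lattice (K : Type u) [Field K] where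
  /-- the abelian group `L(K̄)` -/
  carrier : Type u
  [addCommGroup : AddCommGroup carrier]
  [free : Module.Free ℤ carrier]
  [finite : Module.Finite ℤ carrier]
  /-- the Galois action -/
  ρ : Representation ℤ (AlgebraicClosure K ≃ₐ[K] AlgebraicClosure K) carrier
  isOpen_stabilizer : ∀ x, IsOpen {γ | ρ γ x = x}

attribute [instance] Lattice.addCommGroup Lattice.free Lattice.finite

instance (K : Type u) [Field K] : CoeSort (Lattice K) (Type u) := ⟨Lattice.carrier⟩

namespace Lattice
variable {K : Type u} [Field K] (L : Lattice K)

/-- The diagonal action of the Galois group on `K̄ ⊗ L`. -/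
def galAct (γ : AlgebraicClosure K ≃ₐ[K] AlgebraicClosure K) :
    AlgebraicClosure K ⊗[ℤ] L →ₗ[K] AlgebraicClosure K ⊗[ℤ] L :=
  AlgebraTensorModule.map γ.toLinearMap (L.ρ γ)

/-- `T_dR([L → 0]) = (K̄ ⊗ L)^{Gal(K̄/K)}` -/
def deRham : Submodule K (AlgebraicClosure K ⊗[ℤ] L) := fixedVectors L.galAct

/-- The smallest extension of `K` in `K̄` over which `L` becomes constant. -/
def splittingField : IntermediateField K (AlgebraicClosure K) :=
  IntermediateField.fixedField L.ρ.ker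

theorem mem_splittingField {a : AlgebraicClosure K} :
    a ∈ L.splittingField ↔ ∀ γ, L.ρ γ = 1 → γ a = a := by
  rw [splittingField, IntermediateField.mem_fixedField_iff]
  rfl

instance finiteDimensional_splittingField [CharZero K] : FiniteDimensional K L.splittingField := by
  have h1 : {γ | L.ρ γ = 1} ∈ nhds (1 : AlgebraicClosure K ≃ₐ[K] AlgebraicClosure K) := by
    let b := Module.Free.chooseBasis ℤ L
    have h2 : {γ | L.ρ γ = 1} = ⋂ i, {γ | L.ρ γ (b i) = b i} := by
      ext γ
      simp only [Set.mem_ofPred_eq, Set.mem_iInter]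
      exact ⟨fun h i => by rw [h]; rfl, fun h => b.ext h⟩
    rw [h2]
    exact (isOpen_iInter_of_finite fun i => L.isOpen_stabilizer _).mem_nhds (by simp)
  rw [krullTopology_mem_nhds_one_iff] at h1
  obtain ⟨F, hF, h3⟩ := h1
  have h4 : L.splittingField ≤ F := by
    rw [← InfiniteGalois.fixedField_fixingSubgroup F]
    intro a ha
    rw [IntermediateField.mem_fixedField_iff]
    intro γ hγ
    exact L.mem_splittingField.mp ha γ (h3 hγ)
  exact FiniteDimensional.of_injective (IntermediateField.inclusion h4).toLinearMap
    (IntermediateField.inclusion h4).injective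

theorem apply_mem_splittingField (γ : AlgebraicClosure K ≃ₐ[K] AlgebraicClosure K)
    {a : AlgebraicClosure K} (ha : a ∈ L.splittingField) : γ a ∈ L.splittingField := by
  rw [mem_splittingField] at ha ⊢
  intro δ hδ
  have h1 := ha (γ⁻¹ * δ * γ) (by
    rw [map_mul, map_mul, hδ, mul_one, ← map_mul, inv_mul_cancel, map_one])
  have h2 := congrArg γ h1
  have h3 : γ ((γ⁻¹ * δ * γ) a) = δ (γ a) := by
    rw [← AlgEquiv.mul_apply, ← mul_assoc, ← mul_assoc, mul_inv_cancel, one_mul]; rfl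
  rw [← h3, h2]

/-- The action of the Galois group on the splitting field. -/
def restrict (γ : AlgebraicClosure K ≃ₐ[K] AlgebraicClosure K) :
    L.splittingField →ₐ[K] L.splittingField :=
  (γ.toAlgHom.comp L.splittingField.val).codRestrict L.splittingField.toSubalgebra
    fun a => L.apply_mem_splittingField γ a.2

/-- `F ⊗ L → K̄ ⊗ L` -/
def fieldEmb (F : IntermediateField K (AlgebraicClosure K)) :
    F ⊗[ℤ] L →ₗ[K] AlgebraicClosure K ⊗[ℤ] L :=
  AlgebraTensorModule.map F.val.toLinearMap LinearMap.id

theorem fieldEmb_injective (F : IntermediateField K (AlgebraicClosure K)) :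
    Function.Injective (L.fieldEmb F) :=
  Module.Flat.rTensor_preserves_injective_linearMap (M := L)
    (F.val.toLinearMap.restrictScalars ℤ) F.val.injective

theorem exists_fieldEmb {x : AlgebraicClosure K ⊗[ℤ] L} (hx : x ∈ L.deRham) :
    ∃ y, L.fieldEmb L.splittingField y = x := by
  let b := Module.Free.chooseBasis ℤ L
  have h1 : ∀ i, TensorProduct.equivFinsuppOfBasisRight b x i ∈ L.splittingField := by
    intro i
    rw [mem_splittingField]
    intro γ hγ
    conv_rhs => rw [← hx γ]
    generalize x = z
    induction z using TensorProduct.induction_on with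
    | zero => simp
    | tmul s m =>
      simp [galAct, hγ]
    | add y z hy hz => simp only [map_add, Finsupp.add_apply, hy, hz]
  have h2 := (TensorProduct.equivFinsuppOfBasisRight b).symm_apply_apply x
  rw [TensorProduct.equivFinsuppOfBasisRight_symm_apply, Finsupp.sum] at h2
  refine ⟨∑ i ∈ (TensorProduct.equivFinsuppOfBasisRight b x).support, ⟨_, h1 i⟩ ⊗ₜ b i, ?_⟩
  rw [map_sum]
  exact h2

instance finiteDimensional_deRham [CharZero K] : FiniteDimensional K L.deRham := by
  have h1 : L.deRham ≤ LinearMap.range (L.fieldEmb L.splittingField) :=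
    fun x hx => L.exists_fieldEmb hx
  have : FiniteDimensional K (L.splittingField ⊗[ℤ] L) :=
    Module.Finite.equiv (AlgebraTensorModule.cancelBaseChange ℤ K K L.splittingField L)
  have : FiniteDimensional K (LinearMap.range (L.fieldEmb L.splittingField)) :=
    LinearMap.finiteDimensional_range _
  exact Submodule.finiteDimensional_of_le h1

variable [NumberField K] (v : HeightOneSpectrum (𝓞 K))

/-- `(K_v ⊗_K K̄ ⊗ L)^{Gal(K̄/K)}` -/
def crys : Submodule (v.adicCompletion K) (v.adicCompletion K ⊗[K] (AlgebraicClosure K ⊗[ℤ] L)) :=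
  fixedVectors fun γ => (L.galAct γ).baseChange (v.adicCompletion K)

/-- The comparison isomorphism `K_v ⊗_K T_dR ≅ (K_v ⊗_K K̄ ⊗ L)^{Gal(K̄/K)}`. -/
def comparison : v.adicCompletion K ⊗[K] L.deRham ≃ₗ[v.adicCompletion K] L.crys v :=
  baseChangeFixedVectors (v.adicCompletion K) L.galAct

/-- Associativity of the tensor product. -/
def assocEquiv (F : IntermediateField K (AlgebraicClosure K)) :
    (v.adicCompletion K ⊗[K] F) ⊗[ℤ] L ≃ₗ[v.adicCompletion K]
      v.adicCompletion K ⊗[K] (F ⊗[ℤ] L) :=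
  AlgebraTensorModule.assoc ℤ K (v.adicCompletion K) (v.adicCompletion K) F L

/-- `(K_v ⊗_K F) ⊗ L → K_v ⊗_K K̄ ⊗ L` -/
def localEmb (F : IntermediateField K (AlgebraicClosure K)) :
    (v.adicCompletion K ⊗[K] F) ⊗[ℤ] L →ₗ[v.adicCompletion K]
      v.adicCompletion K ⊗[K] (AlgebraicClosure K ⊗[ℤ] L) :=
  (L.fieldEmb F).baseChange (v.adicCompletion K) ∘ₗ
    (L.assocEquiv v F).toLinearMap

@[simp] theorem localEmb_tmul (F : IntermediateField K (AlgebraicClosure K))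
    (c : v.adicCompletion K) (a : F) (l : L) :
    L.localEmb v F ((c ⊗ₜ a) ⊗ₜ l) = c ⊗ₜ ((a : AlgebraicClosure K) ⊗ₜ l) := rfl

theorem localEmb_injective (F : IntermediateField K (AlgebraicClosure K)) :
    Function.Injective (L.localEmb v F) := by
  rw [localEmb, LinearMap.coe_comp]
  refine Function.Injective.comp ?_ (LinearEquiv.injective _)
  exact Module.Flat.lTensor_preserves_injective_linearMap (M := v.adicCompletion K) (L.fieldEmb F)
    (L.fieldEmb_injective F)

theorem exists_localEmb {x : v.adicCompletion K ⊗[K] (AlgebraicClosure K ⊗[ℤ] L)}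
    (hx : x ∈ L.crys v) : ∃ y, L.localEmb v L.splittingField y = x := by
  obtain ⟨z, rfl⟩ := baseChange_fixedVectors_surj (v.adicCompletion K) L.galAct hx
  induction z using TensorProduct.induction_on with
  | zero => exact ⟨0, by simp⟩
  | tmul c y =>
    obtain ⟨w, hw⟩ := L.exists_fieldEmb y.2
    refine ⟨(L.assocEquiv v _).symm (c ⊗ₜ w), ?_⟩
    rw [localEmb, LinearMap.comp_apply, LinearEquiv.coe_coe, LinearEquiv.apply_symm_apply,
      LinearMap.baseChange_tmul, hw]
    rfl
  | add y z hy hz =>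
    obtain ⟨a, ha⟩ := hy (baseChange_mem_fixedVectors _ _ _)
    obtain ⟨b, hb⟩ := hz (baseChange_mem_fixedVectors _ _ _)
    exact ⟨a + b, by rw [map_add, map_add, ha, hb]⟩

/-- The Frobenius `φ ⊗ 1` on `(K_v ⊗_K F) ⊗ L`. -/
def localFrob (F : IntermediateField K (AlgebraicClosure K)) :
    (v.adicCompletion K ⊗[K] F) ⊗[ℤ] L ≃+ (v.adicCompletion K ⊗[K] F) ⊗[ℤ] L :=
  (TensorProduct.congr (frobOver v F).toAddEquiv.toIntLinearEquiv
    (LinearEquiv.refl ℤ L)).toAddEquiv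

@[simp] theorem localFrob_tmul (F : IntermediateField K (AlgebraicClosure K))
    (x : v.adicCompletion K ⊗[K] F) (l : L) :
    L.localFrob v F (x ⊗ₜ l) = frobOver v F x ⊗ₜ l := rfl

end Lattice

end

/-! ## The Frobenius of the realization of a lattice -/

section

instance numberField_intermediateField {K : Type u} [Field K] [NumberField K]
    (F : IntermediateField K (AlgebraicClosure K)) [FiniteDimensional K F] : NumberField F :=
  NumberField.of_module_finite K F

namespace Lattice
variable {K : Type u} [Field K] [NumberField K] (L : Lattice K) {L' : Lattice K}
variable {v : HeightOneSpectrum (𝓞 K)}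

theorem localFrob_smul (hv : IsUnramified v) (F : IntermediateField K (AlgebraicClosure K))
    [FiniteDimensional K F] (hF : IsUnramifiedIn v F) (c : v.adicCompletion K)
    (x : (v.adicCompletion K ⊗[K] F) ⊗[ℤ] L) :
    L.localFrob v F (c • x) = frob v c • L.localFrob v F x := by
  induction x using TensorProduct.induction_on with
  | zero => simp
  | tmul x l =>
    rw [TensorProduct.smul_tmul', localFrob_tmul, localFrob_tmul, frobOver_smul hv hF]
    rfl
  | add x y hx hy => simp only [smul_add, map_add, hx, hy]

/-- The map `(1 ⊗ τ) ⊗ ψ`. -/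
def localMap {L L' : Lattice K} (v : HeightOneSpectrum (𝓞 K)) {F F' : IntermediateField K (AlgebraicClosure K)}
    (τ : F →ₐ[K] F') (ψ : L →ₗ[ℤ] L') :
    (v.adicCompletion K ⊗[K] F) ⊗[ℤ] L →ₗ[ℤ] (v.adicCompletion K ⊗[K] F') ⊗[ℤ] L' :=
  TensorProduct.map (Algebra.TensorProduct.map
    (AlgHom.id (v.adicCompletion K) (v.adicCompletion K)) τ).toRingHom.toAddMonoidHom.toIntLinearMap ψ

theorem localFrob_localMap (hv : IsUnramified v) {F F' : IntermediateField K (AlgebraicClosure K)}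
    [FiniteDimensional K F] [FiniteDimensional K F']
    (hF : IsUnramifiedIn v F) (hF' : IsUnramifiedIn v F') (τ : F →ₐ[K] F') (ψ : L →ₗ[ℤ] L')
    (x : (v.adicCompletion K ⊗[K] F) ⊗[ℤ] L) :
    L'.localFrob v F' (localMap v τ ψ x) = localMap v τ ψ (L.localFrob v F x) := by
  induction x using TensorProduct.induction_on with
  | zero => simp
  | tmul x l =>
    exact congrArg (· ⊗ₜ ψ l) (frobOver_map hv hF hF' τ x)
  | add x y hx hy => simp only [map_add, hx, hy]

theorem baseChange_localEmb {F F' : IntermediateField K (AlgebraicClosure K)}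
    (θ : AlgebraicClosure K →ₗ[K] AlgebraicClosure K) (τ : F →ₐ[K] F') (h : ∀ a : F, θ a = τ a)
    (ψ : L →ₗ[ℤ] L') (x : (v.adicCompletion K ⊗[K] F) ⊗[ℤ] L) :
    (AlgebraTensorModule.map θ ψ).baseChange (v.adicCompletion K) (L.localEmb v F x) =
      L'.localEmb v F' (localMap v τ ψ x) := by
  induction x using TensorProduct.induction_on with
  | zero => simp
  | tmul x l =>
    induction x using TensorProduct.induction_on with
    | zero => simp
    | tmul c a =>
      change c ⊗ₜ (θ a ⊗ₜ ψ l) = c ⊗ₜ ((τ a : AlgebraicClosure K) ⊗ₜ ψ l)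
      rw [h]
    | add x y hx hy => simp only [add_tmul, map_add, hx, hy]
  | add x y hx hy => simp only [map_add, hx, hy]

theorem localEmb_mem_iff (x : (v.adicCompletion K ⊗[K] L.splittingField) ⊗[ℤ] L) :
    L.localEmb v L.splittingField x ∈ L.crys v ↔ ∀ γ, localMap v (L.restrict γ) (L.ρ γ) x = x := by
  refine forall_congr' fun γ => ?_
  have := L.baseChange_localEmb (v := v) (L' := L) γ.toLinearMap (L.restrict γ) (fun a => rfl) (L.ρ γ) x
  change (AlgebraTensorModule.map γ.toLinearMap (L.ρ γ)).baseChange (v.adicCompletion K) _ = _ ↔ _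
  rw [this]
  exact (L.localEmb_injective v _).eq_iff

theorem localFrob_mem_iff (hv : IsUnramified v) (hL : IsUnramifiedIn v L.splittingField)
    (x : (v.adicCompletion K ⊗[K] L.splittingField) ⊗[ℤ] L) :
    L.localEmb v L.splittingField (L.localFrob v L.splittingField x) ∈ L.crys v ↔
      L.localEmb v L.splittingField x ∈ L.crys v := by
  rw [localEmb_mem_iff, localEmb_mem_iff]
  refine forall_congr' fun γ => ?_
  rw [← L.localFrob_localMap hv hL hL]
  exact (L.localFrob v L.splittingField).injective.eq_iff

/-- The Frobenius of `(K_v ⊗_K K̄ ⊗ L)^{Gal(K̄/K)} ⊆ (K_v ⊗_K E) ⊗ L`, for `E` the splitting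
field: the restriction of `φ ⊗ 1`. -/
def crysFrob (v : HeightOneSpectrum (𝓞 K)) (hv : IsUnramified v)
    (hL : IsUnramifiedIn v L.splittingField) :
    L.crys v →ₛₗ[(frob v : v.adicCompletion K →+* v.adicCompletion K)] L.crys v where
  toFun x := ⟨L.localEmb v L.splittingField
    (L.localFrob v L.splittingField (L.exists_localEmb v x.2).choose),
    (L.localFrob_mem_iff hv hL _).mpr (by
      rw [(L.exists_localEmb v x.2).choose_spec]; exact x.2)⟩
  map_add' x y := by
    apply Subtype.ext
    change L.localEmb v _ _ = L.localEmb v _ _ + L.localEmb v _ _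
    rw [← map_add, ← map_add]
    congr 2
    apply L.localEmb_injective v
    rw [map_add, (L.exists_localEmb v x.2).choose_spec, (L.exists_localEmb v y.2).choose_spec,
      (L.exists_localEmb v (x + y).2).choose_spec]
    rfl
  map_smul' c x := by
    apply Subtype.ext
    change L.localEmb v _ _ = frob v c • L.localEmb v _ _
    rw [← map_smul, ← L.localFrob_smul hv _ hL]
    congr 2
    apply L.localEmb_injective v
    rw [map_smul, (L.exists_localEmb v x.2).choose_spec, (L.exists_localEmb v (c • x).2).choose_spec]
    rfl

theorem coe_crysFrob (hv : IsUnramified v) (hL : IsUnramifiedIn v L.splittingField) (x : L.crys v)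
    (F : IntermediateField K (AlgebraicClosure K)) [FiniteDimensional K F]
    (hLF : L.splittingField ≤ F) (hF : IsUnramifiedIn v F)
    (y : (v.adicCompletion K ⊗[K] F) ⊗[ℤ] L) (hy : L.localEmb v F y = x) :
    (L.crysFrob v hv hL x : v.adicCompletion K ⊗[K] (AlgebraicClosure K ⊗[ℤ] L)) =
      L.localEmb v F (L.localFrob v F y) := by
  have hid : (AlgebraTensorModule.map (LinearMap.id : AlgebraicClosure K →ₗ[K] AlgebraicClosure K)
      (LinearMap.id : L →ₗ[ℤ] L)).baseChange (v.adicCompletion K) = LinearMap.id := by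
    rw [AlgebraTensorModule.map_id, LinearMap.baseChange_id]
  have key := fun z => L.baseChange_localEmb (v := v) (L' := L) LinearMap.id
    (IntermediateField.inclusion hLF) (fun a => rfl) LinearMap.id z
  simp only [hid, LinearMap.id_apply] at key
  have h1 : L.localEmb v F y = L.localEmb v F (localMap v (IntermediateField.inclusion hLF)
      LinearMap.id (L.exists_localEmb v x.2).choose) := by
    rw [hy, ← key, (L.exists_localEmb v x.2).choose_spec]
  rw [L.localEmb_injective v F h1, L.localFrob_localMap hv hL hF, ← key]
  rfl

theorem crysFrob_bijective (hv : IsUnramified v) (hL : IsUnramifiedIn v L.splittingField) :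
    Function.Bijective (L.crysFrob v hv hL) := by
  have h := fun x y => L.coe_crysFrob hv hL x L.splittingField le_rfl hL y
  constructor
  · intro x x' hx
    obtain ⟨y, hy⟩ := L.exists_localEmb v x.2
    obtain ⟨y', hy'⟩ := L.exists_localEmb v x'.2
    have h1 := congrArg Subtype.val hx
    rw [h x y hy, h x' y' hy'] at h1
    apply Subtype.ext
    rw [← hy, ← hy', (L.localFrob v _).injective (L.localEmb_injective v _ h1)]
  · intro x
    obtain ⟨y, hy⟩ := L.exists_localEmb v x.2
    obtain ⟨z, rfl⟩ := (L.localFrob v L.splittingField).surjective y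
    refine ⟨⟨L.localEmb v L.splittingField z, (L.localFrob_mem_iff hv hL z).mp (hy ▸ x.2)⟩, ?_⟩
    apply Subtype.ext
    rw [h _ z rfl, hy]

/-- The Frobenius has finite order. -/
theorem exists_iterate_crysFrob (hv : IsUnramified v) (hL : IsUnramifiedIn v L.splittingField) :
    ∃ m : ℕ, 0 < m ∧ ∀ x, (L.crysFrob v hv hL)^[m] x = x := by
  obtain ⟨m, hm, h⟩ := (isStrict_integersOver (E := L.splittingField) hv hL).2
  refine ⟨m, hm, fun x => ?_⟩
  have h1 : ∀ z, (L.localFrob v L.splittingField)^[m] z = z := by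
    intro z
    have h2 : ∀ n : ℕ, ∀ x : v.adicCompletion K ⊗[K] L.splittingField, ∀ l : L,
        (L.localFrob v L.splittingField)^[n] (x ⊗ₜ l) = (frobOver v L.splittingField)^[n] x ⊗ₜ l := by
      intro n
      induction n with
      | zero => intro x l; rfl
      | succ n ih => intro x l; rw [Function.iterate_succ_apply, localFrob_tmul, ih]; rfl
    induction z using TensorProduct.induction_on with
    | zero => exact iterate_map_zero _ _
    | tmul x l => rw [h2]; exact congrArg (· ⊗ₜ l) (h x)
    | add x y hx hy => rw [iterate_map_add, hx, hy]
  obtain ⟨y, hy⟩ := L.exists_localEmb v x.2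
  have h3 : ∀ n : ℕ, ((L.crysFrob v hv hL)^[n] x : v.adicCompletion K ⊗[K] (AlgebraicClosure K ⊗[ℤ] L))
      = L.localEmb v L.splittingField ((L.localFrob v L.splittingField)^[n] y) := by
    intro n
    induction n with
    | zero => exact hy.symm
    | succ n ih =>
      rw [Function.iterate_succ_apply', Function.iterate_succ_apply']
      exact L.coe_crysFrob hv hL _ L.splittingField le_rfl hL _ ih.symm
  apply Subtype.ext
  rw [h3, h1, hy]

end Lattice

end

/-! ## The categories -/

section

/-- An object `(V, (V_v, F_v), (g_v))` of the Ogus category of the number field `K`. The local data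
are given for the places `v` in a cofinite set of places that are unramified over `ℚ`. -/
structure Og (K : Type u) [Field K] [NumberField K] where
  V : Type u
  [addCommGroup : AddCommGroup V]
  [module : Module K V]
  [finite : FiniteDimensional K V]
  places : Set (HeightOneSpectrum (𝓞 K))
  isUnramified : ∀ v ∈ places, IsUnramified v
  cofinite : ∀ᶠ v in cofinite, v ∈ places
  Vloc : ∀ v ∈ places, Type u
  [addCommGroupLoc : ∀ v hv, AddCommGroup (Vloc v hv)]
  [moduleLoc : ∀ v hv, Module (v.adicCompletion K) (Vloc v hv)]
  [finiteLoc : ∀ v hv, FiniteDimensional (v.adicCompletion K) (Vloc v hv)]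
  F : ∀ v hv, Vloc v hv →ₛₗ[(frob v : v.adicCompletion K →+* v.adicCompletion K)] Vloc v hv
  F_bijective : ∀ v hv, Function.Bijective (F v hv)
  g : ∀ v hv, v.adicCompletion K ⊗[K] V ≃ₗ[v.adicCompletion K] Vloc v hv

attribute [instance] Og.addCommGroup Og.module Og.finite Og.addCommGroupLoc Og.moduleLoc
  Og.finiteLoc

variable {K : Type u} [Field K] [NumberField K]

/-- A `K`-linear map `f : V → V'` underlies a morphism of the Ogus category if for almost all `v`
there is a `K_v`-linear map `V_v → V'_v` which corresponds to `f ⊗ K_v` under `g_v` and `g'_v` and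
which commutes with the Frobenius maps. -/
def IsOgHom (X Y : Og K) (f : X.V →ₗ[K] Y.V) : Prop :=
  ∀ᶠ v in cofinite, ∃ (hX : v ∈ X.places) (hY : v ∈ Y.places)
    (φ : X.Vloc v hX →ₗ[v.adicCompletion K] Y.Vloc v hY),
    (∀ x, φ (X.g v hX x) = Y.g v hY (f.baseChange (v.adicCompletion K) x)) ∧
    ∀ x, φ (X.F v hX x) = Y.F v hY (φ x)

/-- Morphisms of the Ogus category. The local components are determined by the `K`-linear map,
so that this is the colimit, over the cofinite sets of places, of the sets of compatible families
`(f, (f_v)_v)`. -/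
@[ext]
structure Og.Hom (X Y : Og K) where
  toLinearMap : X.V →ₗ[K] Y.V
  isOgHom : IsOgHom X Y toLinearMap

theorem isOgHom_id (X : Og K) : IsOgHom X X LinearMap.id := by
  filter_upwards [X.cofinite] with v hv
  exact ⟨hv, hv, LinearMap.id, fun x => by rw [LinearMap.baseChange_id]; rfl, fun x => rfl⟩

theorem IsOgHom.comp {X Y Z : Og K} {f : X.V →ₗ[K] Y.V} {f' : Y.V →ₗ[K] Z.V}
    (hf' : IsOgHom Y Z f') (hf : IsOgHom X Y f) : IsOgHom X Z (f' ∘ₗ f) := by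
  filter_upwards [hf, hf'] with v h h'
  obtain ⟨hX, hY, φ, h1, h2⟩ := h
  obtain ⟨_, hZ, φ', h1', h2'⟩ := h'
  refine ⟨hX, hZ, φ' ∘ₗ φ, fun x => ?_, fun x => ?_⟩
  · rw [LinearMap.comp_apply, h1, h1', LinearMap.baseChange_comp]; rfl
  · rw [LinearMap.comp_apply, h2, h2']; rfl

instance : Category (Og K) where
  Hom := Og.Hom
  id X := ⟨LinearMap.id, isOgHom_id X⟩
  comp f g := ⟨g.toLinearMap ∘ₗ f.toLinearMap, g.isOgHom.comp f.isOgHom⟩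

/-- The `K_v`-subspace of `V_v` that corresponds to a `K`-subspace of `V`. -/
def Og.localize (X : Og K) (W : Submodule K X.V) (v : HeightOneSpectrum (𝓞 K))
    (hv : v ∈ X.places) : Submodule (v.adicCompletion K) (X.Vloc v hv) :=
  (W.baseChange (v.adicCompletion K)).map (X.g v hv).toLinearMap

/-- Weil numbers of weight `i` relative to the residue field of `v`: algebraic numbers all of whose
complex conjugates have absolute value `p_v ^ (i n_v / 2)`. -/
def IsWeilNumber (v : HeightOneSpectrum (𝓞 K)) (i : ℤ)
    (α : AlgebraicClosure (v.adicCompletion K)) : Prop :=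
  IsAlgebraic ℚ α ∧ ∀ z : ℂ, Polynomial.aeval z (minpoly ℚ α) = 0 →
    ‖z‖ = (residueChar v : ℝ) ^ ((i : ℝ) * residueDegree v / 2)

/-- A vector space with an endomorphism is pure of weight `i` if all eigenvalues of the
endomorphism (in an algebraic closure of `K_v`) are Weil numbers of weight `i`. -/
def IsPure (v : HeightOneSpectrum (𝓞 K)) (i : ℤ) {H : Type u} [AddCommGroup H]
    [Module (v.adicCompletion K) H] (ψ : H →ₗ[v.adicCompletion K] H) : Prop :=
  ∀ α : AlgebraicClosure (v.adicCompletion K),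
    Module.End.HasEigenvalue (ψ.baseChange (AlgebraicClosure (v.adicCompletion K))) α →
      IsWeilNumber v i α

variable (K) in
/-- Objects of the enriched Ogus category: objects of the Ogus category with an increasing finite
exhaustive filtration by subobjects such that the `i`-th graded piece is pure of weight `i`, which
means that for almost all `v` the endomorphism `ψ` that the `K_v`-linear map `F_v ^ {n_v}` induces
on `W_i V_v / W_{i-1} V_v` is pure of weight `i`. -/
structure FOg extends Og K where
  W : ℤ → Submodule K V
  monotone : Monotone W
  exists_eq_bot : ∃ m, W m = ⊥
  exists_eq_top : ∃ n, W n = ⊤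
  map_mem : ∀ i, ∀ᶠ v in Filter.cofinite, ∃ hv : v ∈ places,
    ∀ x, F v hv x ∈ toOg.localize (W i) v hv ↔ x ∈ toOg.localize (W i) v hv
  pure : ∀ i, ∀ᶠ v in Filter.cofinite, ∃ (hv : v ∈ places)
    (ψ : (toOg.localize (W i) v hv ⧸
        (toOg.localize (W (i - 1)) v hv).submoduleOf (toOg.localize (W i) v hv))
      →ₗ[v.adicCompletion K]
      (toOg.localize (W i) v hv ⧸
        (toOg.localize (W (i - 1)) v hv).submoduleOf (toOg.localize (W i) v hv))),
    (∀ x y : toOg.localize (W i) v hv,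
      (y : Vloc v hv) = (F v hv)^[residueDegree v] x →
        ψ (Submodule.Quotient.mk x) = Submodule.Quotient.mk y) ∧
    IsPure v i ψ

/-- Morphisms are the morphisms in the Ogus category. -/
@[ext]
structure FOg.Hom (X Y : FOg K) where
  hom : X.toOg ⟶ Y.toOg

instance : Category (FOg K) where
  Hom := FOg.Hom
  id X := ⟨𝟙 X.toOg⟩
  comp f g := ⟨f.hom ≫ g.hom⟩

/-! ### Artin motives up to isogeny -/

/-- Homomorphisms of lattices. -/
def Lattice.Hom (L L' : Lattice K) : Submodule ℤ (L →ₗ[ℤ] L') where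
  carrier := {f | ∀ γ, f ∘ₗ L.ρ γ = L'.ρ γ ∘ₗ f}
  add_mem' hf hg γ := by rw [LinearMap.add_comp, LinearMap.comp_add, hf γ, hg γ]
  zero_mem' γ := by rw [LinearMap.zero_comp, LinearMap.comp_zero]
  smul_mem' c f hf γ := by rw [LinearMap.smul_comp, LinearMap.comp_smul, hf γ]

/-- The identity homomorphism. -/
def Lattice.Hom.id (L : Lattice K) : Lattice.Hom L L := ⟨LinearMap.id, fun _ => rfl⟩

/-- Composition of homomorphisms as a bilinear map. -/
def Lattice.Hom.comp (L L' L'' : Lattice K) :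
    Lattice.Hom L L' →ₗ[ℤ] Lattice.Hom L' L'' →ₗ[ℤ] Lattice.Hom L L'' :=
  LinearMap.mk₂ ℤ (fun f g => ⟨g.1 ∘ₗ f.1, fun γ => by
      rw [LinearMap.comp_assoc, f.2 γ, ← LinearMap.comp_assoc, g.2 γ, LinearMap.comp_assoc]⟩)
    (fun _ _ _ => Subtype.ext (LinearMap.comp_add _ _ _))
    (fun _ _ _ => Subtype.ext (LinearMap.comp_smul _ _ _))
    (fun _ _ _ => Subtype.ext (LinearMap.add_comp _ _ _))
    (fun _ _ _ => Subtype.ext (LinearMap.smul_comp _ _ _))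

variable (K) in
/-- The category of Artin motives `[L → 0]` over `K` up to isogeny: the objects are the lattices
and the group of morphisms from `L` to `L'` is `ℚ ⊗ Hom(L, L')`. -/
structure ArtinMotive where
  lattice : Lattice K

/-- Composition in `ℚ ⊗ Hom`. -/
def ArtinMotive.comp (L L' L'' : Lattice K) :
    ℚ ⊗[ℤ] Lattice.Hom L L' →ₗ[ℤ] ℚ ⊗[ℤ] Lattice.Hom L' L'' →ₗ[ℤ] ℚ ⊗[ℤ] Lattice.Hom L L'' :=
  TensorProduct.map₂ (LinearMap.mul ℤ ℚ) (Lattice.Hom.comp L L' L'')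

theorem ArtinMotive.comp_tmul {L L' L'' : Lattice K} (q r : ℚ) (f : Lattice.Hom L L')
    (g : Lattice.Hom L' L'') : ArtinMotive.comp L L' L'' (q ⊗ₜ f) (r ⊗ₜ g) =
      (q * r) ⊗ₜ Lattice.Hom.comp L L' L'' f g := rfl

theorem ArtinMotive.id_comp {L L' : Lattice K} (x : ℚ ⊗[ℤ] Lattice.Hom L L') :
    ArtinMotive.comp L L L' (1 ⊗ₜ Lattice.Hom.id L) x = x := by
  induction x using TensorProduct.induction_on with
  | zero => simp
  | tmul q f => rw [comp_tmul, one_mul]; rfl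
  | add x y hx hy => rw [map_add, hx, hy]

theorem ArtinMotive.comp_id {L L' : Lattice K} (x : ℚ ⊗[ℤ] Lattice.Hom L L') :
    ArtinMotive.comp L L' L' x (1 ⊗ₜ Lattice.Hom.id L') = x := by
  induction x using TensorProduct.induction_on with
  | zero => simp
  | tmul q f => rw [comp_tmul, mul_one]; rfl
  | add x y hx hy => rw [map_add, LinearMap.add_apply, hx, hy]

theorem ArtinMotive.assoc {L₁ L₂ L₃ L₄ : Lattice K} (x : ℚ ⊗[ℤ] Lattice.Hom L₁ L₂)
    (y : ℚ ⊗[ℤ] Lattice.Hom L₂ L₃) (z : ℚ ⊗[ℤ] Lattice.Hom L₃ L₄) :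
    ArtinMotive.comp L₁ L₃ L₄ (ArtinMotive.comp L₁ L₂ L₃ x y) z =
      ArtinMotive.comp L₁ L₂ L₄ x (ArtinMotive.comp L₂ L₃ L₄ y z) := by
  induction x using TensorProduct.induction_on with
  | zero => simp
  | add x x' hx hx' => simp only [map_add, LinearMap.add_apply, hx, hx']
  | tmul q f =>
    induction y using TensorProduct.induction_on with
    | zero => simp
    | add y y' hy hy' => simp only [map_add, LinearMap.add_apply, hy, hy']
    | tmul r g =>
      induction z using TensorProduct.induction_on with
      | zero => simp
      | add z z' hz hz' => simp only [map_add, hz, hz']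
      | tmul s h =>
        simp only [comp_tmul, mul_assoc]
        rfl

instance : Category (ArtinMotive K) where
  Hom M N := ℚ ⊗[ℤ] Lattice.Hom M.lattice N.lattice
  id M := 1 ⊗ₜ Lattice.Hom.id M.lattice
  comp f g := ArtinMotive.comp _ _ _ f g
  id_comp := ArtinMotive.id_comp
  comp_id := ArtinMotive.comp_id
  assoc := ArtinMotive.assoc

/-! ### The realization of a lattice -/

/-- The map `K̄ ⊗ L → K̄ ⊗ L'`. -/
def Lattice.mapTensor {L L' : Lattice K} (f : L →ₗ[ℤ] L') :
    AlgebraicClosure K ⊗[ℤ] L →ₗ[K] AlgebraicClosure K ⊗[ℤ] L' :=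
  AlgebraTensorModule.map LinearMap.id f

theorem Lattice.mapTensor_add {L L' : Lattice K} (f g : L →ₗ[ℤ] L') :
    mapTensor (f + g) = mapTensor f + mapTensor g :=
  AlgebraTensorModule.map_add_right _ _ _

theorem Lattice.mapTensor_zsmul {L L' : Lattice K} (n : ℤ) (f : L →ₗ[ℤ] L') :
    mapTensor (n • f) = n • mapTensor f := by
  ext x l
  exact TensorProduct.tmul_smul n x (f l)

theorem Lattice.galAct_mapTensor {L L' : Lattice K} (f : Lattice.Hom L L')
    (γ : AlgebraicClosure K ≃ₐ[K] AlgebraicClosure K) :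
    L'.galAct γ ∘ₗ mapTensor f.1 = mapTensor f.1 ∘ₗ L.galAct γ := by
  rw [galAct, galAct, mapTensor, ← AlgebraTensorModule.map_comp, ← AlgebraTensorModule.map_comp,
    f.2 γ]
  rfl

/-- `T_dR(f) : T_dR(L) → T_dR(L')` -/
def Lattice.deRhamMap {L L' : Lattice K} (f : Lattice.Hom L L') : L.deRham →ₗ[K] L'.deRham :=
  (mapTensor f.1).restrict fun x hx γ => by
    rw [← LinearMap.comp_apply, galAct_mapTensor, LinearMap.comp_apply, hx γ]

/-- `ℚ ⊗ Hom(L, L') → Hom_K(T_dR(L), T_dR(L'))` -/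
def Lattice.realize (L L' : Lattice K) :
    ℚ ⊗[ℤ] Lattice.Hom L L' →ₗ[ℤ] (L.deRham →ₗ[K] L'.deRham) :=
  TensorProduct.lift <| LinearMap.mk₂ ℤ (fun (q : ℚ) f => (algebraMap ℚ K q) • deRhamMap f)
    (fun q r f => by rw [map_add, add_smul])
    (fun n q f => by rw [map_zsmul, smul_assoc])
    (fun q f g => by
      rw [← smul_add]; congr 1; ext x
      exact LinearMap.congr_fun (mapTensor_add f.1 g.1) x.1)
    (fun n q f => by
      rw [smul_comm]; congr 1; ext x
      exact LinearMap.congr_fun (mapTensor_zsmul n f.1) x.1)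

theorem Lattice.realize_tmul {L L' : Lattice K} (q : ℚ) (f : Lattice.Hom L L') :
    realize L L' (q ⊗ₜ f) = (algebraMap ℚ K q) • deRhamMap f := rfl

/-- The places at which the Frobenius of the realization is defined. -/
def Lattice.goodPlaces (L : Lattice K) : Set (HeightOneSpectrum (𝓞 K)) :=
  {v | IsUnramified v ∧ IsUnramifiedIn v L.splittingField}

theorem Lattice.eventually_goodPlaces (L : Lattice K) :
    ∀ᶠ v in cofinite, v ∈ L.goodPlaces :=
  (eventually_cofinite.mpr finite_not_isUnramified).and
    (eventually_cofinite.mpr (finite_not_isUnramifiedIn K L.splittingField))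

/-- The object of the Ogus category attached to `[L → 0]`. -/
def Lattice.toOg (L : Lattice K) : Og K where
  V := L.deRham
  places := L.goodPlaces
  isUnramified _ hv := hv.1
  cofinite := L.eventually_goodPlaces
  Vloc v _ := L.crys v
  finiteLoc v _ := Module.Finite.equiv (L.comparison v)
  F v hv := L.crysFrob v hv.1 hv.2
  F_bijective _ hv := L.crysFrob_bijective hv.1 hv.2
  g v _ := L.comparison v

/-- An endomorphism of finite order is pure of weight `0`. -/
theorem isPure_of_pow_eq_one {v : HeightOneSpectrum (𝓞 K)} {H : Type u} [AddCommGroup H]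
    [Module (v.adicCompletion K) H] (ψ : H →ₗ[v.adicCompletion K] H) {m : ℕ} (hm : 0 < m)
    (h : ψ ^ m = 1) : IsPure v 0 ψ := by
  intro α hα
  obtain ⟨x, hx⟩ := hα.exists_hasEigenvector
  have h1 := hx.pow_apply m
  have h2 : (ψ.baseChange (AlgebraicClosure (v.adicCompletion K))) ^ m = 1 := by
    rw [← LinearMap.baseChange_pow, h]
    exact LinearMap.baseChange_one _ _
  rw [h2] at h1
  have h3 : α ^ m = 1 := by
    have h4 : (1 : AlgebraicClosure (v.adicCompletion K)) • x = α ^ m • x := by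
      rw [one_smul, ← h1]; rfl
    exact (smul_left_injective _ hx.2 h4).symm
  have h6 : Polynomial.aeval α (Polynomial.X ^ m - 1 : Polynomial ℚ) = 0 := by simp [h3]
  refine ⟨⟨Polynomial.X ^ m - 1, (Polynomial.monic_X_pow_sub_C 1 hm.ne').ne_zero, h6⟩, fun z hz => ?_⟩
  obtain ⟨r, hr⟩ := minpoly.dvd ℚ α h6
  have h7 : z ^ m = 1 := by
    have := congrArg (Polynomial.aeval z) hr
    rw [map_mul, hz, zero_mul] at this
    simpa [sub_eq_zero] using this
  rw [Complex.norm_eq_one_of_pow_eq_one h7 hm.ne']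
  simp

end

/-! ## The realization functor -/

section

variable {K : Type u} [Field K] [NumberField K]

theorem isPure_of_subsingleton {v : HeightOneSpectrum (𝓞 K)} {i : ℤ} {H : Type u} [AddCommGroup H]
    [Module (v.adicCompletion K) H] [Subsingleton H] (ψ : H →ₗ[v.adicCompletion K] H) :
    IsPure v i ψ := by
  intro α hα
  obtain ⟨x, hx⟩ := hα.exists_hasEigenvector
  have h : ∀ y : AlgebraicClosure (v.adicCompletion K) ⊗[v.adicCompletion K] H, y = 0 := by
    intro y
    induction y using TensorProduct.induction_on with
    | zero => rfl
    | tmul a b => rw [Subsingleton.elim b 0, tmul_zero]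
    | add a b ha hb => rw [ha, hb, add_zero]
  exact absurd (h x) hx.2

theorem Og.localize_top (X : Og K) (v : HeightOneSpectrum (𝓞 K)) (hv : v ∈ X.places) :
    X.localize ⊤ v hv = ⊤ := by
  rw [Og.localize, Submodule.baseChange_top, Submodule.map_top]
  exact LinearEquiv.range _

theorem Og.localize_bot (X : Og K) (v : HeightOneSpectrum (𝓞 K)) (hv : v ∈ X.places) :
    X.localize ⊥ v hv = ⊥ := by
  rw [Og.localize, Submodule.baseChange_bot, Submodule.map_bot]

/-- The `n_v`-th power of the Frobenius is linear. -/
def Og.linearFrob (X : Og K) (v : HeightOneSpectrum (𝓞 K)) (hv : v ∈ X.places) :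
    X.Vloc v hv →ₗ[v.adicCompletion K] X.Vloc v hv where
  toFun := (X.F v hv)^[residueDegree v]
  map_add' x y := iterate_map_add _ _ x y
  map_smul' c x := by
    have h : ∀ (n : ℕ) (c : v.adicCompletion K) (x : X.Vloc v hv),
        (X.F v hv)^[n] (c • x) = (frob v)^[n] c • (X.F v hv)^[n] x := by
      intro n
      induction n with
      | zero => intro c x; rfl
      | succ n ih =>
        intro c x
        rw [Function.iterate_succ_apply, map_smulₛₗ, ih]
        rfl
    rw [h, (isStrict_integers (X.isUnramified v hv)).2]
    rfl

/-- The pure weight zero filtration. -/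
def trivialFiltration (V : Type u) [AddCommGroup V] [Module K V] (i : ℤ) : Submodule K V :=
  if 0 ≤ i then ⊤ else ⊥

theorem trivialFiltration_of_nonneg {V : Type u} [AddCommGroup V] [Module K V] {i : ℤ}
    (hi : 0 ≤ i) : trivialFiltration (K := K) V i = ⊤ := if_pos hi

theorem trivialFiltration_of_neg {V : Type u} [AddCommGroup V] [Module K V] {i : ℤ}
    (hi : i < 0) : trivialFiltration (K := K) V i = ⊥ := if_neg hi.not_ge

theorem Og.mem_localize_trivialFiltration (X : Og K) (v : HeightOneSpectrum (𝓞 K))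
    (hv : v ∈ X.places) (i : ℤ) (x : X.Vloc v hv) :
    X.F v hv x ∈ X.localize (trivialFiltration X.V i) v hv ↔
      x ∈ X.localize (trivialFiltration X.V i) v hv := by
  rcases lt_or_ge i 0 with hi | hi
  · rw [trivialFiltration_of_neg hi, Og.localize_bot, Submodule.mem_bot, Submodule.mem_bot]
    exact map_eq_zero_iff _ (X.F_bijective v hv).1
  · rw [trivialFiltration_of_nonneg hi, Og.localize_top]
    simp

/-- The realization of `[L → 0]`, pure of weight `0`. -/
def Lattice.toFOg (L : Lattice K) : FOg K where
  toOg := L.toOg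
  W := trivialFiltration L.toOg.V
  monotone i j hij := by
    rcases lt_or_ge i 0 with hi | hi
    · rw [trivialFiltration_of_neg hi]; exact bot_le
    · rw [trivialFiltration_of_nonneg (hi.trans hij)]; exact le_top
  exists_eq_bot := ⟨-1, trivialFiltration_of_neg (by decide)⟩
  exists_eq_top := ⟨0, trivialFiltration_of_nonneg le_rfl⟩
  map_mem i := by
    filter_upwards [L.toOg.cofinite] with v hv
    exact ⟨hv, L.toOg.mem_localize_trivialFiltration v hv i⟩
  pure i := by
    filter_upwards [L.toOg.cofinite] with v hv
    have hit : ∀ (j : ℤ) (n : ℕ) (x : L.toOg.Vloc v hv),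
        x ∈ L.toOg.localize (trivialFiltration L.toOg.V j) v hv →
        (L.toOg.F v hv)^[n] x ∈ L.toOg.localize (trivialFiltration L.toOg.V j) v hv := by
      intro j n
      induction n with
      | zero => intro x hx; exact hx
      | succ n ih =>
        intro x hx
        exact ih _ ((L.toOg.mem_localize_trivialFiltration v hv j x).mpr hx)
    let A := L.toOg.localize (trivialFiltration L.toOg.V i) v hv
    let B := L.toOg.localize (trivialFiltration L.toOg.V (i - 1)) v hv
    let Φ : A →ₗ[v.adicCompletion K] A := (L.toOg.linearFrob v hv).restrict fun x hx => hit i _ x hx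
    let ψ : (A ⧸ B.submoduleOf A) →ₗ[v.adicCompletion K] (A ⧸ B.submoduleOf A) :=
      (B.submoduleOf A).mapQ (B.submoduleOf A) Φ fun x hx => hit (i - 1) _ x.1 hx
    refine ⟨hv, ψ, fun x y hxy => congrArg _ (Subtype.ext hxy.symm), ?_⟩
    rcases lt_trichotomy i 0 with hi | rfl | hi
    · have : Subsingleton (A ⧸ B.submoduleOf A) := by
        have hA : A = ⊥ := by
          change L.toOg.localize _ v hv = ⊥
          rw [trivialFiltration_of_neg hi, Og.localize_bot]
        have : Subsingleton A := by rw [hA]; infer_instance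
        exact (Submodule.Quotient.mk_surjective _).subsingleton
      exact isPure_of_subsingleton ψ
    · obtain ⟨m, hm, h⟩ := L.exists_iterate_crysFrob hv.1 hv.2
      refine isPure_of_pow_eq_one ψ hm ?_
      have hΦ : ∀ n : ℕ, ∀ x : A, (((Φ ^ n) x : A) : L.toOg.Vloc v hv) =
          ((L.toOg.F v hv)^[residueDegree v])^[n] x := by
        intro n
        induction n with
        | zero => intro x; rfl
        | succ n ih =>
          intro x
          rw [pow_succ, Module.End.mul_apply, ih]
          rfl
      have hψ : ∀ n : ℕ, ∀ x : A, (ψ ^ n) (Submodule.Quotient.mk x) =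
          Submodule.Quotient.mk ((Φ ^ n) x) := by
        intro n
        induction n with
        | zero => intro x; rfl
        | succ n ih =>
          intro x
          rw [pow_succ, Module.End.mul_apply, pow_succ, Module.End.mul_apply, ← ih]
          rfl
      ext x
      rw [LinearMap.comp_apply, Submodule.mkQ_apply, hψ]
      refine congrArg _ (Subtype.ext ?_)
      rw [hΦ, ← Function.iterate_mul, mul_comm, Function.iterate_mul]
      exact Function.iterate_fixed (h _) _
    · have : Subsingleton (A ⧸ B.submoduleOf A) := by
        have hB : B = ⊤ := by
          change L.toOg.localize _ v hv = ⊤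
          rw [trivialFiltration_of_nonneg (by omega), Og.localize_top]
        refine Submodule.Quotient.subsingleton_iff.mpr (eq_top_iff.mpr fun x _ => ?_)
        change x.1 ∈ B
        rw [hB]; exact Submodule.mem_top
      exact isPure_of_subsingleton ψ

theorem Lattice.baseChange_comparison {L L' : Lattice K} (f : Lattice.Hom L L')
    (v : HeightOneSpectrum (𝓞 K)) (x : v.adicCompletion K ⊗[K] L.deRham) :
    (mapTensor f.1).baseChange (v.adicCompletion K) (L.comparison v x).1 =
      (L'.comparison v ((deRhamMap f).baseChange (v.adicCompletion K) x)).1 := by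
  induction x using TensorProduct.induction_on with
  | zero => simp
  | tmul c y => rfl
  | add x y hx hy =>
    rw [map_add, map_add, map_add]
    exact (map_add _ _ _).trans (congrArg₂ _ hx hy)

theorem Lattice.isOgHom_deRhamMap {L L' : Lattice K} (f : Lattice.Hom L L') :
    IsOgHom L.toOg L'.toOg (deRhamMap f) := by
  let F : IntermediateField K (AlgebraicClosure K) := L.splittingField ⊔ L'.splittingField
  have : FiniteDimensional K F := IntermediateField.finiteDimensional_sup _ _
  filter_upwards [L.toOg.cofinite, L'.toOg.cofinite,
    eventually_cofinite.mpr (finite_not_isUnramifiedIn K F)] with v hv hv' hF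
  have hcomm : ∀ γ, (L'.galAct γ).baseChange (v.adicCompletion K) ∘ₗ
      (mapTensor f.1).baseChange (v.adicCompletion K) =
      (mapTensor f.1).baseChange (v.adicCompletion K) ∘ₗ
        (L.galAct γ).baseChange (v.adicCompletion K) := by
    intro γ
    rw [← LinearMap.baseChange_comp, galAct_mapTensor, LinearMap.baseChange_comp]
  let φ : L.crys v →ₗ[v.adicCompletion K] L'.crys v :=
    ((mapTensor f.1).baseChange (v.adicCompletion K)).restrict fun x hx γ => by
      rw [← LinearMap.comp_apply, hcomm, LinearMap.comp_apply, hx γ]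
  refine ⟨hv, hv', φ, fun x => ?_, fun x => ?_⟩
  · apply Subtype.ext
    exact baseChange_comparison f v x
  · obtain ⟨y, hy⟩ := L.exists_localEmb v x.2
    have hin : ∀ z, L.localEmb v L.splittingField z = L.localEmb v F
        (localMap v (IntermediateField.inclusion le_sup_left) LinearMap.id z) := by
      intro z
      have := L.baseChange_localEmb (v := v) (L' := L) LinearMap.id
        (IntermediateField.inclusion (le_sup_left : L.splittingField ≤ F))
        (fun a => rfl) LinearMap.id z
      rwa [AlgebraTensorModule.map_id, LinearMap.baseChange_id] at this
    rw [hin] at hy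
    set w := localMap v (IntermediateField.inclusion
      (le_sup_left : L.splittingField ≤ F)) LinearMap.id y
    have hmap : ∀ z, (mapTensor f.1).baseChange (v.adicCompletion K) (L.localEmb v F z) =
        L'.localEmb v F (localMap v (AlgHom.id K F) f.1 z) := fun z =>
      L.baseChange_localEmb (v := v) (L' := L') LinearMap.id (AlgHom.id K F) (fun a => rfl) f.1 z
    have h1 := L.coe_crysFrob hv.1 hv.2 x F le_sup_left hF w hy
    have h2 := L'.coe_crysFrob hv'.1 hv'.2 (φ x) F le_sup_right hF
      (localMap v (AlgHom.id K F) f.1 w) (by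
        rw [← hmap, hy]; rfl)
    apply Subtype.ext
    refine Eq.trans ?_ h2.symm
    rw [L.localFrob_localMap hv.1 hF hF, ← hmap, ← h1]
    rfl

theorem isOgHom_zero (X Y : Og K) : IsOgHom X Y 0 := by
  filter_upwards [X.cofinite, Y.cofinite] with v hv hv'
  exact ⟨hv, hv', 0, fun x => by simp, fun x => by simp⟩

theorem IsOgHom.add {X Y : Og K} {f g : X.V →ₗ[K] Y.V} (hf : IsOgHom X Y f) (hg : IsOgHom X Y g) :
    IsOgHom X Y (f + g) := by
  filter_upwards [hf, hg] with v h h'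
  obtain ⟨hX, hY, φ, h1, h2⟩ := h
  obtain ⟨_, _, φ', h1', h2'⟩ := h'
  refine ⟨hX, hY, φ + φ', fun x => ?_, fun x => ?_⟩
  · simp only [LinearMap.add_apply, h1, h1', LinearMap.baseChange_add, map_add]
  · simp only [LinearMap.add_apply, h2, h2', map_add]

theorem IsOgHom.rat_smul {X Y : Og K} {f : X.V →ₗ[K] Y.V} (hf : IsOgHom X Y f) (q : ℚ) :
    IsOgHom X Y (algebraMap ℚ K q • f) := by
  filter_upwards [hf] with v h
  obtain ⟨hX, hY, φ, h1, h2⟩ := h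
  refine ⟨hX, hY, algebraMap ℚ (v.adicCompletion K) q • φ, fun x => ?_, fun x => ?_⟩
  · rw [LinearMap.smul_apply, h1, ← map_smul]
    congr 1
    induction x using TensorProduct.induction_on with
    | zero => simp
    | tmul c y =>
      rw [LinearMap.baseChange_tmul, LinearMap.baseChange_tmul, TensorProduct.smul_tmul',
        LinearMap.smul_apply, TensorProduct.tmul_smul, TensorProduct.smul_tmul',
        algebraMap_smul, algebraMap_smul]
    | add x y hx hy => rw [map_add, map_add, smul_add, hx, hy]
  · rw [LinearMap.smul_apply, LinearMap.smul_apply, h2, map_smulₛₗ]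
    congr 1
    exact (RingHom.map_rat_algebraMap (frob v : v.adicCompletion K →+* v.adicCompletion K) q).symm

theorem Lattice.isOgHom_realize {L L' : Lattice K} (x : ℚ ⊗[ℤ] Lattice.Hom L L') :
    IsOgHom L.toOg L'.toOg (realize L L' x) := by
  induction x using TensorProduct.induction_on with
  | zero => rw [map_zero]; exact isOgHom_zero _ _
  | tmul q f => exact (isOgHom_deRhamMap f).rat_smul q
  | add x y hx hy => rw [map_add]; exact hx.add hy

theorem Lattice.realize_id (L : Lattice K) : realize L L (1 ⊗ₜ Lattice.Hom.id L) = LinearMap.id := by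
  rw [realize_tmul, map_one, one_smul]
  ext x
  exact LinearMap.congr_fun AlgebraTensorModule.map_id x.1

theorem Lattice.deRhamMap_comp {L L' L'' : Lattice K} (f : Lattice.Hom L L')
    (g : Lattice.Hom L' L'') :
    deRhamMap (Lattice.Hom.comp L L' L'' f g) = deRhamMap g ∘ₗ deRhamMap f := by
  ext x
  exact LinearMap.congr_fun (AlgebraTensorModule.map_comp LinearMap.id LinearMap.id g.1 f.1) x.1

theorem Lattice.realize_comp {L L' L'' : Lattice K} (x : ℚ ⊗[ℤ] Lattice.Hom L L')
    (y : ℚ ⊗[ℤ] Lattice.Hom L' L'') :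
    realize L L'' (ArtinMotive.comp L L' L'' x y) = realize L' L'' y ∘ₗ realize L L' x := by
  induction x using TensorProduct.induction_on with
  | zero => simp
  | add x x' hx hx' =>
    rw [map_add, LinearMap.add_apply, map_add, hx, hx', map_add, LinearMap.comp_add]
  | tmul q f =>
    induction y using TensorProduct.induction_on with
    | zero => simp
    | add y y' hy hy' => rw [map_add, map_add, hy, hy', map_add, LinearMap.add_comp]
    | tmul r g =>
      rw [ArtinMotive.comp_tmul, realize_tmul, realize_tmul, realize_tmul, deRhamMap_comp,
        LinearMap.smul_comp, LinearMap.comp_smul, smul_smul, map_mul, mul_comm]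

variable (K) in
/-- The Ogus realization of Artin motives up to isogeny. -/
def ogusRealization : ArtinMotive K ⥤ FOg K where
  obj M := M.lattice.toFOg
  map f := ⟨⟨Lattice.realize _ _ f, Lattice.isOgHom_realize f⟩⟩
  map_id M := FOg.Hom.ext (Og.Hom.ext (Lattice.realize_id M.lattice))
  map_comp f g := FOg.Hom.ext (Og.Hom.ext (Lattice.realize_comp f g))

end

end OgusRealization

end

/-!
Over a finite normal extension `E / K` on which `L` and `L'` become constant, Galois descent turns
a `K`-linear map `f` between the de Rham realizations into an `E`-linear map
`M : E ⊗ L → E ⊗ L'`. If `f` is compatible with the Frobenius maps at almost all `v`, then the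
coordinates `m ∈ E` of the elements `M (1 ⊗ l)` satisfy `φ_v (1 ⊗ m) = 1 ⊗ m` at almost all `v`.
A multiple of such an `m` by a nonzero integer is an integer `a` of `E` with
`a ^ p ≡ a` modulo `p` for almost all prime numbers `p`. Hence almost all `p` split completely in
`ℚ(a)`. If `ℚ(a)` were not `ℚ`, then almost every `p` would have two distinct primes
of norm `p` above it, and the products of these would yield more ideals of norm at most `s` than
the `O(s)` that exist. So `m` is rational, and a multiple of `M` comes from a map `L → L'`, which
is `Γ`-equivariant because it preserves the invariants.
-/

noncomputable section

namespace OgusRealization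

open IsDedekindDomain NumberField TensorProduct CategoryTheory Filter

universe u

/-! ## Ideals of bounded norm -/

section IdealOfNat

variable {R : Type*} [CommRing R] [IsDedekindDomain R]

/-- The product of the ideals `P p`, where `p` runs through the prime factors of `m` with
multiplicity. -/
def idealOfNat (P : ℕ → Ideal R) (m : ℕ) : Ideal R :=
  ((m.primeFactorsList : Multiset ℕ).map P).prod

theorem normalizedFactors_idealOfNat {P : ℕ → Ideal R} {m : ℕ}
    (hP : ∀ p ∈ m.primeFactorsList, Prime (P p)) :
    UniqueFactorizationMonoid.normalizedFactors (idealOfNat P m) =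
      (m.primeFactorsList : Multiset ℕ).map P := by
  refine UniqueFactorizationMonoid.normalizedFactors_prod_of_prime fun I hI => ?_
  obtain ⟨p, hp, rfl⟩ := Multiset.mem_map.mp hI
  exact hP p hp

theorem idealOfNat_ne_zero {P : ℕ → Ideal R} {m : ℕ}
    (hP : ∀ p ∈ m.primeFactorsList, Prime (P p)) : idealOfNat P m ≠ 0 := by
  refine Multiset.prod_ne_zero fun h => ?_
  obtain ⟨p, hp, h0⟩ := Multiset.mem_map.mp h
  exact (hP p hp).ne_zero h0

variable [Module.Free ℤ R]

theorem absNorm_idealOfNat {P : ℕ → Ideal R} {m : ℕ} (hm : m ≠ 0)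
    (hP : ∀ p ∈ m.primeFactorsList, Ideal.absNorm (P p) = p) :
    Ideal.absNorm (idealOfNat P m) = m := by
  have hmap : (m.primeFactorsList : Multiset ℕ).map (Ideal.absNorm ∘ P) = m.primeFactorsList := by
    rw [Multiset.map_congr rfl (g := id) hP, Multiset.map_id]
  rw [idealOfNat, map_multiset_prod, Multiset.map_map, hmap, Multiset.prod_coe,
    Nat.prod_primeFactorsList hm]

open Classical in
theorem map_absNorm_filter_normalizedFactors {P Q : ℕ → Ideal R} {m n : ℕ}
    (hP : ∀ p ∈ m.primeFactorsList, Prime (P p) ∧ Ideal.absNorm (P p) = p)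
    (hQ : ∀ p ∈ n.primeFactorsList, Prime (Q p) ∧ Ideal.absNorm (Q p) = p ∧ P p ≠ Q p) :
    ((UniqueFactorizationMonoid.normalizedFactors (idealOfNat P m * idealOfNat Q n)).filter
      fun I => P (Ideal.absNorm I) = I).map Ideal.absNorm = m.primeFactorsList := by
  have hPm : ((m.primeFactorsList : Multiset ℕ).map P).filter (fun I => P (Ideal.absNorm I) = I) =
      (m.primeFactorsList : Multiset ℕ).map P := by
    refine Multiset.filter_eq_self.mpr fun I hI => ?_
    obtain ⟨p, hp, rfl⟩ := Multiset.mem_map.mp hI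
    rw [(hP p hp).2]
  have hQn : ((n.primeFactorsList : Multiset ℕ).map Q).filter (fun I => P (Ideal.absNorm I) = I) =
      0 := by
    refine Multiset.filter_eq_nil.mpr fun I hI => ?_
    obtain ⟨p, hp, rfl⟩ := Multiset.mem_map.mp hI
    rw [(hQ p hp).2.1]
    exact (hQ p hp).2.2
  rw [UniqueFactorizationMonoid.normalizedFactors_mul (idealOfNat_ne_zero fun p hp => (hP p hp).1)
      (idealOfNat_ne_zero fun p hp => (hQ p hp).1),
    normalizedFactors_idealOfNat fun p hp => (hP p hp).1,
    normalizedFactors_idealOfNat fun p hp => (hQ p hp).1, Multiset.filter_add, hPm, hQn, add_zero,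
    Multiset.map_map, Multiset.map_congr rfl (f := Ideal.absNorm ∘ P) (g := id)
      fun p hp => (hP p hp).2, Multiset.map_id]

theorem eq_of_idealOfNat_mul_eq {P Q : ℕ → Ideal R} {T : Set ℕ}
    (hP : ∀ p ∈ T, Prime (P p) ∧ Ideal.absNorm (P p) = p)
    (hQ : ∀ p ∈ T, Prime (Q p) ∧ Ideal.absNorm (Q p) = p ∧ P p ≠ Q p)
    {m n m' n' : ℕ} (hm₀ : m ≠ 0) (hm₀' : m' ≠ 0)
    (hm : ∀ p ∈ m.primeFactorsList, p ∈ T) (hn : ∀ p ∈ n.primeFactorsList, p ∈ T)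
    (hm' : ∀ p ∈ m'.primeFactorsList, p ∈ T) (hn' : ∀ p ∈ n'.primeFactorsList, p ∈ T)
    (h : idealOfNat P m * idealOfNat Q n = idealOfNat P m' * idealOfNat Q n') : m = m' := by
  have hperm : (m.primeFactorsList : Multiset ℕ) = m'.primeFactorsList := by
    rw [← map_absNorm_filter_normalizedFactors (fun p hp => hP p (hm p hp))
        (fun p hp => hQ p (hn p hp)), h,
      map_absNorm_filter_normalizedFactors (fun p hp => hP p (hm' p hp))
        (fun p hp => hQ p (hn' p hp))]
  rw [← Nat.prod_primeFactorsList hm₀, ← Nat.prod_primeFactorsList hm₀', ← Multiset.prod_coe, hperm,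
    Multiset.prod_coe]

end IdealOfNat

section Counting

variable {F : Type*} [Field F] [NumberField F]

theorem sum_le_card_absNorm_le {C : ℕ} (hC : 0 < C) {J : ℕ × ℕ → Ideal (𝓞 F)}
    (hJ : Function.Injective J)
    (hnorm : ∀ a b, Ideal.absNorm (J (a, b)) ≤ C * ((a + 1) * (b + 1))) (A : ℕ) (s : ℝ) :
    ∑ a ∈ Finset.range A, (s / (C * (a + 1)) - 1) ≤
      Nat.card {I : Ideal (𝓞 F) // (Ideal.absNorm I : ℝ) ≤ s} := by
  let B : Finset (Σ _ : ℕ, ℕ) :=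
    (Finset.range A).sigma fun a => Finset.range ⌊s / (C * ((a : ℝ) + 1))⌋₊
  have hB : ∀ x ∈ B, (Ideal.absNorm (J (x.1, x.2)) : ℝ) ≤ s := by
    rintro ⟨a, b⟩ hab
    have hb : ((b + 1 : ℕ) : ℝ) ≤ s / (C * ((a : ℝ) + 1)) :=
      (Nat.le_floor_iff' b.succ_ne_zero).mp (Finset.mem_range.mp (Finset.mem_sigma.mp hab).2)
    rw [le_div_iff₀ (by positivity)] at hb
    calc (Ideal.absNorm (J (a, b)) : ℝ) ≤ (C * ((a + 1) * (b + 1)) : ℕ) := by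
          exact_mod_cast hnorm a b
      _ = (b + 1 : ℕ) * (C * ((a : ℝ) + 1)) := by push_cast; ring
      _ ≤ s := hb
  have hfin : Finite {I : Ideal (𝓞 F) // (Ideal.absNorm I : ℝ) ≤ s} :=
    ((Ideal.finite_setOfPred_absNorm_le (S := 𝓞 F) ⌊s⌋₊).subset
      fun _ hI => Nat.le_floor hI).to_subtype
  have hcard : B.card ≤ Nat.card {I : Ideal (𝓞 F) // (Ideal.absNorm I : ℝ) ≤ s} := by
    rw [← Nat.card_eq_finsetCard]
    refine Nat.card_le_card_of_injective (fun x : B => ⟨J (x.1.1, x.1.2), hB x x.2⟩)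
      fun x y hxy => ?_
    have hxy' := Prod.ext_iff.mp (hJ (Subtype.ext_iff.mp hxy))
    exact Subtype.ext (Sigma.ext hxy'.1 (heq_of_eq hxy'.2))
  calc ∑ a ∈ Finset.range A, (s / (C * (a + 1)) - 1)
      ≤ ∑ a ∈ Finset.range A, (⌊s / (C * ((a : ℝ) + 1))⌋₊ : ℝ) :=
        Finset.sum_le_sum fun a _ => (Nat.sub_one_lt_floor _).le
    _ = B.card := by simp only [B, Finset.card_sigma, Finset.card_range, Nat.cast_sum]
    _ ≤ _ := Nat.cast_le.mpr hcard

/-- There are `O(s)` ideals of norm at most `s`, but more than `O(s)` pairs `(a, b)` with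
`(a + 1) * (b + 1) ≤ s`. -/
theorem not_injective_of_absNorm_le {C : ℕ} (hC : 0 < C) {J : ℕ × ℕ → Ideal (𝓞 F)}
    (hnorm : ∀ a b, Ideal.absNorm (J (a, b)) ≤ C * ((a + 1) * (b + 1))) :
    ¬ Function.Injective J := by
  intro hJ
  obtain ⟨κ, hκ⟩ : ∃ κ : ℝ, Tendsto (fun s : ℝ =>
      (Nat.card {I : Ideal (𝓞 F) // (Ideal.absNorm I : ℝ) ≤ s} : ℝ) / s) atTop (nhds κ) :=
    ⟨_, NumberField.Ideal.tendsto_norm_le_div_atTop F⟩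
  have hbound (A : ℕ) : ∑ a ∈ Finset.range A, 1 / ((a : ℝ) + 1) ≤ C * κ := by
    have hlim : Tendsto (fun s : ℝ => C * ((∑ a ∈ Finset.range A, (s / (C * (a + 1)) - 1)) / s))
        atTop (nhds (∑ a ∈ Finset.range A, 1 / ((a : ℝ) + 1))) := by
      have hlim₀ : Tendsto (fun s : ℝ => ∑ a ∈ Finset.range A, 1 / ((a : ℝ) + 1) - C * A / s) atTop
          (nhds (∑ a ∈ Finset.range A, 1 / ((a : ℝ) + 1) - 0)) :=
        tendsto_const_nhds.sub (tendsto_const_nhds.div_atTop tendsto_id)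
      rw [sub_zero] at hlim₀
      refine hlim₀.congr' ?_
      filter_upwards [eventually_gt_atTop 0] with s hs
      simp only [Finset.sum_sub_distrib, Finset.sum_const, Finset.card_range, nsmul_one, sub_div,
        mul_sub, Finset.sum_div, Finset.mul_sum, mul_div_assoc]
      congr 1
      refine Finset.sum_congr rfl fun a _ => ?_
      field_simp
    refine le_of_tendsto_of_tendsto hlim (hκ.const_mul _) ?_
    filter_upwards [eventually_gt_atTop 0] with s hs
    gcongr
    exact sum_le_card_absNorm_le hC hJ hnorm A s
  exact not_tendsto_const_atTop _ _
    (tendsto_atTop_mono hbound Real.tendsto_sum_range_one_div_nat_succ_atTop)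

/-- Otherwise the ideals `idealOfNat P (1 + a * N) * idealOfNat Q (1 + b * N)` would be distinct. -/
theorem exists_prime_not_dvd_apply_eq {N : ℕ} (hN : 0 < N) (P Q : ℕ → Ideal (𝓞 F))
    (hP : ∀ p, p.Prime → ¬ p ∣ N → Prime (P p) ∧ Ideal.absNorm (P p) = p)
    (hQ : ∀ p, p.Prime → ¬ p ∣ N → Prime (Q p) ∧ Ideal.absNorm (Q p) = p) :
    ∃ p, p.Prime ∧ ¬ p ∣ N ∧ P p = Q p := by
  by_contra! hPQ
  let T : Set ℕ := {p | p.Prime ∧ ¬ p ∣ N}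
  have hPT : ∀ p ∈ T, Prime (P p) ∧ Ideal.absNorm (P p) = p := fun p hp => hP p hp.1 hp.2
  have hQT : ∀ p ∈ T, Prime (Q p) ∧ Ideal.absNorm (Q p) = p ∧ P p ≠ Q p :=
    fun p hp => ⟨(hQ p hp.1 hp.2).1, (hQ p hp.1 hp.2).2, hPQ p hp.1 hp.2⟩
  have h₀ (a : ℕ) : 1 + a * N ≠ 0 := by omega
  have hT (a : ℕ) : ∀ p ∈ (1 + a * N).primeFactorsList, p ∈ T := by
    intro p hp
    have hp' := Nat.prime_of_mem_primeFactorsList hp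
    refine ⟨hp', fun hpN => hp'.one_lt.ne' (Nat.dvd_one.mp ?_)⟩
    exact (Nat.dvd_add_left (dvd_mul_of_dvd_right hpN a)).mp (Nat.dvd_of_mem_primeFactorsList hp)
  let J : ℕ × ℕ → Ideal (𝓞 F) := fun x =>
    idealOfNat P (1 + x.1 * N) * idealOfNat Q (1 + x.2 * N)
  have hnorm (a b : ℕ) : Ideal.absNorm (J (a, b)) = (1 + a * N) * (1 + b * N) := by
    rw [map_mul, absNorm_idealOfNat (h₀ a) fun p hp => (hPT p (hT _ p hp)).2,
      absNorm_idealOfNat (h₀ b) fun p hp => (hQT p (hT _ p hp)).2.1]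
  refine not_injective_of_absNorm_le (C := N * N) (by positivity) (J := J) (fun a b => ?_) ?_
  · rw [hnorm]
    calc (1 + a * N) * (1 + b * N) ≤ ((a + 1) * N) * ((b + 1) * N) := by gcongr <;> nlinarith
      _ = N * N * ((a + 1) * (b + 1)) := by ring
  · rintro ⟨a, b⟩ ⟨a', b'⟩ h
    have ha : a = a' := by
      have h₁ := eq_of_idealOfNat_mul_eq hPT hQT (h₀ a) (h₀ a') (hT a) (hT b) (hT a') (hT b') h
      exact Nat.eq_of_mul_eq_mul_right hN (Nat.add_left_cancel h₁)
    subst ha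
    have hab := congrArg Ideal.absNorm h
    rw [hnorm, hnorm] at hab
    have h₂ := Nat.eq_of_mul_eq_mul_left (Nat.pos_of_ne_zero (h₀ a)) hab
    rw [Nat.eq_of_mul_eq_mul_right hN (Nat.add_left_cancel h₂)]

end Counting

/-! ## Integers that are congruent to rational integers modulo almost all primes -/

section PowSub

variable {F : Type*} [Field F] [NumberField F]

theorem residueChar_eq_of_mem {v : HeightOneSpectrum (𝓞 F)} {p : ℕ} (hp : p.Prime)
    (h : (p : 𝓞 F) ∈ v.asIdeal) : residueChar v = p := by
  rw [← Ideal.Quotient.eq_zero_iff_mem, map_natCast, CharP.cast_eq_zero_iff _ (residueChar v)] at h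
  exact ((Nat.dvd_prime hp).mp h).resolve_left (Fact.out : (residueChar v).Prime).ne_one

theorem finite_setOf_mem {x : 𝓞 F} (hx : x ≠ 0) :
    {v : HeightOneSpectrum (𝓞 F) | x ∈ v.asIdeal}.Finite := by
  refine (Ideal.finite_factors (I := Ideal.span {x}) ?_).subset fun v hv => ?_
  · rwa [Ne, Ideal.zero_eq_bot, Ideal.span_singleton_eq_bot]
  · exact Ideal.dvd_span_singleton.mpr hv

theorem exists_mul_mem_adjoin {b : 𝓞 F} (B : PowerBasis ℚ F) (hB : B.gen = b) :
    ∃ D : ℤ, D ≠ 0 ∧ ∀ x : 𝓞 F, D * x ∈ Algebra.adjoin ℤ {b} := by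
  have hgen : IsIntegral ℤ B.gen := hB ▸ b.isIntegral_coe
  obtain ⟨D, hD⟩ := IsIntegrallyClosed.isIntegral_iff.mp
    (Algebra.discr_isIntegral ℚ (b := B.basis) fun i => B.basis_eq_pow i ▸ hgen.pow _)
  refine ⟨D, fun h => Algebra.discr_not_zero_of_basis ℚ B.basis (by rw [← hD, h, map_zero]),
    fun x => ?_⟩
  have hx : (algebraMap ℤ ℚ D : ℚ) • (x : F) ∈ Algebra.adjoin ℤ {(b : F)} := by
    rw [hD, ← hB]
    exact Algebra.discr_mul_isIntegral_mem_adjoin ℚ hgen x.isIntegral_coe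
  have hmap : Algebra.adjoin ℤ {(b : F)} =
      (Algebra.adjoin ℤ {b}).map (IsScalarTower.toAlgHom ℤ (𝓞 F) F) := by
    rw [AlgHom.map_adjoin, Set.image_singleton]
    rfl
  rw [hmap] at hx
  obtain ⟨y, hy, hyx⟩ := hx
  have hyDx : y = D * x := RingOfIntegers.ext (hyx.trans (by simp [Algebra.smul_def]))
  exact hyDx ▸ hy

theorem absNorm_eq_residueChar {v : HeightOneSpectrum (𝓞 F)} {b : 𝓞 F} {D : ℤ}
    (hD : ∀ x : 𝓞 F, D * x ∈ Algebra.adjoin ℤ {b}) (hDv : (D : 𝓞 F) ∉ v.asIdeal)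
    (hb : b ^ residueChar v - b ∈ v.asIdeal) : Ideal.absNorm v.asIdeal = residueChar v := by
  have := v.isMaximal
  let := Ideal.Quotient.field v.asIdeal
  let π := Ideal.Quotient.mk v.asIdeal
  have hπb : π b ∈ (⊥ : Subfield (𝓞 F ⧸ v.asIdeal)) := by
    rw [Subfield.mem_bot_iff_pow_eq_self _ (residueChar v), ← map_pow]
    exact Ideal.Quotient.eq.mpr hb
  have hadj : Algebra.adjoin ℤ {b} ≤
      subalgebraOfSubring ((⊥ : Subfield (𝓞 F ⧸ v.asIdeal)).toSubring.comap π) :=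
    Algebra.adjoin_le (Set.singleton_subset_iff.mpr hπb)
  have htop : (⊥ : Subfield (𝓞 F ⧸ v.asIdeal)) = ⊤ := by
    refine top_unique fun y _ => ?_
    obtain ⟨x, rfl⟩ := Ideal.Quotient.mk_surjective y
    have hDx : π D * π x ∈ (⊥ : Subfield (𝓞 F ⧸ v.asIdeal)) := map_mul π _ x ▸ hadj (hD x)
    have hD₀ : π D ≠ 0 := fun h => hDv (Ideal.Quotient.eq_zero_iff_mem.mp h)
    have hDbot : π D ∈ (⊥ : Subfield (𝓞 F ⧸ v.asIdeal)) := map_intCast π D ▸ intCast_mem _ D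
    exact inv_mul_cancel_left₀ hD₀ (π x) ▸ mul_mem (inv_mem hDbot) hDx
  rw [Ideal.absNorm_apply, Submodule.cardQuot_apply,
    ← Subfield.card_bot (𝓞 F ⧸ v.asIdeal) (residueChar v), htop]
  exact (Nat.card_congr Subfield.topEquiv.toEquiv).symm

theorem isMaximal_span_natCast {p : ℕ} (hp : p.Prime) : (Ideal.span {(p : ℤ)}).IsMaximal :=
  PrincipalIdealRing.isMaximal_of_irreducible (Nat.prime_iff_prime_int.mp hp).irreducible

theorem exists_asIdeal_eq_of_mem_primesOver {p : ℕ} (hp : p.Prime) {P : Ideal (𝓞 F)}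
    (hP : P ∈ (Ideal.span {(p : ℤ)}).primesOver (𝓞 F)) :
    ∃ v : HeightOneSpectrum (𝓞 F), v.asIdeal = P ∧ (p : 𝓞 F) ∈ v.asIdeal := by
  have hp₀ : Ideal.span {(p : ℤ)} ≠ ⊥ := by simpa using hp.ne_zero
  obtain ⟨hPprime, hPp⟩ := hP
  refine ⟨⟨P, hPprime, Ideal.ne_bot_of_liesOver_of_ne_bot hp₀ P⟩, rfl, ?_⟩
  simpa using (Ideal.mem_of_liesOver P (Ideal.span {(p : ℤ)}) p).mp
    (Ideal.mem_span_singleton_self _)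

theorem ncard_primesOver_eq_finrank {p : ℕ} (hp : p.Prime)
    (hu : ∀ v : HeightOneSpectrum (𝓞 F), (p : 𝓞 F) ∈ v.asIdeal →
      IsUnramified v ∧ Ideal.absNorm v.asIdeal = p) :
    ((Ideal.span {(p : ℤ)}).primesOver (𝓞 F)).ncard = Module.finrank ℚ F := by
  have := isMaximal_span_natCast hp
  have hone (q : (Ideal.span {(p : ℤ)}).primesOver (𝓞 F)) :
      q.1.ramificationIdx ℤ * q.1.inertiaDeg ℤ = 1 := by
    have := q.2.2
    obtain ⟨v, hqv, hpv⟩ := exists_asIdeal_eq_of_mem_primesOver hp q.2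
    obtain ⟨hv, hnorm⟩ := hu v hpv
    have : Algebra.IsUnramifiedAt ℤ q.1 := by
      simpa only [IsUnramified, hqv] using hv
    have hpow : p ^ q.1.inertiaDeg ℤ = p ^ 1 := by
      rw [Ideal.pow_inertiaDeg, pow_one, ← hqv, hnorm]
    rw [q.1.ramificationIdx_eq_one ℤ, Nat.pow_right_injective hp.two_le hpow]
  rw [← RingOfIntegers.rank, ← Ideal.sum_ramification_inertia_eq_finrank (Ideal.span {(p : ℤ)}),
    Finset.sum_congr rfl fun q _ => hone q, Finset.sum_const, smul_eq_mul, mul_one,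
    Finset.card_univ, ← Nat.card_eq_fintype_card, Nat.card_coe_set_eq]

theorem exists_ne_of_one_lt_finrank (hF : 1 < Module.finrank ℚ F) {p : ℕ} (hp : p.Prime)
    (hu : ∀ v : HeightOneSpectrum (𝓞 F), (p : 𝓞 F) ∈ v.asIdeal →
      IsUnramified v ∧ Ideal.absNorm v.asIdeal = p) :
    ∃ v w : HeightOneSpectrum (𝓞 F), (p : 𝓞 F) ∈ v.asIdeal ∧ (p : 𝓞 F) ∈ w.asIdeal ∧ v ≠ w := by
  have := isMaximal_span_natCast hp
  rw [← ncard_primesOver_eq_finrank hp hu,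
    Set.one_lt_ncard_iff (IsDedekindDomain.primesOver_finite _ _)] at hF
  obtain ⟨P, Q, hP, hQ, hPQ⟩ := hF
  obtain ⟨v, rfl, hv⟩ := exists_asIdeal_eq_of_mem_primesOver hp hP
  obtain ⟨w, rfl, hw⟩ := exists_asIdeal_eq_of_mem_primesOver hp hQ
  exact ⟨v, w, hv, hw, fun h => hPQ (congrArg _ h)⟩

/-- Almost all primes of `F` have degree one, so if `F ≠ ℚ` then two of them lie over almost every
prime number. -/
theorem finrank_eq_one_of_pow_sub_mem {b : 𝓞 F} (B : PowerBasis ℚ F) (hB : B.gen = b)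
    (h : ∀ᶠ v : HeightOneSpectrum (𝓞 F) in cofinite, b ^ residueChar v - b ∈ v.asIdeal) :
    Module.finrank ℚ F = 1 := by
  by_contra! hn
  obtain ⟨D, hD₀, hD⟩ := exists_mul_mem_adjoin B hB
  have hgood : ∀ᶠ v : HeightOneSpectrum (𝓞 F) in cofinite, IsUnramified v ∧
      Ideal.absNorm v.asIdeal = residueChar v := by
    filter_upwards [h, eventually_cofinite.mpr finite_not_isUnramified,
      (finite_setOf_mem (F := F) (x := D) (mod_cast hD₀)).eventually_cofinite_notMem]
      with v hbv hv hDv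
    exact ⟨hv, absNorm_eq_residueChar hD hDv hbv⟩
  rw [eventually_cofinite] at hgood
  let N : ℕ := ∏ v ∈ hgood.toFinset, residueChar v
  have hN : 0 < N := Finset.prod_pos fun v _ => (Fact.out : (residueChar v).Prime).pos
  have hgood' {p : ℕ} (hp : p.Prime) (hpN : ¬ p ∣ N) (v : HeightOneSpectrum (𝓞 F))
      (hv : (p : 𝓞 F) ∈ v.asIdeal) : IsUnramified v ∧ Ideal.absNorm v.asIdeal = p := by
    by_contra hbad
    rw [← residueChar_eq_of_mem hp hv] at hbad hpN
    exact hpN (Finset.dvd_prod_of_mem _ (hgood.mem_toFinset.mpr hbad))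
  have htwo (p : ℕ) (hp : p.Prime) (hpN : ¬ p ∣ N) : ∃ P Q : Ideal (𝓞 F),
      (Prime P ∧ Ideal.absNorm P = p) ∧ (Prime Q ∧ Ideal.absNorm Q = p) ∧ P ≠ Q := by
    obtain ⟨v, w, hv, hw, hvw⟩ :=
      exists_ne_of_one_lt_finrank
        (lt_of_le_of_ne (Module.finrank_pos (M := F)) hn.symm) hp (hgood' hp hpN)
    exact ⟨v.asIdeal, w.asIdeal, ⟨v.prime, (hgood' hp hpN v hv).2⟩,
      ⟨w.prime, (hgood' hp hpN w hw).2⟩, fun h => hvw (HeightOneSpectrum.ext h)⟩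
  choose! P Q hP hQ hPQ using htwo
  obtain ⟨p, hp, hpN, heq⟩ := exists_prime_not_dvd_apply_eq hN P Q hP hQ
  exact hPQ p hp hpN heq

theorem residueChar_under {E : Type*} [Field E] [NumberField E] [Algebra F E]
    (w : HeightOneSpectrum (𝓞 E)) : residueChar (w.under (𝓞 F)) = residueChar w := by
  refine (residueChar_eq_of_mem Fact.out ?_).symm
  have h : algebraMap (𝓞 F) (𝓞 E) (residueChar (w.under (𝓞 F)) : ℕ) ∈ w.asIdeal :=
    residueChar_mem (w.under (𝓞 F))
  rwa [map_natCast] at h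

theorem surjective_under {E : Type*} [Field E] [NumberField E] [Algebra F E] :
    Function.Surjective fun w : HeightOneSpectrum (𝓞 E) => w.under (𝓞 F) := by
  intro v
  have := v.isMaximal
  obtain ⟨P, hP, hPv⟩ := Ideal.exists_maximal_ideal_liesOver_of_isIntegral (S := 𝓞 E) v.asIdeal
  exact ⟨⟨P, hP.isPrime, Ideal.ne_bot_of_liesOver_of_ne_bot v.ne_bot P⟩,
    HeightOneSpectrum.ext hPv.over.symm⟩

theorem mem_range_of_pow_sub_mem {a : 𝓞 F}
    (h : ∀ᶠ v : HeightOneSpectrum (𝓞 F) in cofinite, a ^ residueChar v - a ∈ v.asIdeal) :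
    (a : F) ∈ Set.range (algebraMap ℚ F) := by
  have hint : IsIntegral ℚ (a : F) := Algebra.IsIntegral.isIntegral _
  let F₀ := IntermediateField.adjoin ℚ {(a : F)}
  let g : F₀ := IntermediateField.AdjoinSimple.gen ℚ (a : F)
  have hg : IsIntegral ℤ g := (isIntegral_algebraMap_iff (algebraMap F₀ F).injective).mp a.2
  let b : 𝓞 F₀ := ⟨g, hg⟩
  have hba : algebraMap (𝓞 F₀) (𝓞 F) b = a := RingOfIntegers.ext rfl
  have hb : ∀ᶠ v : HeightOneSpectrum (𝓞 F₀) in cofinite, b ^ residueChar v - b ∈ v.asIdeal := by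
    rw [eventually_cofinite] at h ⊢
    refine Set.Finite.of_preimage (h.subset fun w hw hwa => hw ?_) surjective_under
    change algebraMap (𝓞 F₀) (𝓞 F) (b ^ residueChar (w.under (𝓞 F₀)) - b) ∈ w.asIdeal
    rwa [map_sub, map_pow, hba, residueChar_under]
  have hbot : F₀ = ⊥ := IntermediateField.finrank_eq_one_iff.mp <| finrank_eq_one_of_pow_sub_mem
    (IntermediateField.adjoin.powerBasis hint) (IntermediateField.adjoin.powerBasis_gen hint) hb
  have haF₀ : (a : F) ∈ F₀ := IntermediateField.mem_adjoin_simple_self ℚ (a : F)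
  rw [hbot] at haF₀
  exact IntermediateField.mem_bot.mp haF₀

end PowSub

/-! ## Elements fixed by the Frobenius lifts -/

section FrobeniusFixed

theorem trace_one_tmul {R S : Type*} (A : Type*) [CommRing R] [CommRing S] [CommRing A]
    [Algebra R S] [Algebra R A] [Module.Free R S] [Module.Finite R S] (s : S) :
    Algebra.trace A (A ⊗[R] S) (1 ⊗ₜ[R] s) = algebraMap R A (Algebra.trace R S s) := by
  have hlmul : Algebra.lmul A (A ⊗[R] S) (1 ⊗ₜ[R] s) = (Algebra.lmul R S s).baseChange A := by
    ext t
    simp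
  rw [Algebra.trace_apply, Algebra.trace_apply, hlmul, LinearMap.trace_baseChange]

variable {K : Type*} [Field K] [NumberField K]
variable {E : Type*} [Field E] [NumberField E] [Algebra K E]

variable (K E) in
/-- A common denominator of a trace dual basis of integers serves as `D`. -/
theorem exists_mul_mem_map_of_intTrace_mem : ∃ D : 𝓞 E, D ≠ 0 ∧ ∀ (I : Ideal (𝓞 K)) (x : 𝓞 E),
    (∀ y, Algebra.intTrace (𝓞 K) (𝓞 E) (x * y) ∈ I) →
      D * x ∈ I.map (algebraMap (𝓞 K) (𝓞 E)) := by
  classical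
  obtain ⟨ι, b, hb⟩ := FiniteDimensional.exists_is_basis_integral (𝓞 K) K E
  choose β hβ using fun i => IsIntegralClosure.isIntegral_iff (A := 𝓞 E) |>.mp (hb i)
  obtain ⟨D, hD⟩ := IsLocalization.exist_integer_multiples_of_finite (nonZeroDivisors (𝓞 E))
    (S := E) b.traceDual
  choose δ hδ using hD
  refine ⟨D, nonZeroDivisors.coe_ne_zero D, fun I x hx => ?_⟩
  have hsum : D * x =
      ∑ i, algebraMap (𝓞 K) (𝓞 E) (Algebra.intTrace (𝓞 K) (𝓞 E) (x * β i)) * δ i := by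
    apply FaithfulSMul.algebraMap_injective (𝓞 E) E
    have hδ' (i : ι) : algebraMap (𝓞 E) E (δ i) = algebraMap (𝓞 E) E D * b.traceDual i := by
      rw [hδ, Algebra.smul_def]
    have htrace (i : ι) : algebraMap (𝓞 E) E (algebraMap (𝓞 K) (𝓞 E)
        (Algebra.intTrace (𝓞 K) (𝓞 E) (x * β i))) =
          algebraMap K E (b.traceDual.repr (algebraMap (𝓞 E) E x) i) := by
      rw [b.traceDual_repr_apply, Algebra.traceForm_apply, ← hβ, ← map_mul,
        ← Algebra.algebraMap_intTrace (A := 𝓞 K), ← IsScalarTower.algebraMap_apply,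
        ← IsScalarTower.algebraMap_apply]
    simp only [map_mul, map_sum, hδ', htrace]
    conv_lhs => rw [← b.traceDual.sum_repr (algebraMap (𝓞 E) E x), Finset.mul_sum]
    exact Finset.sum_congr rfl fun i _ => by rw [Algebra.smul_def, mul_left_comm]
  rw [hsum]
  exact sum_mem fun i _ => Ideal.mul_mem_right _ _ (Ideal.mem_map_of_mem _ (hx (β i)))

theorem trace_mem_of_mem_integersOver {v : HeightOneSpectrum (𝓞 K)}
    {c : v.adicCompletion K ⊗[K] E} (hc : c ∈ integersOver v E) :
    Algebra.trace (v.adicCompletion K) (v.adicCompletion K ⊗[K] E) c ∈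
      v.adicCompletionIntegers K := by
  rw [← Subalgebra.mem_toSubmodule, integersOver_eq_span] at hc
  induction hc using Submodule.span_induction with
  | mem y hy =>
    obtain ⟨a, rfl⟩ := hy
    rw [trace_one_tmul, RingOfIntegers.coe_eq_algebraMap,
      ← Algebra.algebraMap_intTrace (A := 𝓞 K)]
    exact (algebraMap (𝓞 K) (v.adicCompletionIntegers K) _).2
  | zero => rw [map_zero]; exact zero_mem _
  | add y z _ _ hy hz => rw [map_add]; exact add_mem hy hz
  | smul a y _ hy =>
    have hay : a • y = (a : v.adicCompletion K) • y := by
      rw [Algebra.smul_def, Algebra.smul_def]; rfl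
    rw [hay, map_smul]
    exact mul_mem a.2 hy

theorem algebraMap_valued_lt_one_iff {v : HeightOneSpectrum (𝓞 K)} {t : 𝓞 K} :
    Valued.v (algebraMap K (v.adicCompletion K) (t : K)) < 1 ↔ t ∈ v.asIdeal := by
  rw [← v.intValuation_lt_one_iff_mem, ← v.valuation_of_algebraMap (K := K),
    ← HeightOneSpectrum.valuedAdicCompletion_eq_valuation']
  rfl

theorem intTrace_mem_of_tmul_eq {v : HeightOneSpectrum (𝓞 K)} {x : 𝓞 E}
    {c : v.adicCompletion K ⊗[K] E} (hc : c ∈ integersOver v E)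
    (hx : (1 : v.adicCompletion K) ⊗ₜ[K] (x : E) = (residueChar v : ℕ) * c) (y : 𝓞 E) :
    Algebra.intTrace (𝓞 K) (𝓞 E) (x * y) ∈ v.asIdeal := by
  have hp : Valued.v (residueChar v : v.adicCompletion K) < 1 := by
    simpa using algebraMap_valued_lt_one_iff.mpr (residueChar_mem v)
  have hcy : c * 1 ⊗ₜ[K] (y : E) ∈ integersOver v E := mul_mem hc (Algebra.subset_adjoin ⟨y, rfl⟩)
  have hxy : (1 : v.adicCompletion K) ⊗ₜ[K] ((x * y : 𝓞 E) : E) =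
      (residueChar v : v.adicCompletion K) • (c * 1 ⊗ₜ[K] (y : E)) := by
    rw [Algebra.smul_def, map_natCast, ← mul_assoc, ← hx, Algebra.TensorProduct.tmul_mul_tmul,
      one_mul, RingOfIntegers.coe_eq_algebraMap, map_mul]
  rw [← algebraMap_valued_lt_one_iff, RingOfIntegers.coe_eq_algebraMap,
    Algebra.algebraMap_intTrace (L := E), ← trace_one_tmul, ← RingOfIntegers.coe_eq_algebraMap, hxy,
    map_smul, smul_eq_mul, map_mul]
  exact mul_lt_one_of_lt_of_le hp (trace_mem_of_mem_integersOver hcy)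

theorem tendsto_under_cofinite :
    Tendsto (fun w : HeightOneSpectrum (𝓞 E) => w.under (𝓞 K)) cofinite cofinite := by
  refine Tendsto.cofinite_of_finite_preimage_singleton fun v => ?_
  have hp : ((residueChar v : ℕ) : 𝓞 E) ≠ 0 := mod_cast (Fact.out : (residueChar v).Prime).ne_zero
  refine ((finite_setOf_mem hp).subset ?_).to_subtype
  rintro w rfl
  exact residueChar_under (F := K) w ▸ residueChar_mem w

theorem exists_pow_sub_eq_mul {v : HeightOneSpectrum (𝓞 K)} (hv : IsUnramified v)
    (hE : IsUnramifiedIn v E) {a : 𝓞 E}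
    (ha : frobOver v E ((1 : v.adicCompletion K) ⊗ₜ[K] (a : E)) = 1 ⊗ₜ (a : E)) :
    ∃ c ∈ integersOver v E,
      (1 : v.adicCompletion K) ⊗ₜ[K] ((a ^ residueChar v - a : 𝓞 E) : E) =
        (residueChar v : ℕ) * c := by
  obtain ⟨-, c, hc, hac⟩ := (isStrict_integersOver hv hE).1.isFrobeniusLift
    ((1 : v.adicCompletion K) ⊗ₜ[K] (a : E)) (Algebra.subset_adjoin ⟨a, rfl⟩)
  change frobOver v E _ = _ at hac
  refine ⟨-c, neg_mem hc, ?_⟩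
  rw [ha, Algebra.TensorProduct.tmul_pow, one_pow] at hac
  rw [RingOfIntegers.coe_eq_algebraMap, map_sub, map_pow, tmul_sub]
  linear_combination -hac

theorem eventually_pow_sub_mem {a : 𝓞 E} (h : ∀ᶠ v : HeightOneSpectrum (𝓞 K) in cofinite,
      frobOver v E ((1 : v.adicCompletion K) ⊗ₜ[K] (a : E)) = 1 ⊗ₜ (a : E)) :
    ∀ᶠ w : HeightOneSpectrum (𝓞 E) in cofinite, a ^ residueChar w - a ∈ w.asIdeal := by
  obtain ⟨D, hD₀, hD⟩ := exists_mul_mem_map_of_intTrace_mem K E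
  have hunder := tendsto_under_cofinite (K := K) (E := E)
  filter_upwards [hunder.eventually h,
    hunder.eventually (eventually_cofinite.mpr finite_not_isUnramified),
    hunder.eventually (eventually_cofinite.mpr (finite_not_isUnramifiedIn K E)),
    (finite_setOf_mem hD₀).eventually_cofinite_notMem] with w hfix hv hE hDw
  obtain ⟨c, hc, hac⟩ := exists_pow_sub_eq_mul hv hE hfix
  have hDa : D * (a ^ residueChar (w.under (𝓞 K)) - a) ∈ w.asIdeal :=
    Ideal.map_comap_le (hD _ _ (intTrace_mem_of_tmul_eq hc hac))
  rw [residueChar_under] at hDa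
  exact (w.isPrime.mem_or_mem hDa).resolve_left hDw

theorem mem_range_of_frobOver_eq {m : E} (h : ∀ᶠ v : HeightOneSpectrum (𝓞 K) in cofinite,
      frobOver v E ((1 : v.adicCompletion K) ⊗ₜ[K] m) = 1 ⊗ₜ m) :
    m ∈ Set.range (algebraMap ℚ E) := by
  have halg : IsAlgebraic ℤ m :=
    (IsFractionRing.isAlgebraic_iff ℤ ℚ E).mpr (Algebra.IsAlgebraic.isAlgebraic m)
  obtain ⟨d, hd, hint⟩ := halg.exists_integral_multiple
  let a : 𝓞 E := ⟨d • m, hint⟩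
  obtain ⟨q, hq⟩ : (a : E) ∈ Set.range (algebraMap ℚ E) := by
    refine mem_range_of_pow_sub_mem (eventually_pow_sub_mem (K := K) ?_)
    filter_upwards [h] with v hv
    change frobOver v E ((1 : v.adicCompletion K) ⊗ₜ[K] (d • m)) = 1 ⊗ₜ (d • m)
    rw [tmul_smul, map_zsmul, hv]
  refine ⟨q / d, ?_⟩
  rw [map_div₀, hq, map_intCast, div_eq_iff (Int.cast_ne_zero.mpr hd), mul_comm]
  exact zsmul_eq_mul m d

end FrobeniusFixed

/-! ## Galois descent -/

section GaloisDescent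

variable {K E : Type*} [Field K] [Field E] [Algebra K E] [FiniteDimensional K E] [IsGalois K E]

theorem sum_traceDual_mul_apply {ι : Type*} [Fintype ι] [DecidableEq ι] (b : Module.Basis ι K E)
    [DecidableEq Gal(E/K)] (g : Gal(E/K)) :
    ∑ i, b.traceDual i * g (b i) = if g = 1 then 1 else 0 := by
  let A : Matrix ι Gal(E/K) E := .of fun i g => g (b i)
  let C : Matrix Gal(E/K) ι E := .of fun g i => g (b.traceDual i)
  have hAC : A * C = 1 := by
    ext i j
    calc (A * C) i j = algebraMap K E (Algebra.trace K E (b i * b.traceDual j)) := by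
          rw [trace_eq_sum_automorphisms]
          simp [A, C, Matrix.mul_apply]
      _ = (1 : Matrix ι ι E) i j := by
          rw [b.trace_mul_traceDual, apply_ite (algebraMap K E), map_one, map_zero,
            Matrix.one_apply]
  have hcard : Fintype.card ι = Fintype.card Gal(E/K) := by
    rw [← Module.finrank_eq_card_basis b, ← Nat.card_eq_fintype_card, IsGalois.card_aut_eq_finrank]
  have hCA : C * A = 1 := (Matrix.mul_eq_one_comm_of_card_eq _ _ _ hcard).mp hAC
  simpa [A, C, Matrix.mul_apply, Matrix.one_apply, eq_comm] using congrFun₂ hCA 1 g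

variable {N : Type*} [AddCommGroup N] [Module K N] [Module E N]
  {ρ : Representation K Gal(E/K) N}

theorem span_invariants_eq_top (hρ : ∀ g (e : E) x, ρ g (e • x) = g e • ρ g x) :
    Submodule.span E (ρ.invariants : Set N) = ⊤ := by
  classical
  let b := Module.finBasis K E
  refine eq_top_iff.mpr fun x _ => ?_
  have hx : x = ∑ i, b.traceDual i • ρ.norm (b i • x) := by
    simp only [Representation.norm, LinearMap.sum_apply, hρ, Finset.smul_sum, smul_smul]
    rw [Finset.sum_comm]
    simp only [← Finset.sum_smul, sum_traceDual_mul_apply, ite_smul, one_smul, zero_smul,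
      Finset.sum_ite_eq', Finset.mem_univ, if_true, map_one, Module.End.one_apply]
  rw [hx]
  exact sum_mem fun i _ =>
    Submodule.smul_mem _ _ (Submodule.subset_span fun g => ρ.self_norm_apply g _)

variable [IsScalarTower K E N]

theorem norm_smul_of_mem_invariants (hρ : ∀ g (e : E) x, ρ g (e • x) = g e • ρ g x) (e : E) {x : N}
    (hx : x ∈ ρ.invariants) : ρ.norm (e • x) = Algebra.trace K E e • x := by
  have hx' (g : Gal(E/K)) : ρ g x = x := hx g
  simp only [Representation.norm, LinearMap.sum_apply, hρ, hx']
  rw [← Finset.sum_smul, ← trace_eq_sum_automorphisms, algebraMap_smul]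

variable {N' : Type*} [AddCommGroup N'] [Module K N'] [Module E N'] [IsScalarTower K E N']

theorem exists_extend_invariants (hρ : ∀ g (e : E) x, ρ g (e • x) = g e • ρ g x)
    (f : ρ.invariants →ₗ[K] N') : ∃ M : N →ₗ[E] N', ∀ x : ρ.invariants, M x = f x := by
  classical
  let b := Module.finBasis K E
  let T : N →ₗ[K] ρ.invariants := ρ.norm.codRestrict _ fun x g => ρ.self_norm_apply g x
  let M : N →ₗ[K] N' :=
    ∑ i, Algebra.lsmul K K N' (b.traceDual i) ∘ₗ f ∘ₗ T ∘ₗ Algebra.lsmul K K N (b i)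
  have hM (e : E) (x : ρ.invariants) : M (e • x) = e • f x := by
    have hT (i) : T (b i • e • (x : N)) = b.traceDual.repr e i • x := by
      apply Subtype.ext
      rw [b.traceDual_repr_apply, Algebra.traceForm_apply, mul_comm, smul_smul]
      exact norm_smul_of_mem_invariants hρ _ x.2
    calc M (e • x) = ∑ i, b.traceDual i • f (T (b i • e • (x : N))) := by simp [M]
      _ = (∑ i, b.traceDual.repr e i • b.traceDual i) • f x := by
          simp only [hT, map_smul, Finset.sum_smul, smul_assoc, smul_comm (b.traceDual _)]
      _ = e • f x := by rw [b.traceDual.sum_repr]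
  have hM_one (x : ρ.invariants) : M x = f x := by simpa using hM 1 x
  refine ⟨{ M with map_smul' := fun e x => ?_ }, hM_one⟩
  change M (e • x) = e • M x
  have hx : x ∈ Submodule.span E (ρ.invariants : Set N) := by
    rw [span_invariants_eq_top hρ]
    exact Submodule.mem_top
  induction hx using Submodule.span_induction generalizing e with
  | mem x hx => rw [hM e ⟨x, hx⟩, hM_one ⟨x, hx⟩]
  | zero => simp only [smul_zero, map_zero]
  | add x y _ _ hx hy => rw [smul_add, map_add, map_add, smul_add, hx, hy]
  | smul c x _ hx => rw [smul_smul, hx, hx, smul_smul]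

end GaloisDescent

/-! ## Descent for lattices -/

namespace Lattice

section Descent

variable {K : Type u} [Field K] {L L' : Lattice K}
  {E : IntermediateField K (AlgebraicClosure K)}

variable (L) in
theorem isClosed_ker : IsClosed (L.ρ.ker : Set Gal(AlgebraicClosure K/K)) := by
  let b := Module.Free.chooseBasis ℤ L
  have hker : (L.ρ.ker : Set Gal(AlgebraicClosure K/K)) = ⋂ i, {γ | L.ρ γ (b i) = b i} := by
    ext γ
    simp only [SetLike.mem_coe, MonoidHom.mem_ker, Set.mem_iInter, Set.mem_ofPred_eq]
    exact ⟨fun h i => by rw [h]; rfl, fun h => b.ext h⟩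
  refine L.ρ.ker.isClosed_of_isOpen ?_
  rw [hker]
  exact isOpen_iInter_of_finite fun i => L.isOpen_stabilizer (b i)

theorem exists_fieldEmb_of_le (hL : L.splittingField ≤ E) {x : AlgebraicClosure K ⊗[ℤ] L}
    (hx : x ∈ L.deRham) : ∃ y, L.fieldEmb E y = x := by
  obtain ⟨y, rfl⟩ := L.exists_fieldEmb hx
  refine ⟨AlgebraTensorModule.map (IntermediateField.inclusion hL).toLinearMap LinearMap.id y, ?_⟩
  rw [fieldEmb, fieldEmb, ← LinearMap.comp_apply, ← AlgebraTensorModule.map_comp]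
  rfl

variable [CharZero K]

variable (L) in
theorem fixingSubgroup_splittingField : L.splittingField.fixingSubgroup = L.ρ.ker :=
  InfiniteGalois.fixingSubgroup_fixedField ⟨L.ρ.ker, L.isClosed_ker⟩

variable (L L') in
theorem exists_normal_splittingField_le :
    ∃ E : IntermediateField K (AlgebraicClosure K), FiniteDimensional K E ∧ Normal K E ∧
      L.splittingField ≤ E ∧ L'.splittingField ≤ E := by
  let F := L.splittingField ⊔ L'.splittingField
  have : FiniteDimensional K F := IntermediateField.finiteDimensional_sup _ _
  have hF := F.le_normalClosure
  exact ⟨IntermediateField.normalClosure K F (AlgebraicClosure K), inferInstance, inferInstance,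
    le_sup_left.trans hF, le_sup_right.trans hF⟩

variable [Normal K E]

/-- The action on `L` of the finite quotient `Gal(E/K)` of the absolute Galois group through which
it factors when `L` becomes constant over `E`. -/
def quotientRep (hL : L.splittingField ≤ E) : Representation ℤ Gal(E/K) L :=
  have hker : (AlgEquiv.restrictNormalHom E).ker ≤ L.ρ.ker := by
    rw [IntermediateField.restrictNormalHom_ker, ← L.fixingSubgroup_splittingField]
    exact IntermediateField.fixingSubgroup_antitone hL
  (QuotientGroup.lift _ L.ρ hker).comp (QuotientGroup.quotientKerEquivOfSurjective
    (AlgEquiv.restrictNormalHom E)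
    (AlgEquiv.restrictNormalHom_surjective (AlgebraicClosure K))).symm.toMonoidHom

theorem quotientRep_restrictNormalHom (hL : L.splittingField ≤ E)
    (γ : Gal(AlgebraicClosure K/K)) :
    quotientRep hL (AlgEquiv.restrictNormalHom E γ) = L.ρ γ := by
  have hγ : (QuotientGroup.quotientKerEquivOfSurjective (AlgEquiv.restrictNormalHom E)
      (AlgEquiv.restrictNormalHom_surjective (AlgebraicClosure K))).symm
        (AlgEquiv.restrictNormalHom E γ) = γ := by
    rw [MulEquiv.symm_apply_eq]
    rfl
  rw [quotientRep, MonoidHom.comp_apply, MulEquiv.toMonoidHom_eq_coe, MonoidHom.coe_coe, hγ,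
    QuotientGroup.lift_mk]

/-- The diagonal action of `Gal(E/K)` on `E ⊗ L`, for a lattice `L` that becomes constant
over `E`. -/
def semilinearRep (hL : L.splittingField ≤ E) : Representation K Gal(E/K) (E ⊗[ℤ] L) where
  toFun g := AlgebraTensorModule.map g.toLinearMap (quotientRep hL g)
  map_one' := by
    rw [map_one]
    exact AlgebraTensorModule.map_id
  map_mul' g h := by
    rw [map_mul, ← AlgebraTensorModule.map_mul]
    rfl

theorem semilinearRep_smul (hL : L.splittingField ≤ E) (g : Gal(E/K)) (e : E) (x : E ⊗[ℤ] L) :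
    semilinearRep hL g (e • x) = g e • semilinearRep hL g x := by
  induction x with
  | zero => simp only [smul_zero, map_zero]
  | tmul a l => exact congrArg (· ⊗ₜ[ℤ] quotientRep hL g l) (map_mul g e a)
  | add x y hx hy => simp only [smul_add, map_add, hx, hy]

theorem fieldEmb_semilinearRep (hL : L.splittingField ≤ E) (γ : Gal(AlgebraicClosure K/K))
    (x : E ⊗[ℤ] L) :
    L.fieldEmb E (semilinearRep hL (AlgEquiv.restrictNormalHom E γ) x) =
      L.galAct γ (L.fieldEmb E x) := by
  induction x with
  | zero => simp only [map_zero]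
  | tmul a l =>
    change _ ⊗ₜ[ℤ] quotientRep hL (AlgEquiv.restrictNormalHom E γ) l = _ ⊗ₜ[ℤ] L.ρ γ l
    rw [quotientRep_restrictNormalHom]
    exact congrArg (· ⊗ₜ[ℤ] L.ρ γ l) (AlgEquiv.restrictNormal_commutes γ E a)
  | add x y hx hy => simp only [map_add, hx, hy]

theorem mem_invariants_semilinearRep (hL : L.splittingField ≤ E) {x : E ⊗[ℤ] L} :
    x ∈ (semilinearRep hL).invariants ↔ L.fieldEmb E x ∈ L.deRham := by
  rw [Representation.mem_invariants,
    (AlgEquiv.restrictNormalHom_surjective (AlgebraicClosure K)).forall]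
  exact forall_congr' fun γ => by
    rw [← fieldEmb_semilinearRep hL, (L.fieldEmb_injective E).eq_iff]

variable [FiniteDimensional K E]

theorem span_fieldEmb_mem_deRham_eq_top (hL : L.splittingField ≤ E) :
    Submodule.span E {x | L.fieldEmb E x ∈ L.deRham} = ⊤ := by
  have : IsGalois K E := {}
  rw [← span_invariants_eq_top (semilinearRep_smul hL)]
  congr 1
  ext x
  exact (mem_invariants_semilinearRep hL).symm

theorem exists_extend_deRham (hL : L.splittingField ≤ E) (hL' : L'.splittingField ≤ E)
    (f : L.deRham →ₗ[K] L'.deRham) : ∃ M : E ⊗[ℤ] L →ₗ[E] E ⊗[ℤ] L',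
      ∀ x (hx : L.fieldEmb E x ∈ L.deRham), L'.fieldEmb E (M x) = f ⟨_, hx⟩ := by
  have : IsGalois K E := {}
  let i : (semilinearRep hL).invariants →ₗ[K] L.deRham :=
    (L.fieldEmb E).restrict fun x hx => (mem_invariants_semilinearRep hL).mp hx
  have hrange (x : L'.deRham) : (x : AlgebraicClosure K ⊗[ℤ] L') ∈
      LinearMap.range (L'.fieldEmb E) := exists_fieldEmb_of_le hL' x.2
  let e := LinearEquiv.ofInjective (L'.fieldEmb E) (L'.fieldEmb_injective E)
  let j : L'.deRham →ₗ[K] E ⊗[ℤ] L' :=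
    e.symm.toLinearMap ∘ₗ L'.deRham.subtype.codRestrict _ hrange
  obtain ⟨M, hM⟩ := exists_extend_invariants (semilinearRep_smul hL) (j ∘ₗ f ∘ₗ i)
  refine ⟨M, fun x hx => ?_⟩
  rw [hM ⟨x, (mem_invariants_semilinearRep hL).mpr hx⟩]
  exact congrArg Subtype.val (e.apply_symm_apply ⟨_, hrange (f ⟨_, hx⟩)⟩)

end Descent

end Lattice

/-! ## Compatibility with the Frobenius maps -/

/-- The `A`-linear extension to `A ⊗ L` of an additive map from `L` to an `A`-module. -/
def extendScalarsInt {A L X : Type*} [CommRing A] [AddCommGroup L] [AddCommGroup X] [Module A X]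
    (g : L →+ X) : A ⊗[ℤ] L →ₗ[A] X :=
  LinearMap.liftBaseChange A g.toIntLinearMap

namespace Lattice

section LocalExtension

-- Without it the `K_v ⊗_K E`-module `(K_v ⊗_K E) ⊗ L` is not found.
set_option maxSynthPendingDepth 3

variable {K : Type u} [Field K] [NumberField K] {L L' : Lattice K}
  {v : HeightOneSpectrum (𝓞 K)} {E : IntermediateField K (AlgebraicClosure K)}

variable (L v E) in
/-- The canonical map `E ⊗ L → (K_v ⊗_K E) ⊗ L`. -/
def toLocal : E ⊗[ℤ] L →ₗ[K] (v.adicCompletion K ⊗[K] E) ⊗[ℤ] L :=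
  AlgebraTensorModule.map Algebra.TensorProduct.includeRight.toLinearMap LinearMap.id

@[simp] theorem toLocal_tmul (a : E) (l : L) :
    L.toLocal v E (a ⊗ₜ l) = ((1 : v.adicCompletion K) ⊗ₜ[K] a) ⊗ₜ l := rfl

theorem localEmb_toLocal (x : E ⊗[ℤ] L) :
    L.localEmb v E (L.toLocal v E x) = 1 ⊗ₜ L.fieldEmb E x := by
  induction x with
  | zero => simp only [map_zero, tmul_zero]
  | tmul a l => rfl
  | add x y hx hy => simp only [map_add, tmul_add, hx, hy]

theorem toLocal_smul (e : E) (x : E ⊗[ℤ] L) :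
    L.toLocal v E (e • x) = ((1 : v.adicCompletion K) ⊗ₜ[K] e) • L.toLocal v E x := by
  induction x with
  | zero => simp only [smul_zero, map_zero]
  | tmul a l =>
    simp only [TensorProduct.smul_tmul', toLocal_tmul, smul_eq_mul,
      Algebra.TensorProduct.tmul_mul_tmul, one_mul]
  | add x y hx hy => simp only [smul_add, map_add, hx, hy]

theorem localFrob_smul_eq_frobOver_smul (b : v.adicCompletion K ⊗[K] E)
    (x : (v.adicCompletion K ⊗[K] E) ⊗[ℤ] L) :
    L.localFrob v E (b • x) = frobOver v E b • L.localFrob v E x := by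
  induction x with
  | zero => simp only [smul_zero, map_zero]
  | tmul y l => simp only [TensorProduct.smul_tmul', localFrob_tmul, smul_eq_mul, map_mul]
  | add x y hx hy => simp only [smul_add, map_add, hx, hy]

variable (v) in
/-- The `K_v ⊗_K E`-linear extension of an `E`-linear map. -/
def localExtend (M : E ⊗[ℤ] L →ₗ[E] E ⊗[ℤ] L') :
    (v.adicCompletion K ⊗[K] E) ⊗[ℤ] L →ₗ[v.adicCompletion K ⊗[K] E]
      (v.adicCompletion K ⊗[K] E) ⊗[ℤ] L' :=
  extendScalarsInt ((L'.toLocal v E).toAddMonoidHom.comp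
    (M.toAddMonoidHom.comp (TensorProduct.mk ℤ E L 1).toAddMonoidHom))

theorem localExtend_toLocal (M : E ⊗[ℤ] L →ₗ[E] E ⊗[ℤ] L') (x : E ⊗[ℤ] L) :
    localExtend v M (L.toLocal v E x) = L'.toLocal v E (M x) := by
  induction x with
  | zero => simp only [map_zero]
  | tmul a l =>
    calc localExtend v M (L.toLocal v E (a ⊗ₜ l))
        = ((1 : v.adicCompletion K) ⊗ₜ[K] a) • L'.toLocal v E (M (1 ⊗ₜ l)) := rfl
      _ = L'.toLocal v E (M (a ⊗ₜ l)) := by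
        rw [← toLocal_smul, ← map_smul, TensorProduct.smul_tmul', smul_eq_mul, mul_one]
  | add x y hx hy => simp only [map_add, hx, hy]

section Frobenius

variable {f : L.deRham →ₗ[K] L'.deRham} {M : E ⊗[ℤ] L →ₗ[E] E ⊗[ℤ] L'}
  {φ : L.crys v →ₗ[v.adicCompletion K] L'.crys v}

theorem exists_localEmb_eq_comparison (hL : L.splittingField ≤ E)
    (hM : ∀ x (hx : L.fieldEmb E x ∈ L.deRham), L'.fieldEmb E (M x) = f ⟨_, hx⟩)
    (t : v.adicCompletion K ⊗[K] L.deRham) :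
    ∃ y, L.localEmb v E y = L.comparison v t ∧ L'.localEmb v E (localExtend v M y) =
      L'.comparison v (f.baseChange (v.adicCompletion K) t) := by
  induction t with
  | zero => exact ⟨0, by simp only [map_zero, ZeroMemClass.coe_zero, and_self]⟩
  | tmul c d =>
    obtain ⟨d, hd⟩ := d
    obtain ⟨x, rfl⟩ := exists_fieldEmb_of_le hL hd
    refine ⟨c • L.toLocal v E x, ?_, ?_⟩
    · rw [map_smul, localEmb_toLocal, TensorProduct.smul_tmul', smul_eq_mul, mul_one]
      rfl
    · rw [LinearMap.map_smul_of_tower, localExtend_toLocal, map_smul, localEmb_toLocal, hM x hd,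
        TensorProduct.smul_tmul', smul_eq_mul, mul_one]
      rfl
  | add t t' ht ht' =>
    obtain ⟨y, hy, hMy⟩ := ht
    obtain ⟨y', hy', hMy'⟩ := ht'
    exact ⟨y + y', by simp only [map_add, hy, hy', Submodule.coe_add],
      by simp only [map_add, hMy, hMy', Submodule.coe_add]⟩

theorem localEmb_localExtend (hL : L.splittingField ≤ E)
    (hM : ∀ x (hx : L.fieldEmb E x ∈ L.deRham), L'.fieldEmb E (M x) = f ⟨_, hx⟩)
    (hφ : ∀ x, φ (L.comparison v x) = L'.comparison v (f.baseChange (v.adicCompletion K) x))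
    {y : (v.adicCompletion K ⊗[K] E) ⊗[ℤ] L} {z : L.crys v} (hy : L.localEmb v E y = z) :
    L'.localEmb v E (localExtend v M y) = φ z := by
  obtain ⟨t, rfl⟩ := (L.comparison v).surjective z
  obtain ⟨y', hy', hMy'⟩ := exists_localEmb_eq_comparison hL hM t
  rw [L.localEmb_injective v E (hy.trans hy'.symm), hMy', hφ]

variable [FiniteDimensional K E]

theorem localExtend_localFrob_of_mem_crys (hL : L.splittingField ≤ E) (hL' : L'.splittingField ≤ E)
    (hM : ∀ x (hx : L.fieldEmb E x ∈ L.deRham), L'.fieldEmb E (M x) = f ⟨_, hx⟩)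
    (hX : v ∈ L.goodPlaces) (hY : v ∈ L'.goodPlaces) (hE : IsUnramifiedIn v E)
    (hφ : ∀ x, φ (L.comparison v x) = L'.comparison v (f.baseChange (v.adicCompletion K) x))
    (hφF : ∀ x, φ (L.crysFrob v hX.1 hX.2 x) = L'.crysFrob v hY.1 hY.2 (φ x))
    {y : (v.adicCompletion K ⊗[K] E) ⊗[ℤ] L} (hy : L.localEmb v E y ∈ L.crys v) :
    localExtend v M (L.localFrob v E y) = L'.localFrob v E (localExtend v M y) := by
  let z : L.crys v := ⟨_, hy⟩
  have hMy : L'.localEmb v E (localExtend v M y) = φ z := localEmb_localExtend hL hM hφ rfl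
  apply L'.localEmb_injective v E
  calc L'.localEmb v E (localExtend v M (L.localFrob v E y))
      = φ (L.crysFrob v hX.1 hX.2 z) := localEmb_localExtend hL hM hφ
        (L.coe_crysFrob hX.1 hX.2 z E hL hE y rfl).symm
    _ = L'.crysFrob v hY.1 hY.2 (φ z) := by rw [hφF]
    _ = L'.localEmb v E (L'.localFrob v E (localExtend v M y)) :=
        L'.coe_crysFrob hY.1 hY.2 (φ z) E hL' hE _ hMy

theorem localFrob_toLocal_map_one_tmul [Normal K E] (hL : L.splittingField ≤ E)
    (hL' : L'.splittingField ≤ E)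
    (hM : ∀ x (hx : L.fieldEmb E x ∈ L.deRham), L'.fieldEmb E (M x) = f ⟨_, hx⟩)
    (hX : v ∈ L.goodPlaces) (hY : v ∈ L'.goodPlaces) (hE : IsUnramifiedIn v E)
    (hφ : ∀ x, φ (L.comparison v x) = L'.comparison v (f.baseChange (v.adicCompletion K) x))
    (hφF : ∀ x, φ (L.crysFrob v hX.1 hX.2 x) = L'.crysFrob v hY.1 hY.2 (φ x)) (l : L) :
    L'.localFrob v E (L'.toLocal v E (M (1 ⊗ₜ l))) = L'.toLocal v E (M (1 ⊗ₜ l)) := by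
  have hcomm (x : E ⊗[ℤ] L) : localExtend v M (L.localFrob v E (L.toLocal v E x)) =
      L'.localFrob v E (localExtend v M (L.toLocal v E x)) := by
    have hx : x ∈ Submodule.span E {x | L.fieldEmb E x ∈ L.deRham} := by
      rw [span_fieldEmb_mem_deRham_eq_top hL]
      exact Submodule.mem_top
    induction hx using Submodule.span_induction with
    | mem x hx =>
      refine localExtend_localFrob_of_mem_crys hL hL' hM hX hY hE hφ hφF ?_
      rw [localEmb_toLocal]
      exact baseChange_mem_fixedVectors _ L.galAct (1 ⊗ₜ ⟨_, hx⟩)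
    | zero => simp only [map_zero]
    | add x y _ _ hx hy => simp only [map_add, hx, hy]
    | smul e x _ hx => simp only [toLocal_smul, localFrob_smul_eq_frobOver_smul, map_smul, hx]
  have hl : L.localFrob v E (L.toLocal v E (1 ⊗ₜ l)) = L.toLocal v E (1 ⊗ₜ l) :=
    congrArg (· ⊗ₜ[ℤ] l) (map_one (frobOver v E))
  rw [← localExtend_toLocal, ← hcomm, hl]

end Frobenius

variable {ι : Type*} [DecidableEq ι] (β : Module.Basis ι ℤ L)

theorem equivFinsupp_localFrob (z : (v.adicCompletion K ⊗[K] E) ⊗[ℤ] L) (j : ι) :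
    equivFinsuppOfBasisRight β (L.localFrob v E z) j =
      frobOver v E (equivFinsuppOfBasisRight β z j) := by
  induction z with
  | zero => simp only [map_zero, Finsupp.coe_zero, Pi.zero_apply]
  | tmul b l =>
    rw [localFrob_tmul, equivFinsuppOfBasisRight_apply_tmul_apply,
      equivFinsuppOfBasisRight_apply_tmul_apply, map_zsmul]
  | add x y hx hy => simp only [map_add, Finsupp.add_apply, hx, hy]

theorem equivFinsupp_toLocal (x : E ⊗[ℤ] L) (j : ι) :
    equivFinsuppOfBasisRight β (L.toLocal v E x) j =
      (1 : v.adicCompletion K) ⊗ₜ[K] equivFinsuppOfBasisRight β x j := by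
  induction x with
  | zero => simp only [map_zero, Finsupp.coe_zero, Pi.zero_apply, tmul_zero]
  | tmul a l =>
    rw [toLocal_tmul, equivFinsuppOfBasisRight_apply_tmul_apply,
      equivFinsuppOfBasisRight_apply_tmul_apply]
    exact (map_zsmul (TensorProduct.mk K (v.adicCompletion K) E 1) _ a).symm
  | add x y hx hy => simp only [map_add, Finsupp.add_apply, hx, hy, tmul_add]

theorem frobOver_equivFinsupp {x : E ⊗[ℤ] L}
    (hx : L.localFrob v E (L.toLocal v E x) = L.toLocal v E x) (j : ι) :
    frobOver v E ((1 : v.adicCompletion K) ⊗ₜ[K] equivFinsuppOfBasisRight β x j) =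
      1 ⊗ₜ equivFinsuppOfBasisRight β x j := by
  rw [← equivFinsupp_toLocal, ← equivFinsupp_localFrob, hx]

end LocalExtension

end Lattice

/-! ## Fullness -/

theorem exists_zsmul_eq_one_tmul {A P Q ι : Type*} [CommRing A] [Algebra ℚ A]
    [AddCommGroup P] [Module.Free ℤ P] [Module.Finite ℤ P] [AddCommGroup Q]
    [Finite ι] [DecidableEq ι] (β : Module.Basis ι ℤ Q) (M : P →ₗ[ℤ] A ⊗[ℤ] Q)
    (hM : ∀ p j, equivFinsuppOfBasisRight β (M p) j ∈ Set.range (algebraMap ℚ A)) :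
    ∃ (d : ℤ) (h : P →ₗ[ℤ] Q), d ≠ 0 ∧ ∀ p, d • M p = 1 ⊗ₜ h p := by
  have := Fintype.ofFinite ι
  let b := Module.Free.chooseBasis ℤ P
  choose q hq using fun x : Module.Free.ChooseBasisIndex ℤ P × ι => hM (b x.1) x.2
  obtain ⟨d, hd⟩ := IsLocalization.exist_integer_multiples_of_finite (nonZeroDivisors ℤ) q
  choose n hn using hd
  let h : P →ₗ[ℤ] Q := b.constr ℤ fun i => ∑ j, n (i, j) • β j
  refine ⟨d, h, nonZeroDivisors.coe_ne_zero d, fun p => ?_⟩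
  suffices hb : (d : ℤ) • M = TensorProduct.mk ℤ A Q 1 ∘ₗ h from LinearMap.congr_fun hb p
  refine b.ext fun i => (equivFinsuppOfBasisRight β).injective ?_
  ext1 j
  have hn' : (n (i, j) : A) = (d : ℤ) • algebraMap ℚ A (q (i, j)) := by
    simpa using congrArg (algebraMap ℚ A) (hn (i, j))
  have hh : h (b i) = ∑ j, n (i, j) • β j := b.constr_basis _ _ _
  calc equivFinsuppOfBasisRight β ((d : ℤ) • M (b i)) j
      = (n (i, j) : A) := by rw [map_zsmul, Finsupp.smul_apply, hn', hq]
    _ = equivFinsuppOfBasisRight β (1 ⊗ₜ h (b i)) j := by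
      rw [equivFinsuppOfBasisRight_apply_tmul_apply, hh, β.repr_sum_self, zsmul_eq_mul, mul_one]

namespace Lattice

section Hom

variable {K : Type u} [Field K] {L L' : Lattice K}
  {E : IntermediateField K (AlgebraicClosure K)}

theorem mapTensor_fieldEmb (h : L →ₗ[ℤ] L') (x : E ⊗[ℤ] L) :
    mapTensor h (L.fieldEmb E x) = L'.fieldEmb E (h.baseChange E x) := by
  induction x with
  | zero => simp only [map_zero]
  | tmul a l => rfl
  | add x y hx hy => simp only [map_add, hx, hy]

theorem mem_hom_of_mapTensor_mem_deRham [CharZero K] [FiniteDimensional K E] [Normal K E]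
    (hL : L.splittingField ≤ E) {h : L →ₗ[ℤ] L'}
    (hh : ∀ x ∈ L.deRham, mapTensor h x ∈ L'.deRham) : h ∈ Lattice.Hom L L' := by
  intro γ
  let Γ := AlgebraTensorModule.congr (R := ℤ) γ.toLinearEquiv (LinearEquiv.refl ℤ L')
  have hΓL : Γ.toLinearMap ∘ₗ mapTensor (h ∘ₗ L.ρ γ) = mapTensor h ∘ₗ L.galAct γ := by
    ext
    rfl
  have hΓL' : Γ.toLinearMap ∘ₗ mapTensor (L'.ρ γ ∘ₗ h) = L'.galAct γ ∘ₗ mapTensor h := by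
    ext
    rfl
  have hE : (h ∘ₗ L.ρ γ).baseChange E = (L'.ρ γ ∘ₗ h).baseChange E := by
    refine LinearMap.ext_on (span_fieldEmb_mem_deRham_eq_top hL) fun x hx => ?_
    apply L'.fieldEmb_injective E
    rw [← mapTensor_fieldEmb, ← mapTensor_fieldEmb]
    apply Γ.injective
    calc Γ (mapTensor (h ∘ₗ L.ρ γ) (L.fieldEmb E x))
        = mapTensor h (L.galAct γ (L.fieldEmb E x)) := LinearMap.congr_fun hΓL _
      _ = L'.galAct γ (mapTensor h (L.fieldEmb E x)) := by rw [hx γ, hh _ hx γ]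
      _ = Γ (mapTensor (L'.ρ γ ∘ₗ h) (L.fieldEmb E x)) := (LinearMap.congr_fun hΓL' _).symm
  ext l
  exact Module.Flat.tensorProduct_mk_injective ℤ L' E (LinearMap.congr_fun hE (1 ⊗ₜ l))

end Hom

section Fullness

variable {K : Type u} [Field K] [NumberField K] {L L' : Lattice K}
  {E : IntermediateField K (AlgebraicClosure K)} [FiniteDimensional K E] [Normal K E]
  {f : L.deRham →ₗ[K] L'.deRham} {M : E ⊗[ℤ] L →ₗ[E] E ⊗[ℤ] L'}

theorem exists_zsmul_eq_baseChange (hf : IsOgHom L.toOg L'.toOg f)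
    (hL : L.splittingField ≤ E) (hL' : L'.splittingField ≤ E)
    (hM : ∀ x (hx : L.fieldEmb E x ∈ L.deRham), L'.fieldEmb E (M x) = f ⟨_, hx⟩) :
    ∃ (d : ℤ) (h : L →ₗ[ℤ] L'), d ≠ 0 ∧ d • M = h.baseChange E := by
  classical
  let β := Module.Free.chooseBasis ℤ L'
  have hrat (l j) : equivFinsuppOfBasisRight β (M (1 ⊗ₜ l)) j ∈ Set.range (algebraMap ℚ E) := by
    refine mem_range_of_frobOver_eq (K := K) ?_
    filter_upwards [hf, eventually_cofinite.mpr (finite_not_isUnramifiedIn K E)] with v hv hE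
    obtain ⟨hX, hY, φ, hφ, hφF⟩ := hv
    exact frobOver_equivFinsupp β
      (localFrob_toLocal_map_one_tmul hL hL' hM hX hY hE hφ hφF l) j
  obtain ⟨d, h, hd, hh⟩ := exists_zsmul_eq_one_tmul β
    (M.restrictScalars ℤ ∘ₗ TensorProduct.mk ℤ E L 1) hrat
  exact ⟨d, h, hd, AlgebraTensorModule.curry_injective <| LinearMap.ext_ring <| LinearMap.ext hh⟩

theorem realize_surjective (hf : IsOgHom L.toOg L'.toOg f) : ∃ x, realize L L' x = f := by
  obtain ⟨E, _, _, hL, hL'⟩ := exists_normal_splittingField_le L L'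
  obtain ⟨M, hM⟩ := exists_extend_deRham hL hL' f
  obtain ⟨d, h, hd, hdM⟩ := exists_zsmul_eq_baseChange hf hL hL' hM
  have hdf (x : L.deRham) : mapTensor h x = d • (f x : AlgebraicClosure K ⊗[ℤ] L') := by
    obtain ⟨x, hx⟩ := x
    obtain ⟨y, rfl⟩ := exists_fieldEmb_of_le hL hx
    rw [mapTensor_fieldEmb, ← hdM, LinearMap.smul_apply, map_zsmul, hM y hx]
  have hh : h ∈ Lattice.Hom L L' := by
    refine mem_hom_of_mapTensor_mem_deRham hL fun x hx => ?_
    rw [hdf ⟨x, hx⟩]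
    exact zsmul_mem (f ⟨x, hx⟩).2 d
  have hdK : (d : K) • f = deRhamMap ⟨h, hh⟩ := by
    ext x
    rw [LinearMap.smul_apply, Submodule.coe_smul, Int.cast_smul_eq_zsmul]
    exact (hdf x).symm
  refine ⟨(d : ℚ)⁻¹ ⊗ₜ ⟨h, hh⟩, ?_⟩
  rw [realize_tmul, ← hdK, map_inv₀, map_intCast, inv_smul_smul₀ (Int.cast_ne_zero.mpr hd)]

end Fullness

end Lattice

end OgusRealization

end

theorem lemma3p8 (K : Type*) [Field K] [NumberField K] :
    (OgusRealization.ogusRealization K).Full := by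
  refine ⟨fun {M N} f => ?_⟩
  obtain ⟨x, hx⟩ := OgusRealization.Lattice.realize_surjective f.hom.isOgHom
  exact ⟨x, OgusRealization.FOg.Hom.ext (OgusRealization.Og.Hom.ext hx)⟩
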